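/- Let $\Delta^5$ be the 5-simplex with vertices $1,\dots,6$; orient every simplex by the increasing order of its vertices. Attach to each of the fifteen tetrahedra $t$ of $\Delta^5$ a Grassmann variable $x_t$ (over $\mathbb C$), and write $\partial_t$ for the left derivative with respect to $x_t$. The scalar product of two operators $d=\sum_t(\beta_t\partial_t+\gamma_tx_t)$, $d'=\sum_t(\beta'_t\partial_t+\gamma'_tx_t)$ is their anticommutator $\langle d,d'\rangle=\sum_t(\beta_t\gamma'_t+\beta'_t\gamma_t)$, and $d|_t=\beta_t\partial_t+\gamma_tx_t$ is the $t$-component of $d$. For a 4-simplex $u$ let $V_u$ be a maximal isotropic subspace of the ten-dimensional space of operators involving only the tetrahedra $t\subset u$. An edge operator for an edge $a\subset u$ is an element of $V_u$ whose $t$-components vanish for all $t\not\supset a$. Suppose that for each edge $a\subset u$ the edge operators form a one-dimensional space, spanned by $d^{(u)}_a\neq 0$; that the $d_a^{(u)}$ are normalized so that $\sum_{a\subset u}(\delta f)_a\,d_a^{(u)}=0$ for every 0-cochain $f$; and that the $d^{(u)}_a$ span $V_u$. For a 2-cocycle $\Omega$ on $\partial\Delta^5$ (with complex coefficients) we say that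 $V_u$ and $(d_a^{(u)})_a$ are built from $\Omega$ if $\Omega|_u\ne 0$ and there is a 1-cochain $\nu$ on $u$ with $\delta\nu=\Omega|_u$ and $\sum_{a\subset u}\nu_a d_a^{(u)}=0$. A quasi-Gaussian weight for $V_u$ is a nonzero element $\mathcal W_u$ of the Grassmann algebra generated by the $x_t$, $t\subset u$, annihilated by all operators in $V_u$. A gauge transformation consists of substitutions $x_t\mapsto\lambda_tx_t$, $\partial_t\mapsto\lambda_t^{-1}\partial_t$ ($\lambda_t\in\mathbb C\setminus\{0\}$), followed by interchanges $\partial_t\leftrightarrow x_t$ for some of the $t$. The left-hand side of the Pachner move 3–3 consists of the 4-simplices $12345,12346,12356$ and its right-hand side of $12456,13456,23456$. **Theorem.** For every 2-cocycle $\Omega$ in some nonempty Zariski open subset of the space of 2-cocycles on $\partial\Delta^5$ the following holds. 1. For each of the six 4-simplices $u$ there exist $V_u$ and edge operators $(d_a^{(u)})_a$ built from $\Omega$. 2. Any such family can be transformed, by multiplying all $d_a^{(u)}$ for each $u$ by a common nonzero factor and applying to each $u$ separately a gauge transformation, into a family, again built from $\Omega$, that satisfies both of the following consistency conditions: * (inner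 tetrahedra) if $t=u_1\cap u_2$ with $u_1\neq u_2$ on the same side of the move, $a\subset t$ is an edge and $d_a^{(u_1)}|_t=\beta\partial_t+\gamma x_t$, then $d_a^{(u_2)}|_t=\beta\partial_t-\gamma x_t$; * (boundary tetrahedra) if $t=u_1\cap u_2$ with $u_1$ on the left-hand side and $u_2$ on the right-hand side, and $a\subset t$ is an edge, then $d_a^{(u_1)}|_t=d_a^{(u_2)}|_t$. 3. For any family built from $\Omega$ that satisfies both consistency conditions, quasi-Gaussian weights $\mathcal W_u$ for the six $V_u$ exist, and for any choice of them there is a nonzero constant $\mathrm{const}\in\mathbb C$ with $$\iiint \mathcal W_{12345}\mathcal W_{12346}\mathcal W_{12356}\,dx_{1234}\,dx_{1235}\,dx_{1236}=\mathrm{const}\iiint \mathcal W_{12456}\mathcal W_{13456}\mathcal W_{23456}\,dx_{1456}\,dx_{2456}\,dx_{3456}.$$ Here the integrals are Berezin integrals (the right derivatives), iterated with the first listed variable innermost. -/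

import Mathlib

namespace Pachner

/-! ### Simplices of the 5-simplex and simplicial cochains

The vertices of the 5-simplex are `0, …, 5 : Fin 6`, playing the role of `1, …, 6`. -/

/-- The `k`-dimensional faces of the 5-simplex. Every simplex is oriented by the increasing order
of its vertices. -/
abbrev Simplex (k : ℕ) : Type := {s : Finset (Fin 6) // s.card = k + 1}

/-- The facet of `s` opposite to its vertex `v`. -/
def facet {k : ℕ} (s : Simplex (k + 1)) (v : Fin 6) (hv : v ∈ s.1) : Simplex k :=
  ⟨s.1.erase v, by rw [Finset.card_erase_of_mem hv, s.2]; rfl⟩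

/-- The simplicial coboundary, e.g. `(δν)_{ijk} = ν_{jk} - ν_{ik} + ν_{ij}` for `i < j < k`. -/
noncomputable def coboundary {k : ℕ} (f : Simplex k → ℂ) (s : Simplex (k + 1)) : ℂ :=
  ∑ v : {v // v ∈ s.1},
    (-1) ^ (s.1.filter (fun w => w < v.1)).card * f (facet s v.1 v.2)

/-- 2-cocycles on the boundary of the 5-simplex. -/
def IsCocycle (Ω : Simplex 2 → ℂ) : Prop := ∀ t : Simplex 3, coboundary Ω t = 0

/-- `P` holds for a generic 2-cocycle on the boundary of the 5-simplex: it holds on a nonempty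
Zariski open subset of the (linear, hence irreducible) space of 2-cocycles. -/
def ForGenericCocycle (P : (Simplex 2 → ℂ) → Prop) : Prop :=
  ∃ p : MvPolynomial (Simplex 2) ℂ,
    (∃ Ω, IsCocycle Ω ∧ MvPolynomial.eval Ω p ≠ 0) ∧
    ∀ Ω, IsCocycle Ω → MvPolynomial.eval Ω p ≠ 0 → P Ω

/-! ### The Grassmann algebra -/

/-- The Grassmann algebra with one generator for each tetrahedron. -/
abbrev Grassmann : Type := ExteriorAlgebra ℂ (Simplex 3 → ℂ)

/-- The Grassmann variable `x_t`. -/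
noncomputable def x (t : Simplex 3) : Grassmann := ExteriorAlgebra.ι ℂ (Pi.single t 1)

/-- The left derivative `∂_t`. -/
noncomputable def leftDeriv (t : Simplex 3) : Grassmann →ₗ[ℂ] Grassmann :=
  CliffordAlgebra.contractLeft (Q := (0 : QuadraticForm ℂ (Simplex 3 → ℂ))) (LinearMap.proj t)

/-- The Berezin integral `f ↦ ∫ f dx_t`, which is the right derivative; see `berezin_one`,
`berezin_x` and `berezin_mul` for its characteristic properties. -/
noncomputable def berezin (t : Simplex 3) : Grassmann →ₗ[ℂ] Grassmann :=
  (CliffordAlgebra.contractRight (Q := (0 : QuadraticForm ℂ (Simplex 3 → ℂ)))).flip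
    (LinearMap.proj t)

theorem berezin_one (t : Simplex 3) : berezin t 1 = 0 :=
  CliffordAlgebra.contractRight_one _ _

theorem berezin_x (t : Simplex 3) : berezin t (x t) = 1 := by
  refine (CliffordAlgebra.contractRight_ι _ _ _).trans ?_
  simp

theorem berezin_mul (t : Simplex 3) (g h : Grassmann)
    (hg : g ∈ Algebra.adjoin ℂ (x '' {s | s ≠ t})) : berezin t (g * h) = g * berezin t h := by
  induction hg using Algebra.adjoin_induction generalizing h with
  | mem g hg =>
    obtain ⟨s, hs, rfl⟩ := hg
    have hs' : (LinearMap.proj t : Module.Dual ℂ (Simplex 3 → ℂ)) (Pi.single s 1) = 0 := by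
      simp [Ne.symm hs]
    unfold x berezin
    rw [LinearMap.flip_apply, LinearMap.flip_apply]
    induction h using CliffordAlgebra.right_induction with
    | algebraMap r =>
      rw [CliffordAlgebra.contractRight_mul_algebraMap, CliffordAlgebra.contractRight_algebraMap,
        mul_zero]
      erw [CliffordAlgebra.contractRight_ι]
      rw [hs', map_zero, zero_mul]
    | add y z hy hz => rw [mul_add, map_add, LinearMap.add_apply, hy, hz, map_add,
        LinearMap.add_apply, mul_add]
    | mul_ι m y hy =>
      rw [← mul_assoc, CliffordAlgebra.contractRight_mul_ι, CliffordAlgebra.contractRight_mul_ι,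
        hy, mul_sub, mul_smul_comm, mul_assoc]
  | algebraMap r => rw [← Algebra.smul_def, map_smul, Algebra.smul_def]
  | add y z _ _ hy hz => rw [add_mul, map_add, hy, hz, add_mul]
  | mul y z _ _ hy hz => rw [mul_assoc, hy, hz, mul_assoc]

/-! ### First-order operators -/

/-- The operators `∑_t (β_t ∂_t + γ_t x_t)`, given by their coefficients: the `t`-component of `d`
is `d t = (β_t, γ_t)`. -/
abbrev Op : Type := Simplex 3 → ℂ × ℂ

/-- The action of an operator on the Grassmann algebra. -/
noncomputable def act (d : Op) : Grassmann →ₗ[ℂ] Grassmann :=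
  ∑ t, ((d t).1 • leftDeriv t + (d t).2 • LinearMap.mulLeft ℂ (x t))

/-- The scalar product of operators; see `act_anticomm`. -/
def scalarProd (d e : Op) : ℂ := ∑ t, ((d t).1 * (e t).2 + (e t).1 * (d t).2)

/-- The scalar product is the anticommutator. -/
theorem act_anticomm (d e : Op) :
    act d ∘ₗ act e + act e ∘ₗ act d = scalarProd d e • LinearMap.id := by
  let φ : Op → Module.Dual ℂ (Simplex 3 → ℂ) := fun d => ∑ t, (d t).1 • LinearMap.proj t
  let C : Module.Dual ℂ (Simplex 3 → ℂ) →ₗ[ℂ] Grassmann →ₗ[ℂ] Grassmann :=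
    CliffordAlgebra.contractLeft (Q := (0 : QuadraticForm ℂ (Simplex 3 → ℂ)))
  have hC : ∀ (f : Module.Dual ℂ (Simplex 3 → ℂ)) v w,
      C f (ExteriorAlgebra.ι ℂ v * w) = f v • w - ExteriorAlgebra.ι ℂ v * C f w :=
    fun f v w => CliffordAlgebra.contractLeft_ι_mul (d := f) v w
  have hCC : ∀ f g w, C f (C g w) = -C g (C f w) :=
    fun f g w => CliffordAlgebra.contractLeft_comm (d := f) (d' := g) w
  have hact : ∀ (d : Op) (w : Grassmann),
      act d w = C (φ d) w + ExteriorAlgebra.ι ℂ (fun t => (d t).2) * w := by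
    intro d w
    have h1 : (fun t => (d t).2) = ∑ t, (d t).2 • (Pi.single t 1 : Simplex 3 → ℂ) := by
      rw [← pi_eq_sum_univ' (fun t => (d t).2)]
    have h2 : C (φ d) w = ∑ t, (d t).1 • leftDeriv t w := by
      simp only [φ, map_sum, map_smul, LinearMap.sum_apply, LinearMap.smul_apply]
      rfl
    rw [h1, h2, map_sum, Finset.sum_mul, ← Finset.sum_add_distrib]
    simp [act, x, LinearMap.sum_apply]
  have hanti : ∀ v w : Simplex 3 → ℂ, ∀ z : Grassmann,
      ExteriorAlgebra.ι ℂ v * (ExteriorAlgebra.ι ℂ w * z) =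
        -(ExteriorAlgebra.ι ℂ w * (ExteriorAlgebra.ι ℂ v * z)) := by
    intro v w z
    rw [← mul_assoc, ← mul_assoc, ← neg_mul,
      eq_neg_of_add_eq_zero_left (ExteriorAlgebra.ι_add_mul_swap v w)]
  have hs : scalarProd d e = φ d (fun t => (e t).2) + φ e (fun t => (d t).2) := by
    simp [scalarProd, φ, LinearMap.sum_apply, Finset.sum_add_distrib]
  refine LinearMap.ext fun w => ?_
  simp only [LinearMap.add_apply, LinearMap.comp_apply, LinearMap.smul_apply, LinearMap.id_apply]
  rw [hact d (act e w), hact e (act d w), hact e w, hact d w, hs]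
  simp only [map_add, mul_add, hC, add_smul]
  rw [hCC (φ d) (φ e), hanti (fun t => (d t).2)]
  abel

/-- The ten-dimensional space of operators belonging to the 4-simplex `u`. -/
def opSpace (u : Simplex 4) : Submodule ℂ Op where
  carrier := {d | ∀ t : Simplex 3, ¬ t.1 ⊆ u.1 → d t = 0}
  add_mem' ha hb t ht := by simp [ha t ht, hb t ht]
  zero_mem' _ _ := rfl
  smul_mem' c _ ha t ht := by simp [ha t ht]

def IsIsotropic (V : Submodule ℂ Op) : Prop := ∀ d ∈ V, ∀ e ∈ V, scalarProd d e = 0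

/-- `V` is a maximal (with respect to inclusion) isotropic subspace of `opSpace u`. -/
def IsMaximalIsotropic (u : Simplex 4) (V : Submodule ℂ Op) : Prop :=
  Maximal (fun V' => V' ≤ opSpace u ∧ IsIsotropic V') V

/-- `W` is a quasi-Gaussian weight of the 4-simplex `u` corresponding to `V`: a nonzero element of
the Grassmann algebra generated by the `x_t`, `t ⊂ u`, annihilated by all operators in `V`. -/
def IsWeight (u : Simplex 4) (V : Submodule ℂ Op) (W : Grassmann) : Prop :=
  W ∈ Algebra.adjoin ℂ (x '' {t | t.1 ⊆ u.1}) ∧ W ≠ 0 ∧ ∀ d ∈ V, act d W = 0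

/-! ### Edge operators and cocycles of weights -/

/-- The edge operators in `V` for the edge `a`: the elements of `V` with vanishing coefficients at
all tetrahedra not containing `a`. -/
def edgeOps (V : Submodule ℂ Op) (a : Simplex 1) : Submodule ℂ Op where
  carrier := {d | d ∈ V ∧ ∀ t : Simplex 3, ¬ a.1 ⊆ t.1 → d t = 0}
  add_mem' ha hb := ⟨V.add_mem ha.1 hb.1, fun t ht => by simp [ha.2 t ht, hb.2 t ht]⟩
  zero_mem' := ⟨V.zero_mem, fun _ _ => rfl⟩
  smul_mem' c _ ha := ⟨V.smul_mem c ha.1, fun t ht => by simp [ha.2 t ht]⟩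

/-- The operator `∑_{a ⊂ u} ν_a d_a` corresponding to the 1-cochain `ν` on the 4-simplex `u`. -/
noncomputable def cochainOp (u : Simplex 4) (d : Simplex 1 → Op) (ν : Simplex 1 → ℂ) : Op :=
  ∑ a with a.1 ⊆ u.1, ν a • d a

/-- `d` is a normalized system of edge operators of the 4-simplex `u` with space `V`: for each edge
`a` of `u`, the operator `d a` is nonzero and spans the space of edge operators for `a`, and zero
corresponds to any 1-coboundary. The edge operators span `V`. (The values of `d` at edges not in
`u` are irrelevant.) -/
structure IsEdgeSystem (u : Simplex 4) (V : Submodule ℂ Op) (d : Simplex 1 → Op) : Prop where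
  ne_zero : ∀ a : Simplex 1, a.1 ⊆ u.1 → d a ≠ 0
  edgeOps_eq : ∀ a : Simplex 1, a.1 ⊆ u.1 → edgeOps V a = Submodule.span ℂ {d a}
  coboundary_eq_zero : ∀ f : Simplex 0 → ℂ, cochainOp u d (coboundary f) = 0
  span_eq : Submodule.span ℂ (d '' {a | a.1 ⊆ u.1}) = V

/-- The maximal isotropic space `V` of the 4-simplex `u` and its normalized edge operators `d` are
built from the 2-cocycle `Ω`: the restriction of `Ω` to `u` is the (nonvanishing) cocycle
corresponding to `V`, i.e. it is `δν` for a 1-cochain `ν` on `u` whose operator is zero. -/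
structure BuiltFrom (Ω : Simplex 2 → ℂ) (u : Simplex 4) (V : Submodule ℂ Op)
    (d : Simplex 1 → Op) : Prop where
  maximalIsotropic : IsMaximalIsotropic u V
  edgeSystem : IsEdgeSystem u V d
  exists_cochain : ∃ ν : Simplex 1 → ℂ, cochainOp u d ν = 0 ∧
    ∀ s : Simplex 2, s.1 ⊆ u.1 → coboundary ν s = Ω s
  nonvanishing : ∃ s : Simplex 2, s.1 ⊆ u.1 ∧ Ω s ≠ 0

/-- The gauge transformation `x_t ↦ λ_t x_t`, `∂_t ↦ λ_t⁻¹ ∂_t` for all `t`, followed by the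
interchange `∂_t ↔ x_t` for `t ∈ S`. -/
def gaugeMap (lam : Simplex 3 → ℂˣ) (S : Finset (Simplex 3)) : Op →ₗ[ℂ] Op where
  toFun d t :=
    if t ∈ S then ((lam t : ℂ) * (d t).2, ((lam t)⁻¹ : ℂˣ) * (d t).1)
    else (((lam t)⁻¹ : ℂˣ) * (d t).1, (lam t : ℂ) * (d t).2)
  map_add' d e := by
    funext t; by_cases h : t ∈ S <;> simp [h, mul_add]
  map_smul' c d := by
    funext t; by_cases h : t ∈ S <;> simp [h, mul_left_comm]

/-! ### The move 3–3 -/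

def s01234 : Simplex 4 := ⟨{0, 1, 2, 3, 4}, rfl⟩
def s01235 : Simplex 4 := ⟨{0, 1, 2, 3, 5}, rfl⟩
def s01245 : Simplex 4 := ⟨{0, 1, 2, 4, 5}, rfl⟩
def s01345 : Simplex 4 := ⟨{0, 1, 3, 4, 5}, rfl⟩
def s02345 : Simplex 4 := ⟨{0, 2, 3, 4, 5}, rfl⟩
def s12345 : Simplex 4 := ⟨{1, 2, 3, 4, 5}, rfl⟩

def t0123 : Simplex 3 := ⟨{0, 1, 2, 3}, rfl⟩
def t0124 : Simplex 3 := ⟨{0, 1, 2, 4}, rfl⟩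
def t0125 : Simplex 3 := ⟨{0, 1, 2, 5}, rfl⟩
def t0345 : Simplex 3 := ⟨{0, 3, 4, 5}, rfl⟩
def t1345 : Simplex 3 := ⟨{1, 3, 4, 5}, rfl⟩
def t2345 : Simplex 3 := ⟨{2, 3, 4, 5}, rfl⟩

/-- The 4-simplices in the left-hand side of the move. -/
def lhsSimplices : Finset (Simplex 4) := {s01234, s01235, s01245}

/-- The 4-simplices in the right-hand side of the move. -/
def rhsSimplices : Finset (Simplex 4) := {s01345, s02345, s12345}

/-- Consistency at the inner tetrahedra: if `u₁ ≠ u₂` are on the same side of the move, `a` is an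
edge of the common tetrahedron `t` of `u₁` and `u₂`, and the `t`-component of the edge operator of
`u₁` is `β ∂_t + γ x_t`, then that of `u₂` is `β ∂_t - γ x_t`. -/
def AgreeInner (d : Simplex 4 → Simplex 1 → Op) : Prop :=
  ∀ u₁ u₂ : Simplex 4, u₁ ≠ u₂ →
    (u₁ ∈ lhsSimplices ∧ u₂ ∈ lhsSimplices ∨ u₁ ∈ rhsSimplices ∧ u₂ ∈ rhsSimplices) →
    ∀ t : Simplex 3, t.1 ⊆ u₁.1 → t.1 ⊆ u₂.1 → ∀ a : Simplex 1, a.1 ⊆ t.1 →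
      d u₂ a t = ((d u₁ a t).1, -(d u₁ a t).2)

/-- Consistency at the boundary tetrahedra: if `u₁` and `u₂` are on different sides of the move and
`a` is an edge of their common tetrahedron `t`, then the edge operators of `u₁` and `u₂` for `a`
have the same `t`-component. -/
def AgreeBoundary (d : Simplex 4 → Simplex 1 → Op) : Prop :=
  ∀ u₁ ∈ lhsSimplices, ∀ u₂ ∈ rhsSimplices,
    ∀ t : Simplex 3, t.1 ⊆ u₁.1 → t.1 ⊆ u₂.1 → ∀ a : Simplex 1, a.1 ⊆ t.1 →
      d u₁ a t = d u₂ a t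

/-- `∭ W₀₁₂₃₄ W₀₁₂₃₅ W₀₁₂₄₅ dx₀₁₂₃ dx₀₁₂₄ dx₀₁₂₅`; the integral over `x₀₁₂₃` is the innermost. -/
noncomputable def lhs33 (W : Simplex 4 → Grassmann) : Grassmann :=
  berezin t0125 (berezin t0124 (berezin t0123 (W s01234 * W s01235 * W s01245)))

/-- `∭ W₀₁₃₄₅ W₀₂₃₄₅ W₁₂₃₄₅ dx₀₃₄₅ dx₁₃₄₅ dx₂₃₄₅`; the integral over `x₀₃₄₅` is the innermost. -/
noncomputable def rhs33 (W : Simplex 4 → Grassmann) : Grassmann :=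
  berezin t2345 (berezin t1345 (berezin t0345 (W s01345 * W s02345 * W s12345)))

end Pachner

open Pachner

/-!
The theorem holds for all 2-cocycles `Ω` without zero values. Such a cocycle is `δN` for a
1-cochain `N`.

**Edge operators and quadratic forms.** For a 1-cochain `μ` consider the quantities `(δμ)²/Ω` on the
triangles (`energy`) and their coboundary on the tetrahedra. On each tetrahedron this is a quadratic
form in `μ` of rank two, whose radical consists of the `μ` with `δμ` proportional to `Ω` there. Let
`β ∂_t + γ x_t` be the `t`-component of the operator `∑ μ_a d_a`. If the `d_a` are built from `Ω`,
then `βγ` is this quadratic form, up to the incidence number of `t` and `u` and a constant `κ ≠ 0`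
depending only on `u` (`BuiltFrom.exists_edgeForm`). Indeed, isotropy applied to opposite edges and
to adjacent edges, the relations at the vertices, and the vanishing of the operator of `N` determine
all products of components. Conversely, operators with this property are edge operators built from
`Ω` (`EdgeForm.builtFrom`): isotropy is `δδ = 0`, and maximality is a dimension count. Over `ℂ` a
binary quadratic form is a product of two linear forms, so such operators exist.

**Consistency.** Two factorizations of a form of rank two differ by a factor `λ_t` and possibly by
interchanging the linear forms, which is a gauge transformation. Hence, after scaling `κ` to a sign,
the operators of every `u` can be brought to a standard form in which only the sign depends on `u`
(`BuiltFrom.exists_gauge_eq`). The signs given by the orientation of `u` in the boundary of the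
5-simplex, reversed on the right-hand side of the move, give both consistency conditions.

**The relation.** Operators form a Clifford algebra acting irreducibly on the Grassmann algebra, so
that an isotropic space of dimension fifteen annihilates just one line in it
(`exists_eq_smul_of_act_eq_zero`). By consistency, the operators of a 1-cochain for the three
4-simplices on one side glue to an operator annihilating the integral
(`IsStar.act_berezin_eq_zero`), and both sides yield the same operators. Together with the `∂_t` for
the six tetrahedra `t` that are not in the boundary they span a space of dimension fifteen
(`card_add_card_le_finrank`). Both sides are therefore proportional, with a nonzero constant as soon
as both are nonzero. For this, consider the integral as a linear map on the triple tensor power of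
the Grassmann algebra, an irreducible module over triples of operators. Its kernel is stable under
the triples that descend to the integral. If these, together with the triples annihilating
`W₁ ⊗ W₂ ⊗ W₃`, span all triples, then `W₁ ⊗ W₂ ⊗ W₃` can only be in the kernel if the integral is
zero on everything, which it is not (`eq_zero_of_sup_eq_top`). The spanning condition says, dually,
that no nonzero operator in `V_u` is supported on the inner tetrahedra; it holds since an operator in
`V_u` vanishing at three tetrahedra of `u` is zero (`EdgeForm.exists_coboundary_eq_of_three`).
-/

namespace Pachner

open Module

/-! ### Representations of Clifford relations -/

section Clifford

variable {M : Type*} [AddCommGroup M] [Module ℂ M]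

/-- The annihilation operator `D` of a creation–annihilation pair has equal kernel and image, so that
its kernel has half the dimension. -/
theorem finrank_eq_two_mul_finrank_inf_ker [FiniteDimensional ℂ M] (S : Submodule ℂ M)
    (D E : Module.End ℂ M) (hD : ∀ m ∈ S, D m ∈ S) (hE : ∀ m ∈ S, E m ∈ S)
    (hDD : D * D = 0) (hDE : D * E + E * D = 1) :
    finrank ℂ S = 2 * finrank ℂ (S ⊓ LinearMap.ker D : Submodule ℂ M) := by
  have hDD' : ∀ m, D (D m) = 0 := fun m => by simpa using congrArg (fun f => f m) hDD
  have hDE' : ∀ m, D (E m) + E (D m) = m := fun m => by simpa using congrArg (fun f => f m) hDE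
  let g : S →ₗ[ℂ] S := D.restrict hD
  have hg : LinearMap.ker g = LinearMap.range g := by
    ext m
    constructor
    · intro hm
      have h0 : D m.1 = 0 := by simpa [g, Subtype.ext_iff] using hm
      refine ⟨⟨E m.1, hE _ m.2⟩, Subtype.ext ?_⟩
      have := hDE' m.1
      rw [h0, map_zero, add_zero] at this
      simpa [g] using this
    · rintro ⟨m, rfl⟩
      simp [g, Subtype.ext_iff, hDD']
  have hmap : (LinearMap.ker g).map S.subtype = S ⊓ LinearMap.ker D := by
    ext m
    simp only [Submodule.mem_map, LinearMap.mem_ker, Submodule.subtype_apply, Submodule.mem_inf]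
    constructor
    · rintro ⟨m, hm, rfl⟩
      exact ⟨m.2, by simpa [g, Subtype.ext_iff] using hm⟩
    · rintro ⟨hm, h0⟩
      exact ⟨⟨m, hm⟩, by simpa [g, Subtype.ext_iff] using h0, rfl⟩
  rw [← LinearMap.finrank_range_add_finrank_ker g, ← hg, ← hmap,
    LinearEquiv.finrank_eq (Submodule.equivSubtypeMap S (LinearMap.ker g)), two_mul]

/-- Each of `n` independent creation–annihilation pairs halves the dimension. -/
theorem finrank_eq_two_pow_mul [FiniteDimensional ℂ M] {ι : Type*} [DecidableEq ι]
    (S : Submodule ℂ M) (D E : ι → Module.End ℂ M)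
    (hD : ∀ i, ∀ m ∈ S, D i m ∈ S) (hE : ∀ i, ∀ m ∈ S, E i m ∈ S)
    (hDD : ∀ i j, D i * D j + D j * D i = 0)
    (hDE : ∀ i j, D i * E j + E j * D i = if i = j then 1 else 0) (s : Finset ι) :
    finrank ℂ S = 2 ^ s.card * finrank ℂ (S ⊓ ⨅ i ∈ s, LinearMap.ker (D i) : Submodule ℂ M) := by
  induction s using Finset.induction_on with
  | empty =>
    have : (⨅ i ∈ (∅ : Finset ι), LinearMap.ker (D i)) = ⊤ := by simp
    rw [this, inf_top_eq, Finset.card_empty, pow_zero, one_mul]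
  | insert a s ha ih =>
    rw [ih, finrank_eq_two_mul_finrank_inf_ker (S ⊓ ⨅ i ∈ s, LinearMap.ker (D i)) (D a) (E a),
      Finset.card_insert_of_notMem ha, pow_succ, mul_assoc, Finset.iInf_insert, inf_assoc,
      inf_comm (LinearMap.ker (D a))]
    · rintro m ⟨hm, hk⟩
      refine ⟨hD a m hm, ?_⟩
      simp only [SetLike.mem_coe, Submodule.mem_iInf, LinearMap.mem_ker] at hk ⊢
      intro i hi
      have := congrArg (fun f => f m) (hDD i a)
      simpa [hk i hi] using this
    · rintro m ⟨hm, hk⟩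
      refine ⟨hE a m hm, ?_⟩
      simp only [SetLike.mem_coe, Submodule.mem_iInf, LinearMap.mem_ker] at hk ⊢
      intro i hi
      have hia : i ≠ a := fun h => ha (h ▸ hi)
      have := congrArg (fun f => f m) (hDE i a)
      simpa [hk i hi, hia] using this
    · have := hDD a a
      rw [← two_smul ℂ] at this
      exact (smul_eq_zero.1 this).resolve_left two_ne_zero
    · simpa using hDE a a

variable {Y : Type*} [AddCommGroup Y] [Module ℂ Y]

/-- An isotropic subspace `L` halves the dimension of a Clifford module `dim L` times, provided
that every functional on `L` is represented by an operator preserving the module. -/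
theorem finrank_eq_two_pow_finrank_mul [FiniteDimensional ℂ M] [FiniteDimensional ℂ Y]
    (ρ : Y →ₗ[ℂ] Module.End ℂ M) (B : Y → Y → ℂ)
    (hρ : ∀ y z, ρ y * ρ z + ρ z * ρ y = B y z • 1) (S : Submodule ℂ M) (Y' L : Submodule ℂ Y)
    (hS : ∀ y ∈ Y', ∀ m ∈ S, ρ y m ∈ S) (hL : L ≤ Y') (hiso : ∀ y ∈ L, ∀ z ∈ L, B y z = 0)
    (hdual : ∀ f : Y →ₗ[ℂ] ℂ, ∃ e ∈ Y', ∀ d ∈ L, B d e = f d) :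
    finrank ℂ S = 2 ^ finrank ℂ L *
      finrank ℂ (S ⊓ ⨅ y ∈ L, LinearMap.ker (ρ y) : Submodule ℂ M) := by
  classical
  let b := finBasis ℂ L
  have hex : ∀ i, ∃ e ∈ Y', ∀ j, B (b j) e = if j = i then 1 else 0 := by
    intro i
    obtain ⟨f, hf⟩ := LinearMap.exists_extend (b.coord i)
    obtain ⟨e, he, h⟩ := hdual f
    refine ⟨e, he, fun j => ?_⟩
    rw [h _ (b j).2]
    have := congrArg (fun g => g (b j)) hf
    simpa [Finsupp.single_apply] using this
  choose e he hbe using hex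
  have key := finrank_eq_two_pow_mul S (fun i => ρ (b i)) (fun i => ρ (e i))
    (fun i => hS _ (hL (b i).2)) (fun i => hS _ (he i))
    (fun i j => by rw [hρ, hiso _ (b i).2 _ (b j).2, zero_smul])
    (fun i j => by rw [hρ, hbe]; split_ifs <;> simp) Finset.univ
  have : (⨅ i ∈ (Finset.univ : Finset (Fin (finrank ℂ L))), LinearMap.ker (ρ (b i)))
      = ⨅ y ∈ L, LinearMap.ker (ρ y) := by
    ext m
    simp only [Submodule.mem_iInf, Finset.mem_univ, forall_const, LinearMap.mem_ker]
    constructor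
    · intro h y hy
      have hy' : y = ∑ i, b.repr ⟨y, hy⟩ i • (b i : Y) := by
        refine (congrArg Subtype.val (b.sum_repr ⟨y, hy⟩)).symm.trans ?_
        rw [Submodule.coe_sum]
        rfl
      rw [hy', map_sum, LinearMap.sum_apply]
      exact Finset.sum_eq_zero fun i _ => by simp [h i]
    · exact fun h i => h _ (b i).2
  rw [key, Finset.card_univ, Fintype.card_fin, this]

/-- The submodule generated by a vector `N` killed by `V` under operators from `V` and `K` is
already generated by the operators from `K` alone. -/
theorem map_mem_of_sup_eq_top (ρ : Y →ₗ[ℂ] Module.End ℂ M) (B : Y → Y → ℂ)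
    (hρ : ∀ y z, ρ y * ρ z + ρ z * ρ y = B y z • 1) (V K : Submodule ℂ Y) (hVK : V ⊔ K = ⊤)
    (N : M) (hN : ∀ y ∈ V, ρ y N = 0) (y : Y) (m : M)
    (hm : ∀ S : Submodule ℂ M, N ∈ S → (∀ k ∈ K, ∀ m ∈ S, ρ k m ∈ S) → m ∈ S)
    (S : Submodule ℂ M) (hNS : N ∈ S) (hS : ∀ k ∈ K, ∀ m ∈ S, ρ k m ∈ S) : ρ y m ∈ S := by
  have hy : y ∈ V ⊔ K := hVK ▸ Submodule.mem_top
  obtain ⟨v, hv, k, hk, rfl⟩ := Submodule.mem_sup.1 hy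
  rw [map_add, LinearMap.add_apply]
  refine S.add_mem ?_ (hS k hk _ (hm S hNS hS))
  refine (hm (S ⊓ S.comap (ρ v)) ⟨hNS, ?_⟩ ?_).2
  · simp [hN v hv]
  · rintro k hk m ⟨h1, h2⟩
    refine ⟨hS k hk m h1, ?_⟩
    have := congrArg (fun f => f m) (hρ v k)
    simp only [LinearMap.add_apply, Module.End.mul_apply, LinearMap.smul_apply,
      Module.End.one_apply] at this
    rw [SetLike.mem_coe, Submodule.mem_comap, eq_sub_of_add_eq this]
    exact S.sub_mem (S.smul_mem _ h1) (hS k hk _ h2)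

/-- A linear map whose kernel is stable under `K` and contains a nonzero vector `N` of an
irreducible Clifford module killed by a complement `V` of `K` vanishes. -/
theorem eq_zero_of_sup_eq_top (ρ : Y →ₗ[ℂ] Module.End ℂ M) (B : Y → Y → ℂ)
    (hρ : ∀ y z, ρ y * ρ z + ρ z * ρ y = B y z • 1) (V K : Submodule ℂ Y) (hVK : V ⊔ K = ⊤)
    (hirr : ∀ S : Submodule ℂ M, S ≠ ⊥ → (∀ y, ∀ m ∈ S, ρ y m ∈ S) → S = ⊤)
    (N : M) (hN0 : N ≠ 0) (hN : ∀ y ∈ V, ρ y N = 0)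
    {P : Type*} [AddCommGroup P] [Module ℂ P] (T : M →ₗ[ℂ] P)
    (hT : ∀ k ∈ K, ∀ m, T m = 0 → T (ρ k m) = 0) (hTN : T N = 0) : T = 0 := by
  let S : Submodule ℂ M := sInf {S | N ∈ S ∧ ∀ k ∈ K, ∀ m ∈ S, ρ k m ∈ S}
  have hS : S = ⊤ := by
    apply hirr
    · intro h
      have : N ∈ S := by
        rw [Submodule.mem_sInf]
        exact fun S hS => hS.1
      rw [h] at this
      exact hN0 (by simpa using this)
    · intro y m hm
      rw [Submodule.mem_sInf] at hm ⊢
      intro S' hS'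
      exact map_mem_of_sup_eq_top ρ B hρ V K hVK N hN y m
        (fun S h1 h2 => hm S ⟨h1, h2⟩) S' hS'.1 hS'.2
  refine LinearMap.ker_eq_top.1 (top_le_iff.1 ?_)
  rw [← hS]
  exact sInf_le ⟨hTN, fun k hk m hm => hT k hk m hm⟩

end Clifford

/-! ### The Grassmann algebra as a Clifford module -/

/-- The parity involution of the Grassmann algebra. -/
noncomputable def parity : Grassmann →ₐ[ℂ] Grassmann :=
  CliffordAlgebra.involute (Q := (0 : QuadraticForm ℂ (Simplex 3 → ℂ)))

theorem parity_parity (F : Grassmann) : parity (parity F) = F :=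
  CliffordAlgebra.involute_involute F

theorem parity_ι (v : Simplex 3 → ℂ) :
    parity (ExteriorAlgebra.ι ℂ v) = -ExteriorAlgebra.ι ℂ v :=
  CliffordAlgebra.involute_ι (Q := (0 : QuadraticForm ℂ (Simplex 3 → ℂ))) v

theorem leftDeriv_ι_mul (t : Simplex 3) (v : Simplex 3 → ℂ) (F : Grassmann) :
    leftDeriv t (ExteriorAlgebra.ι ℂ v * F) =
      v t • F - ExteriorAlgebra.ι ℂ v * leftDeriv t F :=
  CliffordAlgebra.contractLeft_ι_mul (Q := (0 : QuadraticForm ℂ (Simplex 3 → ℂ))) _ v F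

theorem leftDeriv_algebraMap (t : Simplex 3) (r : ℂ) :
    leftDeriv t (algebraMap ℂ Grassmann r) = 0 :=
  CliffordAlgebra.contractLeft_algebraMap (0 : QuadraticForm ℂ (Simplex 3 → ℂ)) _ r

theorem leftDeriv_ι (t : Simplex 3) (v : Simplex 3 → ℂ) :
    leftDeriv t (ExteriorAlgebra.ι ℂ v) = algebraMap ℂ Grassmann (v t) :=
  CliffordAlgebra.contractLeft_ι (0 : QuadraticForm ℂ (Simplex 3 → ℂ)) _ v

theorem berezin_algebraMap (t : Simplex 3) (r : ℂ) :
    berezin t (algebraMap ℂ Grassmann r) = 0 :=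
  CliffordAlgebra.contractRight_algebraMap (0 : QuadraticForm ℂ (Simplex 3 → ℂ)) _ r

theorem berezin_mul_ι (t : Simplex 3) (v : Simplex 3 → ℂ) (F : Grassmann) :
    berezin t (F * ExteriorAlgebra.ι ℂ v) =
      v t • F - berezin t F * ExteriorAlgebra.ι ℂ v :=
  CliffordAlgebra.contractRight_mul_ι (Q := (0 : QuadraticForm ℂ (Simplex 3 → ℂ))) _ v F

/-- Induction along left multiplication by generators. -/
theorem grassmann_left_induction {P : Grassmann → Prop}
    (algebraMap : ∀ r : ℂ, P (algebraMap ℂ Grassmann r)) (add : ∀ a b, P a → P b → P (a + b))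
    (ι_mul : ∀ a (v : Simplex 3 → ℂ), P a → P (ExteriorAlgebra.ι ℂ v * a)) (a : Grassmann) : P a :=
  CliffordAlgebra.left_induction (Q := (0 : QuadraticForm ℂ (Simplex 3 → ℂ)))
    algebraMap add ι_mul a

/-- Induction along right multiplication by generators. -/
theorem grassmann_right_induction {P : Grassmann → Prop}
    (algebraMap : ∀ r : ℂ, P (algebraMap ℂ Grassmann r)) (add : ∀ a b, P a → P b → P (a + b))
    (mul_ι : ∀ a (v : Simplex 3 → ℂ), P a → P (a * ExteriorAlgebra.ι ℂ v)) (a : Grassmann) : P a :=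
  CliffordAlgebra.right_induction (Q := (0 : QuadraticForm ℂ (Simplex 3 → ℂ)))
    algebraMap add (fun v a h => mul_ι a v h) a

theorem leftDeriv_mul (t : Simplex 3) (a b : Grassmann) :
    leftDeriv t (a * b) = leftDeriv t a * b + parity a * leftDeriv t b := by
  induction a using grassmann_left_induction with
  | algebraMap r =>
    rw [leftDeriv_algebraMap, zero_mul, zero_add, AlgHom.commutes, ← Algebra.smul_def,
      ← Algebra.smul_def, map_smul]
  | add a c ha hc => simp only [add_mul, map_add, ha, hc]; abel
  | ι_mul a v ha =>
    rw [mul_assoc, leftDeriv_ι_mul, leftDeriv_ι_mul, ha, map_mul, parity_ι, sub_mul, mul_add,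
      smul_mul_assoc, mul_assoc, mul_assoc, neg_mul]
    abel

/-- The right derivative is the left derivative up to the sign given by the parity. -/
theorem berezin_eq_parity_leftDeriv (t : Simplex 3) (F : Grassmann) :
    berezin t F = parity (leftDeriv t F) := by
  induction F using grassmann_right_induction with
  | algebraMap r => rw [leftDeriv_algebraMap, berezin_algebraMap, map_zero]
  | add a c ha hc => simp only [map_add, ha, hc]
  | mul_ι a v ha =>
    rw [berezin_mul_ι, leftDeriv_mul, map_add, map_mul, map_mul, parity_ι, leftDeriv_ι,
      parity_parity, AlgHom.commutes, ha, mul_neg, Algebra.algebraMap_eq_smul_one, mul_smul_comm,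
      mul_one]
    abel

theorem parity_mul_x (t : Simplex 3) (a : Grassmann) : parity a * x t = x t * a := by
  unfold x
  induction a using grassmann_left_induction with
  | algebraMap r => rw [AlgHom.commutes, Algebra.commutes]
  | add a c ha hc => simp only [map_add, add_mul, mul_add, ha, hc]
  | ι_mul a v ha =>
    rw [map_mul, parity_ι, mul_assoc, ha, ← mul_assoc, ← mul_assoc, neg_mul,
      eq_neg_of_add_eq_zero_left (ExteriorAlgebra.ι_add_mul_swap v (Pi.single t 1)), neg_neg]

theorem act_apply (d : Op) (F : Grassmann) :
    act d F = ∑ t, ((d t).1 • leftDeriv t F + (d t).2 • (x t * F)) := by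
  simp [act, LinearMap.sum_apply]

/-- The operator `∂_t`. -/
noncomputable def derivOp (t : Simplex 3) : Op := Pi.single t (1, 0)

/-- The operator of multiplication by `x_t`. -/
noncomputable def mulOp (t : Simplex 3) : Op := Pi.single t (0, 1)

theorem act_derivOp (t : Simplex 3) (F : Grassmann) : act (derivOp t) F = leftDeriv t F := by
  rw [act_apply, Finset.sum_eq_single t]
  · simp [derivOp]
  · intro s _ hs
    simp [derivOp, hs]
  · simp

/-- `act` as a linear map. -/
noncomputable def actHom : Op →ₗ[ℂ] Module.End ℂ Grassmann where
  toFun := act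
  map_add' d e := by
    refine LinearMap.ext fun F => ?_
    simp only [LinearMap.add_apply, act_apply, Pi.add_apply, Prod.fst_add, Prod.snd_add, add_smul,
      ← Finset.sum_add_distrib]
    exact Finset.sum_congr rfl fun t _ => by abel
  map_smul' c d := by
    refine LinearMap.ext fun F => ?_
    simp [act_apply, Finset.smul_sum, mul_smul]

theorem actHom_anticomm (d e : Op) :
    actHom d * actHom e + actHom e * actHom d = scalarProd d e • 1 :=
  act_anticomm d e

theorem act_act (d e : Op) (F : Grassmann) :
    act d (act e F) + act e (act d F) = scalarProd d e • F := by
  simpa using congrArg (fun f => f F) (act_anticomm d e)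

theorem scalarProd_comm (d e : Op) : scalarProd d e = scalarProd e d := by
  simp only [scalarProd, add_comm]

theorem scalarProd_derivOp (t : Simplex 3) (e : Op) : scalarProd (derivOp t) e = (e t).2 := by
  unfold scalarProd
  rw [Finset.sum_eq_single t]
  · simp [derivOp]
  · intro s _ hs
    simp [derivOp, hs]
  · simp

theorem scalarProd_mulOp (t : Simplex 3) (e : Op) : scalarProd (mulOp t) e = (e t).1 := by
  unfold scalarProd
  rw [Finset.sum_eq_single t]
  · simp [mulOp]
  · intro s _ hs
    simp [mulOp, hs]
  · simp

theorem parity_leftDeriv (t : Simplex 3) (F : Grassmann) :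
    parity (leftDeriv t F) = -leftDeriv t (parity F) := by
  induction F using grassmann_left_induction with
  | algebraMap r => simp [leftDeriv_algebraMap]
  | add a c ha hc => simp only [map_add, ha, hc, neg_add]
  | ι_mul a v ha =>
    rw [leftDeriv_ι_mul, map_sub, map_smul, map_mul, map_mul, ha, parity_ι, neg_mul, neg_mul,
      map_neg, leftDeriv_ι_mul, mul_neg]
    abel

theorem parity_act (d : Op) (F : Grassmann) : parity (act d F) = -act d (parity F) := by
  rw [act_apply, act_apply, map_sum, ← Finset.sum_neg_distrib]
  refine Finset.sum_congr rfl fun t _ => ?_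
  rw [map_add, map_smul, map_smul, map_mul, parity_leftDeriv, x, parity_ι]
  simp only [smul_neg, neg_mul, neg_add]

theorem berezin_act (t : Simplex 3) (d : Op) (hd : (d t).2 = 0) (F : Grassmann) :
    berezin t (act d F) = act d (berezin t F) := by
  have h := act_act (derivOp t) d F
  rw [scalarProd_derivOp, hd, zero_smul, act_derivOp, act_derivOp] at h
  rw [berezin_eq_parity_leftDeriv, berezin_eq_parity_leftDeriv, eq_neg_of_add_eq_zero_left h,
    map_neg, parity_act, neg_neg]

/-- A common form of the Leibniz rules for `∂_t` and `x_t`. -/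
theorem act_mul_add (d e f : Op) (hde : ∀ t, (d t).1 = (e t).1) (hdf : ∀ t, (f t).1 = (e t).1)
    (hf : ∀ t, (f t).2 = (d t).2 + (e t).2) (a b : Grassmann) :
    act d a * b + parity a * act e b = act f (a * b) := by
  simp only [act_apply, Finset.sum_mul, Finset.mul_sum, ← Finset.sum_add_distrib]
  refine Finset.sum_congr rfl fun t _ => ?_
  rw [hde, hdf, hf, leftDeriv_mul, mul_add, add_mul, mul_smul_comm, mul_smul_comm, smul_mul_assoc,
    smul_mul_assoc, ← mul_assoc (parity a), parity_mul_x, mul_assoc, smul_add, add_smul]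
  abel

noncomputable instance : FiniteDimensional ℂ Grassmann :=
  ((Pi.basisFun ℂ (Simplex 3)).reindex (Fintype.equivFin (Simplex 3))).ExteriorAlgebra.finiteDimensional_of_finite

theorem finrank_grassmann : finrank ℂ Grassmann = 2 ^ Fintype.card (Simplex 3) := by
  rw [finrank_eq_card_basis
    ((Pi.basisFun ℂ (Simplex 3)).reindex (Fintype.equivFin (Simplex 3))).ExteriorAlgebra,
    Fintype.card_finset, Fintype.card_fin]

/-! ### Triple products and their integrals -/

section Tensor

open TensorProduct

variable {Y₁ Y₂ M₁ M₂ : Type*} [AddCommGroup Y₁] [Module ℂ Y₁] [AddCommGroup Y₂] [Module ℂ Y₂]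
  [AddCommGroup M₁] [Module ℂ M₁] [AddCommGroup M₂] [Module ℂ M₂]

/-- The graded tensor product of two Clifford modules, the first having parity involution `α`. -/
noncomputable def tensorRep (ρ₁ : Y₁ →ₗ[ℂ] Module.End ℂ M₁) (α : Module.End ℂ M₁)
    (ρ₂ : Y₂ →ₗ[ℂ] Module.End ℂ M₂) : Y₁ × Y₂ →ₗ[ℂ] Module.End ℂ (M₁ ⊗[ℂ] M₂) :=
  LinearMap.coprod ((TensorProduct.mapBilinear (RingHom.id ℂ) M₁ M₂ M₁ M₂).flip 1 ∘ₗ ρ₁)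
    (TensorProduct.mapBilinear (RingHom.id ℂ) M₁ M₂ M₁ M₂ α ∘ₗ ρ₂)

theorem tensorRep_tmul (ρ₁ : Y₁ →ₗ[ℂ] Module.End ℂ M₁) (α : Module.End ℂ M₁)
    (ρ₂ : Y₂ →ₗ[ℂ] Module.End ℂ M₂) (y : Y₁ × Y₂) (a : M₁) (b : M₂) :
    tensorRep ρ₁ α ρ₂ y (a ⊗ₜ b) = ρ₁ y.1 a ⊗ₜ b + α a ⊗ₜ ρ₂ y.2 b := by
  simp [tensorRep]

theorem tensorRep_anticomm (ρ₁ : Y₁ →ₗ[ℂ] Module.End ℂ M₁) (α : Module.End ℂ M₁)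
    (ρ₂ : Y₂ →ₗ[ℂ] Module.End ℂ M₂) (B₁ : Y₁ → Y₁ → ℂ) (B₂ : Y₂ → Y₂ → ℂ)
    (h₁ : ∀ y z, ρ₁ y * ρ₁ z + ρ₁ z * ρ₁ y = B₁ y z • 1)
    (h₂ : ∀ y z, ρ₂ y * ρ₂ z + ρ₂ z * ρ₂ y = B₂ y z • 1)
    (hα : ∀ a, α (α a) = a) (hα₁ : ∀ y a, α (ρ₁ y a) = -ρ₁ y (α a)) (y z : Y₁ × Y₂) :
    tensorRep ρ₁ α ρ₂ y * tensorRep ρ₁ α ρ₂ z + tensorRep ρ₁ α ρ₂ z * tensorRep ρ₁ α ρ₂ y =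
      (B₁ y.1 z.1 + B₂ y.2 z.2) • 1 := by
  refine TensorProduct.ext' fun a b => ?_
  have e₁ := congrArg (fun f => f a) (h₁ y.1 z.1)
  have e₂ := congrArg (fun f => f b) (h₂ y.2 z.2)
  simp only [LinearMap.add_apply, Module.End.mul_apply, LinearMap.smul_apply,
    Module.End.one_apply] at e₁ e₂ ⊢
  simp only [tensorRep_tmul, map_add, hα, hα₁, neg_tmul]
  rw [add_smul, smul_tmul', smul_tmul', ← e₁, smul_tmul, ← e₂, add_tmul, tmul_add]
  abel

end Tensor

section Triple

open TensorProduct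

/-- The space of triple tensors `a ⊗ (b ⊗ c)`. -/
abbrev Triple : Type := Grassmann ⊗[ℂ] (Grassmann ⊗[ℂ] Grassmann)

/-- The graded tensor cube of a Clifford module. -/
noncomputable def cubeRep {Y G : Type*} [AddCommGroup Y] [Module ℂ Y] [AddCommGroup G] [Module ℂ G]
    (ρ : Y →ₗ[ℂ] Module.End ℂ G) (α : Module.End ℂ G) :
    Y × Y × Y →ₗ[ℂ] Module.End ℂ (G ⊗[ℂ] (G ⊗[ℂ] G)) :=
  tensorRep ρ α (tensorRep ρ α ρ)

theorem cubeRep_anticomm {Y G : Type*} [AddCommGroup Y] [Module ℂ Y] [AddCommGroup G] [Module ℂ G]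
    (ρ : Y →ₗ[ℂ] Module.End ℂ G) (α : Module.End ℂ G) (B : Y → Y → ℂ)
    (h : ∀ y z, ρ y * ρ z + ρ z * ρ y = B y z • 1)
    (hα : ∀ a, α (α a) = a) (hα' : ∀ y a, α (ρ y a) = -ρ y (α a)) (y z : Y × Y × Y) :
    cubeRep ρ α y * cubeRep ρ α z + cubeRep ρ α z * cubeRep ρ α y =
      (B y.1 z.1 + (B y.2.1 z.2.1 + B y.2.2 z.2.2)) • 1 := by
  have h₂ := tensorRep_anticomm ρ α (tensorRep ρ α ρ) B (fun y z => B y.1 z.1 + B y.2 z.2) h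
    (tensorRep_anticomm ρ α ρ B B h h hα hα') hα hα' y z
  refine LinearMap.ext fun m => ?_
  have h₃ := congrArg (fun f => f m) h₂
  simp only [LinearMap.add_apply, Module.End.mul_apply, LinearMap.smul_apply,
    Module.End.one_apply] at h₃ ⊢
  exact h₃

theorem cubeRep_tmul {Y G : Type*} [AddCommGroup Y] [Module ℂ Y] [AddCommGroup G] [Module ℂ G]
    (ρ : Y →ₗ[ℂ] Module.End ℂ G) (α : Module.End ℂ G) (y : Y × Y × Y) (a b c : G) :
    cubeRep ρ α y (a ⊗ₜ (b ⊗ₜ c)) = ρ y.1 a ⊗ₜ (b ⊗ₜ c) +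
      α a ⊗ₜ (ρ y.2.1 b ⊗ₜ c + α b ⊗ₜ ρ y.2.2 c) := by
  simp only [cubeRep, tensorRep_tmul]

/-- Triples of operators acting on the three factors of a triple tensor. -/
noncomputable def tripleRep : Op × Op × Op →ₗ[ℂ] Module.End ℂ Triple :=
  cubeRep actHom parity.toLinearMap

/-- The scalar product of triples of operators. -/
noncomputable def tripleProd (y z : Op × Op × Op) : ℂ :=
  scalarProd y.1 z.1 + (scalarProd y.2.1 z.2.1 + scalarProd y.2.2 z.2.2)

theorem tripleRep_anticomm (y z : Op × Op × Op) :
    tripleRep y * tripleRep z + tripleRep z * tripleRep y = tripleProd y z • 1 :=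
  cubeRep_anticomm actHom parity.toLinearMap scalarProd actHom_anticomm parity_parity
    parity_act y z

theorem tripleRep_tmul (y : Op × Op × Op) (a b c : Grassmann) :
    tripleRep y (a ⊗ₜ (b ⊗ₜ c)) = act y.1 a ⊗ₜ (b ⊗ₜ c) +
      parity a ⊗ₜ (act y.2.1 b ⊗ₜ c + parity b ⊗ₜ act y.2.2 c) :=
  cubeRep_tmul actHom parity.toLinearMap y a b c

/-- A nonzero subspace of `Triple` stable under all triples of operators is everything. -/
theorem triple_irreducible (S : Submodule ℂ Triple) (hS0 : S ≠ ⊥)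
    (hS : ∀ y, ∀ m ∈ S, tripleRep y m ∈ S) : S = ⊤ := by
  have key := finrank_eq_two_pow_mul S
    (Sum.elim (fun t => tripleRep (derivOp t, 0, 0))
      (Sum.elim (fun t => tripleRep (0, derivOp t, 0)) fun t => tripleRep (0, 0, derivOp t)))
    (Sum.elim (fun t => tripleRep (mulOp t, 0, 0))
      (Sum.elim (fun t => tripleRep (0, mulOp t, 0)) fun t => tripleRep (0, 0, mulOp t)))
    (by rintro (t | t | t) <;> exact hS _) (by rintro (t | t | t) <;> exact hS _)
    (by
      have h0 : ∀ d, scalarProd 0 d = 0 := fun d => by simp [scalarProd]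
      rintro (s | s | s) (t | t | t) <;>
      simp only [Sum.elim_inl, Sum.elim_inr, tripleRep_anticomm, tripleProd, scalarProd_derivOp,
        h0] <;> simp [derivOp, Pi.single_apply, apply_ite])
    (by
      have h0 : ∀ d, scalarProd 0 d = 0 := fun d => by simp [scalarProd]
      rintro (s | s | s) (t | t | t) <;>
      simp only [Sum.elim_inl, Sum.elim_inr, tripleRep_anticomm, tripleProd, scalarProd_derivOp,
        h0] <;> by_cases h : s = t <;> simp [mulOp, h])
    Finset.univ
  apply Submodule.eq_top_of_finrank_eq
  refine le_antisymm S.finrank_le ?_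
  rw [finrank_tensorProduct, finrank_tensorProduct, finrank_grassmann, ← pow_add, ← pow_add]
  have hpos : 0 < finrank ℂ S := by
    rw [Nat.pos_iff_ne_zero, Ne, Submodule.finrank_eq_zero]
    exact hS0
  rw [key, Finset.card_univ, Fintype.card_sum, Fintype.card_sum] at hpos ⊢
  exact Nat.le_mul_of_pos_right _ (Nat.pos_of_mul_pos_left hpos)

/-- The product map on triple tensors. -/
noncomputable def tripleMul : Triple →ₗ[ℂ] Grassmann :=
  LinearMap.mul' ℂ Grassmann ∘ₗ LinearMap.lTensor Grassmann (LinearMap.mul' ℂ Grassmann)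

theorem tripleMul_tmul (a b c : Grassmann) : tripleMul (a ⊗ₜ (b ⊗ₜ c)) = a * (b * c) := by
  simp [tripleMul]

/-- A triple of operators with equal `∂`-parts acts on the product as a single operator, whose
`x`-part is the sum of the three `x`-parts. -/
theorem tripleMul_tripleRep (y : Op × Op × Op) (e : Op) (h₁ : ∀ t, (y.1 t).1 = (e t).1)
    (h₂ : ∀ t, (y.2.1 t).1 = (e t).1) (h₃ : ∀ t, (y.2.2 t).1 = (e t).1)
    (he : ∀ t, (e t).2 = (y.1 t).2 + (y.2.1 t).2 + (y.2.2 t).2) (m : Triple) :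
    tripleMul (tripleRep y m) = act e (tripleMul m) := by
  induction m using TensorProduct.induction_on with
  | zero => simp
  | add m n hm hn => simp only [map_add, hm, hn]
  | tmul a m =>
    induction m using TensorProduct.induction_on with
    | zero => simp
    | add m n hm hn => simp only [tmul_add, map_add, hm, hn]
    | tmul b c =>
      rw [tripleRep_tmul, map_add, tripleMul_tmul, tmul_add, map_add, tripleMul_tmul,
        tripleMul_tmul, tripleMul_tmul, ← mul_add,
        act_mul_add y.2.1 y.2.2 (fun t => ((e t).1, (y.2.1 t).2 + (y.2.2 t).2))
          (fun t => by rw [h₂, h₃]) (fun t => (h₃ t).symm) (fun _ => rfl)]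
      exact act_mul_add y.1 (fun t => ((e t).1, (y.2.1 t).2 + (y.2.2 t).2)) e h₁
        (fun _ => rfl) (fun t => by simp only [he, add_assoc]) a (b * c)

/-- The triple integral of the product; the integral over `x_{t₁}` is the innermost. -/
noncomputable def tripleIntegral (t₁ t₂ t₃ : Simplex 3) : Triple →ₗ[ℂ] Grassmann :=
  berezin t₃ ∘ₗ berezin t₂ ∘ₗ berezin t₁ ∘ₗ tripleMul

theorem tripleIntegral_tmul (t₁ t₂ t₃ : Simplex 3) (a b c : Grassmann) :
    tripleIntegral t₁ t₂ t₃ (a ⊗ₜ (b ⊗ₜ c)) =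
      berezin t₃ (berezin t₂ (berezin t₁ (a * b * c))) := by
  rw [mul_assoc, ← tripleMul_tmul]
  rfl

theorem tripleIntegral_tripleRep (t₁ t₂ t₃ : Simplex 3) (y : Op × Op × Op) (e : Op)
    (h₁ : ∀ t, (y.1 t).1 = (e t).1)
    (h₂ : ∀ t, (y.2.1 t).1 = (e t).1) (h₃ : ∀ t, (y.2.2 t).1 = (e t).1)
    (he : ∀ t, (e t).2 = (y.1 t).2 + (y.2.1 t).2 + (y.2.2 t).2)
    (he₁ : (e t₁).2 = 0) (he₂ : (e t₂).2 = 0) (he₃ : (e t₃).2 = 0) (m : Triple) :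
    tripleIntegral t₁ t₂ t₃ (tripleRep y m) = act e (tripleIntegral t₁ t₂ t₃ m) := by
  simp only [tripleIntegral, LinearMap.comp_apply]
  rw [tripleMul_tripleRep y e h₁ h₂ h₃ he, berezin_act t₁ e he₁, berezin_act t₂ e he₂,
    berezin_act t₃ e he₃]

theorem tripleIntegral_ne_zero (t₁ t₂ t₃ : Simplex 3) (h₁₂ : t₁ ≠ t₂) (h₁₃ : t₁ ≠ t₃)
    (h₂₃ : t₂ ≠ t₃) : tripleIntegral t₁ t₂ t₃ ≠ 0 := by
  intro h
  have h0 := tripleIntegral_tmul t₁ t₂ t₃ (x t₃) (x t₂) (x t₁)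
  have hx : ∀ {s t : Simplex 3}, t ≠ s → x t ∈ Algebra.adjoin ℂ (x '' {r | r ≠ s}) :=
    fun h => Algebra.subset_adjoin ⟨_, h, rfl⟩
  rw [h, LinearMap.zero_apply,
    berezin_mul t₁ _ _ (Subalgebra.mul_mem _ (hx h₁₃.symm) (hx h₁₂.symm)), berezin_x, mul_one,
    berezin_mul t₂ _ _ (hx h₂₃.symm), berezin_x, mul_one, berezin_x] at h0
  exact zero_ne_one h0

end Triple

/-- An element of the Grassmann algebra of `u` has zero derivatives in the other variables. -/
theorem leftDeriv_eq_zero_of_mem_adjoin {u : Simplex 4} {W : Grassmann}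
    (hW : W ∈ Algebra.adjoin ℂ (x '' {t | t.1 ⊆ u.1})) {t : Simplex 3} (ht : ¬ t.1 ⊆ u.1) :
    leftDeriv t W = 0 := by
  induction hW using Algebra.adjoin_induction with
  | mem g hg =>
    obtain ⟨s, hs, rfl⟩ := hg
    have hst : t ≠ s := fun h => ht (h ▸ hs)
    simp [x, leftDeriv_ι, hst]
  | algebraMap r => exact leftDeriv_algebraMap t r
  | add y z _ _ hy hz => rw [map_add, hy, hz, add_zero]
  | mul y z _ _ hy hz => rw [leftDeriv_mul, hy, hz, zero_mul, mul_zero, add_zero]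

/-- A weight of `u` is killed by an operator whose part in `u` lies in `V` and whose other
components have no `x`-part. -/
theorem IsWeight.act_eq_zero {u : Simplex 4} {V : Submodule ℂ Op} {W : Grassmann}
    (hW : IsWeight u V W) {d e : Op} (he : e ∈ V) (h : ∀ t : Simplex 3, t.1 ⊆ u.1 → d t = e t)
    (heu : e ∈ opSpace u) (h' : ∀ t : Simplex 3, ¬ t.1 ⊆ u.1 → (d t).2 = 0) : act d W = 0 := by
  have h0 := hW.2.2 e he
  rw [act_apply] at h0 ⊢
  rw [← h0]
  refine Finset.sum_congr rfl fun t _ => ?_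
  by_cases ht : t.1 ⊆ u.1
  · rw [h t ht]
  · rw [heu t ht, h' t ht, leftDeriv_eq_zero_of_mem_adjoin hW.1 ht]
    simp

/-! ### Isotropic subspaces, weights and the nonvanishing of triple integrals -/

/-- The scalar product as a bilinear form. -/
noncomputable def scalarForm : LinearMap.BilinForm ℂ Op :=
  LinearMap.mk₂ ℂ scalarProd
    (fun a b c => by
      simp only [scalarProd, Pi.add_apply, Prod.fst_add, Prod.snd_add, ← Finset.sum_add_distrib]
      exact Finset.sum_congr rfl fun t _ => by ring)
    (fun k a b => by
      simp only [scalarProd, Pi.smul_apply, Prod.smul_fst, Prod.smul_snd, smul_eq_mul,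
        Finset.mul_sum]
      exact Finset.sum_congr rfl fun t _ => by ring)
    (fun a b c => by
      simp only [scalarProd, Pi.add_apply, Prod.fst_add, Prod.snd_add, ← Finset.sum_add_distrib]
      exact Finset.sum_congr rfl fun t _ => by ring)
    (fun k a b => by
      simp only [scalarProd, Pi.smul_apply, Prod.smul_fst, Prod.smul_snd, smul_eq_mul,
        Finset.mul_sum]
      exact Finset.sum_congr rfl fun t _ => by ring)

theorem scalarForm_apply (d e : Op) : scalarForm d e = scalarProd d e := rfl

theorem eq_zero_of_scalarProd_eq_zero {d : Op} (h : ∀ e, scalarProd d e = 0) : d = 0 := by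
  funext t
  have h₁ := h (derivOp t)
  have h₂ := h (mulOp t)
  rw [scalarProd_comm, scalarProd_derivOp] at h₁
  rw [scalarProd_comm, scalarProd_mulOp] at h₂
  exact Prod.ext h₂ h₁

theorem scalarForm_nondegenerate : scalarForm.Nondegenerate :=
  ⟨fun _ h => eq_zero_of_scalarProd_eq_zero h, fun d h =>
    eq_zero_of_scalarProd_eq_zero fun e => by rw [scalarProd_comm]; exact h e⟩

theorem op_eq_sum (d : Op) : d = ∑ t, ((d t).1 • derivOp t + (d t).2 • mulOp t) := by
  funext s
  rw [Finset.sum_apply, Finset.sum_eq_single s]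
  · simp [derivOp, mulOp]
  · intro t _ ht
    simp [derivOp, mulOp, ht.symm]
  · simp

/-- Every functional on operators is the scalar product with an operator; on operators of `u` it is
the scalar product with an operator of `u`. -/
theorem exists_mem_opSpace_scalarProd_eq (u : Simplex 4) (f : Op →ₗ[ℂ] ℂ) :
    ∃ e ∈ opSpace u, ∀ d ∈ opSpace u, scalarProd d e = f d := by
  classical
  refine ⟨fun t => if t.1 ⊆ u.1 then (f (mulOp t), f (derivOp t)) else 0,
    fun t ht => if_neg ht, fun d hd => ?_⟩
  conv_rhs => rw [op_eq_sum d]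
  rw [map_sum]
  refine Finset.sum_congr rfl fun t _ => ?_
  by_cases ht : t.1 ⊆ u.1
  · simp [ht, mul_comm]
  · simp [hd t ht]

theorem exists_scalarProd_eq (f : Op →ₗ[ℂ] ℂ) : ∃ e, ∀ d, scalarProd d e = f d := by
  refine ⟨fun t => (f (mulOp t), f (derivOp t)), fun d => ?_⟩
  conv_rhs => rw [op_eq_sum d]
  rw [map_sum]
  refine Finset.sum_congr rfl fun t _ => ?_
  simp [mul_comm]

/-- An isotropic subspace of half the dimension contains everything orthogonal to it. -/
theorem mem_of_forall_scalarProd_eq_zero {L : Submodule ℂ Op} (hL : IsIsotropic L)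
    (hdim : Fintype.card (Simplex 3) ≤ finrank ℂ L) {e : Op}
    (he : ∀ d ∈ L, scalarProd d e = 0) : e ∈ L := by
  have hle : L ≤ scalarForm.orthogonal L := fun e he d hd => hL d hd e he
  have h := LinearMap.BilinForm.finrank_orthogonal scalarForm_nondegenerate L
  have h2 : finrank ℂ Op = 2 * Fintype.card (Simplex 3) := by
    rw [Module.finrank_pi_fintype]
    simp [mul_comm]
  have : L = scalarForm.orthogonal L := Submodule.eq_of_le_of_finrank_le hle (by omega)
  rw [this]
  exact fun d hd => he d hd

/-- Two nonzero elements of the Grassmann algebra killed by a space of operators of half the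
dimension are proportional. Such a space is isotropic because of the anticommutation relations. -/
theorem exists_eq_smul_of_act_eq_zero {F G : Grassmann} (hF : F ≠ 0) (hG : G ≠ 0)
    (L : Submodule ℂ Op) (hdim : Fintype.card (Simplex 3) ≤ finrank ℂ L)
    (hLF : ∀ d ∈ L, act d F = 0) (hLG : ∀ d ∈ L, act d G = 0) :
    ∃ c : ℂ, c ≠ 0 ∧ F = c • G := by
  have hiso : IsIsotropic L := by
    intro d hd e he
    have := act_act d e F
    rw [hLF e he, hLF d hd, map_zero, map_zero, add_zero] at this
    exact (smul_eq_zero.1 this.symm).resolve_right hF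
  have key := finrank_eq_two_pow_finrank_mul actHom scalarProd actHom_anticomm ⊤ ⊤ L
    (fun _ _ _ _ => Submodule.mem_top) le_top hiso
    (fun f => by
      obtain ⟨e, he⟩ := exists_scalarProd_eq f
      exact ⟨e, Submodule.mem_top, fun d _ => he d⟩)
  rw [finrank_top, finrank_grassmann, top_inf_eq] at key
  set K : Submodule ℂ Grassmann := ⨅ y ∈ L, LinearMap.ker (actHom y) with hK
  have hmem : ∀ {H : Grassmann}, (∀ d ∈ L, act d H = 0) → H ∈ K := by
    intro H hH
    simp only [hK, Submodule.mem_iInf, LinearMap.mem_ker]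
    exact hH
  have hK1 : finrank ℂ K ≤ 1 := by
    by_contra hcon
    have h1 : 2 ^ Fintype.card (Simplex 3) ≤ 2 ^ finrank ℂ L :=
      Nat.pow_le_pow_right two_pos hdim
    have h2 : 2 ^ finrank ℂ L * 2 ≤ 2 ^ finrank ℂ L * finrank ℂ K :=
      Nat.mul_le_mul_left _ (by omega)
    have h3 : 0 < 2 ^ finrank ℂ L := Nat.pow_pos two_pos
    omega
  obtain ⟨v, hv⟩ := finrank_le_one_iff.1 hK1
  obtain ⟨a, ha⟩ := hv ⟨F, hmem hLF⟩
  obtain ⟨b, hb⟩ := hv ⟨G, hmem hLG⟩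
  replace ha : a • (v : Grassmann) = F := congrArg Subtype.val ha
  replace hb : b • (v : Grassmann) = G := congrArg Subtype.val hb
  have ha0 : a ≠ 0 := fun h => hF (by rw [← ha, h, zero_smul])
  have hb0 : b ≠ 0 := fun h => hG (by rw [← hb, h, zero_smul])
  refine ⟨a / b, div_ne_zero ha0 hb0, ?_⟩
  rw [← ha, ← hb, smul_smul, div_mul_cancel₀ _ hb0]

theorem act_mem_adjoin {u : Simplex 4} {d : Op} (hd : d ∈ opSpace u) {W : Grassmann}
    (hW : W ∈ Algebra.adjoin ℂ (x '' {t : Simplex 3 | t.1 ⊆ u.1})) :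
    act d W ∈ Algebra.adjoin ℂ (x '' {t : Simplex 3 | t.1 ⊆ u.1}) := by
  have hpar : ∀ {a : Grassmann}, a ∈ Algebra.adjoin ℂ (x '' {t : Simplex 3 | t.1 ⊆ u.1}) →
      parity a ∈ Algebra.adjoin ℂ (x '' {t : Simplex 3 | t.1 ⊆ u.1}) := by
    intro a ha
    induction ha using Algebra.adjoin_induction with
    | mem g hg =>
      have hg' := Algebra.subset_adjoin (R := ℂ) hg
      obtain ⟨s, hs, rfl⟩ := hg
      rw [x, parity_ι]
      exact Subalgebra.neg_mem _ hg'
    | algebraMap r => rw [AlgHom.commutes]; exact Subalgebra.algebraMap_mem _ r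
    | add y z _ _ hy hz => rw [map_add]; exact Subalgebra.add_mem _ hy hz
    | mul y z _ _ hy hz => rw [map_mul]; exact Subalgebra.mul_mem _ hy hz
  have hder : ∀ t, leftDeriv t W ∈ Algebra.adjoin ℂ (x '' {t : Simplex 3 | t.1 ⊆ u.1}) := by
    intro t
    induction hW using Algebra.adjoin_induction with
    | mem g hg =>
      obtain ⟨s, hs, rfl⟩ := hg
      rw [x, leftDeriv_ι]
      exact Subalgebra.algebraMap_mem _ _
    | algebraMap r => rw [leftDeriv_algebraMap]; exact Subalgebra.zero_mem _
    | add y z _ _ hy hz => rw [map_add]; exact Subalgebra.add_mem _ hy hz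
    | mul y z hy' hz' hy hz =>
      rw [leftDeriv_mul]
      exact Subalgebra.add_mem _ (Subalgebra.mul_mem _ hy hz') (Subalgebra.mul_mem _ (hpar hy') hz)
  rw [act_apply]
  refine Subalgebra.sum_mem _ fun t _ => ?_
  by_cases ht : t.1 ⊆ u.1
  · exact Subalgebra.add_mem _ (Subalgebra.smul_mem _ (hder t) _)
      (Subalgebra.smul_mem _ (Subalgebra.mul_mem _ (Algebra.subset_adjoin (Set.mem_image_of_mem x ht)) hW) _)
  · rw [hd t ht]
    simp

/-- Every isotropic space of operators of `u` kills a nonzero element of the Grassmann algebra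
of `u`. -/
theorem exists_isWeight {u : Simplex 4} {V : Submodule ℂ Op} (hV : V ≤ opSpace u)
    (hiso : IsIsotropic V) : ∃ W, IsWeight u V W := by
  set S := Subalgebra.toSubmodule (Algebra.adjoin ℂ (x '' {t : Simplex 3 | t.1 ⊆ u.1})) with hS
  have key := finrank_eq_two_pow_finrank_mul actHom scalarProd actHom_anticomm S (opSpace u) V
    (fun y hy m hm => act_mem_adjoin hy hm) hV hiso
    (fun f => by
      obtain ⟨e, he, h⟩ := exists_mem_opSpace_scalarProd_eq u f
      exact ⟨e, he, fun d hd => h d (hV hd)⟩)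
  have hpos : finrank ℂ S ≠ 0 := by
    rw [Ne, Submodule.finrank_eq_zero]
    intro h
    have h1 : (1 : Grassmann) ∈ S := Subalgebra.one_mem _
    rw [h] at h1
    exact one_ne_zero ((Submodule.mem_bot ℂ).1 h1)
  rw [key] at hpos
  have hK : (S ⊓ ⨅ y ∈ V, LinearMap.ker (actHom y) : Submodule ℂ Grassmann) ≠ ⊥ := by
    intro h
    rw [h, finrank_bot, mul_zero] at hpos
    exact hpos rfl
  obtain ⟨W, hW, hW0⟩ := Submodule.exists_mem_ne_zero_of_ne_bot hK
  refine ⟨W, hW.1, hW0, fun d hd => ?_⟩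
  have := hW.2
  simp only [Submodule.mem_iInf, LinearMap.mem_ker, SetLike.mem_coe] at this
  exact this d hd

theorem exists_tripleProd_eq (f : Op × Op × Op →ₗ[ℂ] ℂ) : ∃ y, ∀ z, tripleProd z y = f z := by
  obtain ⟨e₁, h₁⟩ := exists_scalarProd_eq (f ∘ₗ LinearMap.inl ℂ Op (Op × Op))
  obtain ⟨e₂, h₂⟩ := exists_scalarProd_eq (f ∘ₗ LinearMap.inr ℂ Op (Op × Op) ∘ₗ
    LinearMap.inl ℂ Op Op)
  obtain ⟨e₃, h₃⟩ := exists_scalarProd_eq (f ∘ₗ LinearMap.inr ℂ Op (Op × Op) ∘ₗ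
    LinearMap.inr ℂ Op Op)
  refine ⟨(e₁, e₂, e₃), fun z => ?_⟩
  simp only [tripleProd, h₁, h₂, h₃, LinearMap.comp_apply, ← map_add]
  simp

/-- The operators whose part in `u` lies in `V`, the other components having no `x`-part; they all
kill the weights of `u`. -/
def extendedSpace (u : Simplex 4) (V : Submodule ℂ Op) : Submodule ℂ Op where
  carrier := {d | (∃ e ∈ V, e ∈ opSpace u ∧ ∀ t : Simplex 3, t.1 ⊆ u.1 → d t = e t) ∧
    ∀ t : Simplex 3, ¬ t.1 ⊆ u.1 → (d t).2 = 0}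
  add_mem' := by
    rintro a b ⟨⟨e, he, heu, h⟩, h'⟩ ⟨⟨e₂, he₂, heu₂, h₂⟩, h₂'⟩
    exact ⟨⟨e + e₂, V.add_mem he he₂, (opSpace u).add_mem heu heu₂,
      fun t ht => by simp [h t ht, h₂ t ht]⟩, fun t ht => by simp [h' t ht, h₂' t ht]⟩
  zero_mem' := ⟨⟨0, V.zero_mem, (opSpace u).zero_mem, fun _ _ => rfl⟩, fun _ _ => rfl⟩
  smul_mem' := by
    rintro c a ⟨⟨e, he, heu, h⟩, h'⟩
    exact ⟨⟨c • e, V.smul_mem c he, (opSpace u).smul_mem c heu,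
      fun t ht => by simp [h t ht]⟩, fun t ht => by simp [h' t ht]⟩

theorem IsWeight.act_eq_zero_of_mem {u : Simplex 4} {V : Submodule ℂ Op} {W : Grassmann}
    (hW : IsWeight u V W) {d : Op} (hd : d ∈ extendedSpace u V) : act d W = 0 := by
  obtain ⟨⟨e, he, heu, h⟩, h'⟩ := hd
  exact hW.act_eq_zero he h heu h'

/-- If `V` contains every operator of `u` orthogonal to it, then so does its extension. -/
theorem exists_eq_on_of_orthogonal {u : Simplex 4} {V : Submodule ℂ Op}
    (hV : V ≤ opSpace u) (hLag : ∀ e ∈ opSpace u, (∀ d ∈ V, scalarProd d e = 0) → e ∈ V) {y : Op}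
    (hy : ∀ d ∈ extendedSpace u V, scalarProd d y = 0) :
    (∃ e ∈ V, ∀ t : Simplex 3, t.1 ⊆ u.1 → y t = e t) ∧
      ∀ t : Simplex 3, ¬ t.1 ⊆ u.1 → (y t).2 = 0 := by
  classical
  constructor
  · refine ⟨fun t => if t.1 ⊆ u.1 then y t else 0, hLag _ (fun t ht => if_neg ht) fun d hd => ?_,
      fun t ht => (if_pos ht).symm⟩
    rw [← hy d ⟨⟨d, hd, hV hd, fun _ _ => rfl⟩, fun t ht => by rw [hV hd t ht]; rfl⟩]
    refine Finset.sum_congr rfl fun t _ => ?_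
    by_cases ht : t.1 ⊆ u.1
    · simp [ht]
    · simp [hV hd t ht]
  · intro t ht
    rw [← scalarProd_derivOp t y]
    refine hy _ ⟨⟨0, V.zero_mem, (opSpace u).zero_mem, fun s hs => ?_⟩, fun s _ => ?_⟩
    · have : s ≠ t := fun h => ht (h ▸ hs)
      simp [derivOp, this]
    · by_cases h : s = t
      · subst h; simp [derivOp]
      · simp [derivOp, h]

/-- The triples of operators that descend through the triple integral. -/
def descentSpace (I : Set (Simplex 3)) : Submodule ℂ (Op × Op × Op) where
  carrier := {y | (∀ t, (y.1 t).1 = (y.2.2 t).1) ∧ (∀ t, (y.2.1 t).1 = (y.2.2 t).1) ∧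
    ∀ t ∈ I, (y.1 t).2 + (y.2.1 t).2 + (y.2.2 t).2 = 0}
  add_mem' := by
    rintro a b ⟨h₁, h₂, h₃⟩ ⟨k₁, k₂, k₃⟩
    refine ⟨fun t => by simp [h₁, k₁], fun t => by simp [h₂, k₂], fun t ht => ?_⟩
    have e₁ := h₃ t ht
    have e₂ := k₃ t ht
    simp only [Prod.fst_add, Prod.snd_add, Pi.add_apply]
    linear_combination e₁ + e₂
  zero_mem' := ⟨fun _ => rfl, fun _ => rfl, fun _ _ => by simp⟩
  smul_mem' := by
    rintro c a ⟨h₁, h₂, h₃⟩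
    refine ⟨fun t => by simp [h₁], fun t => by simp [h₂], fun t ht => ?_⟩
    have e₁ := h₃ t ht
    simp only [Prod.smul_fst, Prod.smul_snd, Pi.smul_apply, smul_eq_mul]
    linear_combination c * e₁

theorem tripleIntegral_tripleRep_of_mem {t₁ t₂ t₃ : Simplex 3} {y : Op × Op × Op}
    (hy : y ∈ descentSpace {t₁, t₂, t₃}) (m : Triple) :
    tripleIntegral t₁ t₂ t₃ (tripleRep y m) =
      act (fun t => ((y.2.2 t).1, (y.1 t).2 + (y.2.1 t).2 + (y.2.2 t).2))
        (tripleIntegral t₁ t₂ t₃ m) :=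
  tripleIntegral_tripleRep t₁ t₂ t₃ y
    (fun t => ((y.2.2 t).1, (y.1 t).2 + (y.2.1 t).2 + (y.2.2 t).2)) hy.1 hy.2.1 (fun _ => rfl)
    (fun _ => rfl)
    (hy.2.2 t₁ (by simp)) (hy.2.2 t₂ (by simp)) (hy.2.2 t₃ (by simp)) m

theorem scalarProd_zero_left (d : Op) : scalarProd 0 d = 0 := by simp [scalarProd]

theorem scalarProd_neg_left (d e : Op) : scalarProd (-d) e = -scalarProd d e := by
  simp only [← scalarForm_apply, map_neg, LinearMap.neg_apply]

/-- The transversality behind the nonvanishing of the triple integrals: by duality, it amounts to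
there being no nonzero operator in the spaces `Vᵢ` supported on the tetrahedra in `I`. -/
theorem extendedSpace_prod_sup_descentSpace {u₁ u₂ u₃ : Simplex 4} {V₁ V₂ V₃ : Submodule ℂ Op}
    {I : Set (Simplex 3)} (hV₁ : V₁ ≤ opSpace u₁) (hV₂ : V₂ ≤ opSpace u₂) (hV₃ : V₃ ≤ opSpace u₃)
    (hL₁ : ∀ e ∈ opSpace u₁, (∀ d ∈ V₁, scalarProd d e = 0) → e ∈ V₁)
    (hL₂ : ∀ e ∈ opSpace u₂, (∀ d ∈ V₂, scalarProd d e = 0) → e ∈ V₂)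
    (hL₃ : ∀ e ∈ opSpace u₃, (∀ d ∈ V₃, scalarProd d e = 0) → e ∈ V₃)
    (h₁ : ∀ d ∈ V₁, (∀ t ∉ I, d t = 0) → d = 0) (h₂ : ∀ d ∈ V₂, (∀ t ∉ I, d t = 0) → d = 0)
    (h₃ : ∀ d ∈ V₃, (∀ t ∉ I, d t = 0) → d = 0)
    (h₁₂ : ∀ t : Simplex 3, t.1 ⊆ u₁.1 → t.1 ⊆ u₂.1 → t ∈ I)
    (h₁₃ : ∀ t : Simplex 3, t.1 ⊆ u₁.1 → t.1 ⊆ u₃.1 → t ∈ I)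
    (h₂₃ : ∀ t : Simplex 3, t.1 ⊆ u₂.1 → t.1 ⊆ u₃.1 → t ∈ I)
    (hI : ∀ t ∈ I, t.1 ⊆ u₁.1 ∨ t.1 ⊆ u₂.1 ∨ t.1 ⊆ u₃.1) :
    (extendedSpace u₁ V₁).prod ((extendedSpace u₂ V₂).prod (extendedSpace u₃ V₃)) ⊔
      descentSpace I = ⊤ := by
  by_contra hne
  obtain ⟨y₀, -, hy₀⟩ := SetLike.exists_of_lt (lt_top_iff_ne_top.2 hne)
  obtain ⟨f, hf, hle⟩ := Submodule.exists_le_ker_of_notMem hy₀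
  obtain ⟨y, hy⟩ := exists_tripleProd_eq f
  have hE : ∀ z, z ∈ (extendedSpace u₁ V₁).prod
      ((extendedSpace u₂ V₂).prod (extendedSpace u₃ V₃)) → tripleProd z y = 0 :=
    fun z hz => (hy z).trans (hle (Submodule.mem_sup_left hz))
  have hK : ∀ z, z ∈ descentSpace I → tripleProd z y = 0 :=
    fun z hz => (hy z).trans (hle (Submodule.mem_sup_right hz))
  obtain ⟨⟨e₁, he₁, hye₁⟩, hg₁⟩ := exists_eq_on_of_orthogonal hV₁ hL₁ (y := y.1) fun d hd => by
    have := hE (d, 0, 0) ⟨hd, Submodule.zero_mem _⟩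
    simpa [tripleProd, scalarProd_zero_left] using this
  obtain ⟨⟨e₂, he₂, hye₂⟩, hg₂⟩ := exists_eq_on_of_orthogonal hV₂ hL₂ (y := y.2.1) fun d hd => by
    have := hE (0, d, 0) ⟨Submodule.zero_mem _, hd, Submodule.zero_mem _⟩
    simpa [tripleProd, scalarProd_zero_left] using this
  obtain ⟨⟨e₃, he₃, hye₃⟩, hg₃⟩ := exists_eq_on_of_orthogonal hV₃ hL₃ (y := y.2.2) fun d hd => by
    have := hE (0, 0, d) ⟨Submodule.zero_mem _, Submodule.zero_mem _, hd⟩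
    simpa [tripleProd, scalarProd_zero_left] using this
  have hγ : ∀ t, (y.1 t).2 + (y.2.1 t).2 + (y.2.2 t).2 = 0 := by
    intro t
    have := hK (derivOp t, derivOp t, derivOp t) ⟨fun _ => rfl, fun _ => rfl, fun s _ => by
      by_cases h : s = t
      · subst h; simp [derivOp]
      · simp [derivOp, h]⟩
    simpa [tripleProd, scalarProd_derivOp, add_assoc] using this
  have hm : ∀ s t : Simplex 3, (mulOp t s).1 = 0 := by
    intro s t
    by_cases h : s = t
    · subst h; simp [mulOp]
    · simp [mulOp, h]
  have hm' : ∀ t ∉ I, ∀ s ∈ I, (mulOp t s).2 = 0 := by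
    intro t ht s hs
    have h : s ≠ t := fun h => ht (h ▸ hs)
    simp [mulOp, h]
  have hβ : ∀ t ∉ I, (y.1 t).1 = 0 ∧ (y.2.1 t).1 = 0 ∧ (y.2.2 t).1 = 0 := by
    intro t ht
    refine ⟨?_, ?_, ?_⟩
    · have := hK (mulOp t, 0, 0) ⟨fun s => by simp [hm], fun s => by simp,
        fun s hs => by simp [hm' t ht s hs]⟩
      simpa [tripleProd, scalarProd_mulOp, scalarProd_zero_left] using this
    · have := hK (0, mulOp t, 0) ⟨fun s => by simp, fun s => by simp [hm],
        fun s hs => by simp [hm' t ht s hs]⟩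
      simpa [tripleProd, scalarProd_mulOp, scalarProd_zero_left] using this
    · have := hK (0, 0, mulOp t) ⟨fun s => by simp [hm], fun s => by simp [hm],
        fun s hs => by simp [hm' t ht s hs]⟩
      simpa [tripleProd, scalarProd_mulOp, scalarProd_zero_left] using this
  have hβ₁₂ : ∀ t, (y.1 t).1 = (y.2.1 t).1 := by
    intro t
    have := hK (mulOp t, -mulOp t, 0) ⟨fun s => by simp [hm], fun s => by simp [hm],
      fun s _ => by simp⟩
    simp only [tripleProd, scalarProd_mulOp, scalarProd_zero_left, scalarProd_neg_left] at this
    linear_combination this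
  have hβ₂₃ : ∀ t, (y.2.1 t).1 = (y.2.2 t).1 := by
    intro t
    have := hK (0, mulOp t, -mulOp t) ⟨fun s => by simp [hm], fun s => by simp [hm],
      fun s _ => by simp⟩
    simp only [tripleProd, scalarProd_mulOp, scalarProd_zero_left, scalarProd_neg_left] at this
    linear_combination this
  have hz₁ : e₁ = 0 := by
    refine h₁ e₁ he₁ fun t ht => ?_
    by_cases hu : t.1 ⊆ u₁.1
    · have k := hγ t
      rw [hg₂ t fun h => ht (h₁₂ t hu h), hg₃ t fun h => ht (h₁₃ t hu h), add_zero, add_zero] at k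
      rw [← hye₁ t hu]
      exact Prod.ext (hβ t ht).1 k
    · exact hV₁ he₁ t hu
  have hz₂ : e₂ = 0 := by
    refine h₂ e₂ he₂ fun t ht => ?_
    by_cases hu : t.1 ⊆ u₂.1
    · have k := hγ t
      rw [hg₁ t fun h => ht (h₁₂ t h hu), hg₃ t fun h => ht (h₂₃ t hu h), add_zero, zero_add] at k
      rw [← hye₂ t hu]
      exact Prod.ext (hβ t ht).2.1 k
    · exact hV₂ he₂ t hu
  have hz₃ : e₃ = 0 := by
    refine h₃ e₃ he₃ fun t ht => ?_
    by_cases hu : t.1 ⊆ u₃.1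
    · have k := hγ t
      rw [hg₁ t fun h => ht (h₁₃ t h hu), hg₂ t fun h => ht (h₂₃ t h hu), add_zero, zero_add] at k
      rw [← hye₃ t hu]
      exact Prod.ext (hβ t ht).2.2 k
    · exact hV₃ he₃ t hu
  subst hz₁ hz₂ hz₃
  have hβ₀ : ∀ t, (y.1 t).1 = 0 := by
    intro t
    by_cases ht : t ∈ I
    · rcases hI t ht with h | h | h
      · rw [hye₁ t h]; rfl
      · rw [hβ₁₂, hye₂ t h]; rfl
      · rw [hβ₁₂, hβ₂₃, hye₃ t h]; rfl
    · exact (hβ t ht).1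
  have hy1 : y.1 = 0 := by
    funext t
    by_cases h : t.1 ⊆ u₁.1
    · exact hye₁ t h
    · exact Prod.ext (hβ₀ t) (hg₁ t h)
  have hy2 : y.2.1 = 0 := by
    funext t
    by_cases h : t.1 ⊆ u₂.1
    · exact hye₂ t h
    · exact Prod.ext ((hβ₁₂ t).symm.trans (hβ₀ t)) (hg₂ t h)
  have hy3 : y.2.2 = 0 := by
    funext t
    by_cases h : t.1 ⊆ u₃.1
    · exact hye₃ t h
    · exact Prod.ext ((hβ₂₃ t).symm.trans ((hβ₁₂ t).symm.trans (hβ₀ t))) (hg₃ t h)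
  apply hf
  rw [← hy y₀]
  simp [tripleProd, hy1, hy2, hy3, scalarProd_comm _ 0, scalarProd_zero_left]

theorem tmul_ne_zero {M N : Type*} [AddCommGroup M] [Module ℂ M] [AddCommGroup N] [Module ℂ N]
    {a : M} {b : N} (ha : a ≠ 0) (hb : b ≠ 0) : TensorProduct.tmul ℂ a b ≠ 0 := by
  intro h
  obtain ⟨f, hf, -⟩ := Submodule.exists_le_ker_of_notMem (p := (⊥ : Submodule ℂ M)) (v := a)
    (by simpa using ha)
  have := congrArg (fun m => TensorProduct.lid ℂ N (LinearMap.rTensor N f m)) h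
  simp only [LinearMap.rTensor_tmul, TensorProduct.lid_tmul, map_zero] at this
  exact (smul_ne_zero hf hb) this

/-- Under the transversality condition, the integral of the product of three weights over the
variables that they share is nonzero. -/
theorem berezin_mul_mul_ne_zero {u₁ u₂ u₃ : Simplex 4} {V₁ V₂ V₃ : Submodule ℂ Op}
    {t₁ t₂ t₃ : Simplex 3} (ht₁₂ : t₁ ≠ t₂) (ht₁₃ : t₁ ≠ t₃) (ht₂₃ : t₂ ≠ t₃)
    (htop : (extendedSpace u₁ V₁).prod ((extendedSpace u₂ V₂).prod (extendedSpace u₃ V₃)) ⊔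
      descentSpace {t₁, t₂, t₃} = ⊤) {W₁ W₂ W₃ : Grassmann}
    (hW₁ : IsWeight u₁ V₁ W₁) (hW₂ : IsWeight u₂ V₂ W₂) (hW₃ : IsWeight u₃ V₃ W₃) :
    berezin t₃ (berezin t₂ (berezin t₁ (W₁ * W₂ * W₃))) ≠ 0 := by
  intro h0
  rw [← tripleIntegral_tmul] at h0
  refine tripleIntegral_ne_zero t₁ t₂ t₃ ht₁₂ ht₁₃ ht₂₃ ?_
  refine eq_zero_of_sup_eq_top tripleRep tripleProd tripleRep_anticomm _ _ htop
    triple_irreducible (TensorProduct.tmul ℂ W₁ (TensorProduct.tmul ℂ W₂ W₃)) ?_ ?_ _ ?_ h0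
  · exact tmul_ne_zero hW₁.2.1 (tmul_ne_zero hW₂.2.1 hW₃.2.1)
  · rintro y ⟨hy₁, hy₂, hy₃⟩
    rw [tripleRep_tmul, hW₁.act_eq_zero_of_mem hy₁, hW₂.act_eq_zero_of_mem hy₂,
      hW₃.act_eq_zero_of_mem hy₃]
    simp
  · intro k hk m hm
    rw [tripleIntegral_tripleRep_of_mem hk, hm, map_zero]

/-! ### Simplicial cochains -/

section Cochains

variable {k : ℕ}

/-- Extension of a cochain by zero to all sets of vertices. -/
noncomputable def extendZero (f : Simplex k → ℂ) (s : Finset (Fin 6)) : ℂ :=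
  if h : s.card = k + 1 then f ⟨s, h⟩ else 0

theorem extendZero_eq (f : Simplex k → ℂ) {s : Finset (Fin 6)} (h : s.card = k + 1) :
    extendZero f s = f ⟨s, h⟩ := dif_pos h

/-- The sign of the facet opposite to `v` in the boundary of `s`. -/
noncomputable def facetSign (s : Finset (Fin 6)) (v : Fin 6) : ℂ :=
  (-1) ^ (s.filter (fun w => w < v)).card

theorem coboundary_eq (f : Simplex k → ℂ) (s : Simplex (k + 1)) :
    coboundary f s = ∑ v ∈ s.1, facetSign s.1 v * extendZero f (s.1.erase v) := by
  rw [← Finset.sum_coe_sort s.1]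
  refine Finset.sum_congr rfl fun v _ => ?_
  have h : extendZero f (s.1.erase v) = f (facet s v.1 v.2) :=
    extendZero_eq f (facet s v.1 v.2).2
  rw [h]
  rfl

theorem facetSign_erase_of_lt {s : Finset (Fin 6)} {v w : Fin 6} (hv : v ∈ s) (h : v < w) :
    facetSign (s.erase v) w = -facetSign s w := by
  unfold facetSign
  have h1 : (s.filter (fun x => x < w)) = insert v ((s.erase v).filter (fun x => x < w)) := by
    rw [Finset.filter_erase, Finset.insert_erase]
    simp [hv, h]
  rw [h1, Finset.card_insert_of_notMem (by simp), pow_succ]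
  ring

theorem facetSign_erase_of_gt {s : Finset (Fin 6)} {v w : Fin 6} (h : w < v) :
    facetSign (s.erase v) w = facetSign s w := by
  unfold facetSign
  rw [Finset.filter_erase, Finset.erase_eq_of_notMem]
  simp [h.le]

/-- `δ ∘ δ = 0`. -/
theorem coboundary_coboundary (f : Simplex k → ℂ) (s : Simplex (k + 2)) :
    coboundary (coboundary f) s = 0 := by
  have hG : coboundary (coboundary f) s = ∑ v ∈ s.1, ∑ w ∈ s.1, if v = w then 0 else
      facetSign s.1 v * (facetSign (s.1.erase v) w * extendZero f ((s.1.erase v).erase w)) := by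
    rw [coboundary_eq]
    refine Finset.sum_congr rfl fun v hv => ?_
    have hc : (s.1.erase v).card = k + 1 + 1 := by
      rw [Finset.card_erase_of_mem hv, s.2]; rfl
    rw [extendZero_eq _ hc, coboundary_eq, Finset.mul_sum]
    refine Eq.trans ?_ (Finset.add_sum_erase s.1 _ hv)
    rw [if_pos rfl, zero_add]
    refine Finset.sum_congr rfl fun w hw => ?_
    rw [if_neg (Finset.ne_of_mem_erase hw).symm]
  have hanti : ∀ v ∈ s.1, ∀ w ∈ s.1, (if v = w then 0 else
      facetSign s.1 v * (facetSign (s.1.erase v) w * extendZero f ((s.1.erase v).erase w))) =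
      -(if w = v then 0 else
      facetSign s.1 w * (facetSign (s.1.erase w) v * extendZero f ((s.1.erase w).erase v))) := by
    intro v hv w hw
    rcases lt_trichotomy v w with h | h | h
    · rw [if_neg h.ne, if_neg h.ne', facetSign_erase_of_lt hv h, facetSign_erase_of_gt h,
        Finset.erase_right_comm]
      ring
    · simp [h]
    · rw [if_neg h.ne, if_neg h.ne', facetSign_erase_of_lt hw h, facetSign_erase_of_gt h,
        Finset.erase_right_comm]
      ring
  have h2 : coboundary (coboundary f) s = -coboundary (coboundary f) s := by
    conv_lhs => rw [hG, Finset.sum_comm]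
    rw [hG, ← Finset.sum_neg_distrib]
    refine Finset.sum_congr rfl fun v hv => ?_
    rw [← Finset.sum_neg_distrib]
    exact Finset.sum_congr rfl fun w hw => hanti w hw v hv
  exact self_eq_neg.1 h2

/-- The incidence number of a tetrahedron and a 4-simplex. -/
noncomputable def incidence (u : Simplex 4) (t : Simplex 3) : ℂ :=
  ∑ v ∈ u.1 \ t.1, facetSign u.1 v

theorem exists_eq_facet {u : Simplex (k + 1)} {t : Simplex k} (h : t.1 ⊆ u.1) :
    ∃ v, ∃ hv : v ∈ u.1, t = facet u v hv := by
  have hc : (u.1 \ t.1).card = 1 := by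
    rw [Finset.card_sdiff_of_subset h, u.2, t.2]; omega
  obtain ⟨v, hv⟩ := Finset.card_eq_one.1 hc
  have hvu : v ∈ u.1 \ t.1 := by rw [hv]; simp
  refine ⟨v, (Finset.mem_sdiff.1 hvu).1, Subtype.ext ?_⟩
  change t.1 = u.1.erase v
  rw [← Finset.sdiff_singleton_eq_erase, ← hv, Finset.sdiff_sdiff_eq_self h]

theorem incidence_facet (u : Simplex 4) (v : Fin 6) (hv : v ∈ u.1) :
    incidence u (facet u v hv) = facetSign u.1 v := by
  have : u.1 \ (facet u v hv).1 = {v} := by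
    change u.1 \ u.1.erase v = {v}
    rw [Finset.sdiff_erase hv]
    simp
  rw [incidence, this, Finset.sum_singleton]

theorem facet_subset (u : Simplex (k + 1)) (v : Fin 6) (hv : v ∈ u.1) :
    (facet u v hv).1 ⊆ u.1 := Finset.erase_subset _ _

theorem incidence_sq {u : Simplex 4} {t : Simplex 3} (h : t.1 ⊆ u.1) :
    incidence u t * incidence u t = 1 := by
  obtain ⟨v, hv, rfl⟩ := exists_eq_facet h
  rw [incidence_facet, facetSign, ← mul_pow]
  simp

theorem incidence_ne_zero {u : Simplex 4} {t : Simplex 3} (h : t.1 ⊆ u.1) :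
    incidence u t ≠ 0 := left_ne_zero_of_mul (incidence_sq h ▸ one_ne_zero)

theorem coboundary_eq_sum_incidence (f : Simplex 3 → ℂ) (u : Simplex 4) :
    coboundary f u = ∑ t : Simplex 3 with t.1 ⊆ u.1, incidence u t * f t := by
  unfold coboundary
  refine Finset.sum_bij (fun v _ => facet u v.1 v.2) ?_ ?_ ?_ ?_
  · intro v _
    simpa using facet_subset u v.1 v.2
  · intro v _ w _ h
    have h' : u.1.erase v.1 = u.1.erase w.1 := congrArg Subtype.val h
    by_contra hne
    have : v.1 ∈ u.1.erase w.1 := Finset.mem_erase.2 ⟨fun h => hne (Subtype.ext h), v.2⟩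
    rw [← h'] at this
    simp at this
  · intro t ht
    obtain ⟨v, hv, rfl⟩ := exists_eq_facet (Finset.mem_filter.1 ht).2
    exact ⟨⟨v, hv⟩, Finset.mem_univ _, rfl⟩
  · intro v _
    rw [incidence_facet]
    rfl

end Cochains

/-! ### Expansion in ordered vertices -/

/-- The edge with vertices `i ≠ j`. -/
def edge (i j : Fin 6) (h : i ≠ j) : Simplex 1 := ⟨{i, j}, Finset.card_pair h⟩

/-- The alternating extension of a function on edges to ordered pairs of vertices. -/
def alt {X : Type*} [AddGroup X] (μ : Simplex 1 → X) (i j : Fin 6) : X :=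
  if h : i < j then μ (edge i j h.ne) else if h : j < i then -μ (edge j i h.ne) else 0

theorem alt_of_lt {X : Type*} [AddGroup X] (μ : Simplex 1 → X) {i j : Fin 6} (h : i < j) :
    alt μ i j = μ (edge i j h.ne) := dif_pos h

theorem alt_self {X : Type*} [AddGroup X] (μ : Simplex 1 → X) (i : Fin 6) : alt μ i i = 0 := by
  simp [alt]

theorem alt_swap {X : Type*} [AddGroup X] (μ : Simplex 1 → X) (i j : Fin 6) :
    alt μ j i = -alt μ i j := by
  rcases lt_trichotomy i j with h | h | h
  · simp [alt, h, h.not_gt]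
  · subst h; simp [alt]
  · simp [alt, h, h.not_gt]

theorem edge_comm (i j : Fin 6) (h : i ≠ j) : edge i j h = edge j i h.symm :=
  Subtype.ext (Finset.pair_comm i j)

theorem exists_eq_edge (a : Simplex 1) : ∃ i j, ∃ h : i < j, a = edge i j h.ne := by
  obtain ⟨i, j, hij, h⟩ := Finset.card_eq_two.1 a.2
  rcases lt_or_gt_of_ne hij with hlt | hlt
  · exact ⟨i, j, hlt, Subtype.ext h⟩
  · exact ⟨j, i, hlt, Subtype.ext (h.trans (Finset.pair_comm i j))⟩

/-- The value of `δμ` on the ordered triangle `ijk`. -/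
def cyc (μ : Simplex 1 → ℂ) (i j k : Fin 6) : ℂ := alt μ i j + alt μ j k + alt μ k i

theorem exists_sorted₃ (s : Simplex 2) : ∃ i j k, i < j ∧ j < k ∧ s.1 = {i, j, k} := by
  let e := s.1.orderEmbOfFin s.2
  refine ⟨e 0, e 1, e 2, e.strictMono (by decide), e.strictMono (by decide), ?_⟩
  have h : (Finset.univ : Finset (Fin (2 + 1))) = {0, 1, 2} := by decide
  rw [← Finset.image_orderEmbOfFin_univ s.1 s.2, h]
  simp [e]

theorem exists_sorted₄ (s : Simplex 3) :
    ∃ i j k l, i < j ∧ j < k ∧ k < l ∧ s.1 = {i, j, k, l} := by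
  let e := s.1.orderEmbOfFin s.2
  refine ⟨e 0, e 1, e 2, e 3, e.strictMono (by decide), e.strictMono (by decide),
    e.strictMono (by decide), ?_⟩
  have h : (Finset.univ : Finset (Fin (3 + 1))) = {0, 1, 2, 3} := by decide
  rw [← Finset.image_orderEmbOfFin_univ s.1 s.2, h]
  simp [e]

theorem exists_sorted₅ (s : Simplex 4) :
    ∃ i j k l m, i < j ∧ j < k ∧ k < l ∧ l < m ∧ s.1 = {i, j, k, l, m} := by
  let e := s.1.orderEmbOfFin s.2
  refine ⟨e 0, e 1, e 2, e 3, e 4, e.strictMono (by decide), e.strictMono (by decide),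
    e.strictMono (by decide), e.strictMono (by decide), ?_⟩
  have h : (Finset.univ : Finset (Fin (4 + 1))) = {0, 1, 2, 3, 4} := by decide
  rw [← Finset.image_orderEmbOfFin_univ s.1 s.2, h]
  simp [e]

theorem coboundary_edge (f : Simplex 0 → ℂ) (i j : Fin 6) :
    alt (coboundary f) i j = extendZero f {j} - extendZero f {i} := by
  have key : ∀ i j, i < j → alt (coboundary f) i j = extendZero f {j} - extendZero f {i} := by
    intro i j h
    have h1 : ({i, j} : Finset (Fin 6)).erase i = {j} := by
      rw [Finset.erase_insert]; simp [h.ne]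
    have h2 : ({i, j} : Finset (Fin 6)).erase j = {i} := by
      rw [Finset.pair_comm, Finset.erase_insert]; simp [h.ne']
    rw [alt_of_lt _ h, coboundary_eq]
    simp only [edge]
    rw [Finset.sum_pair h.ne, h1, h2]
    simp [facetSign, Finset.filter_insert, Finset.filter_singleton, h, h.not_gt]
    ring
  rcases lt_trichotomy i j with h | h | h
  · exact key i j h
  · subst h; simp [alt_self]
  · rw [alt_swap, key j i h]; ring

theorem coboundary_triangle (μ : Simplex 1 → ℂ) {i j k : Fin 6} (hij : i < j) (hjk : j < k)
    {s : Simplex 2} (hs : s.1 = {i, j, k}) : coboundary μ s = cyc μ i j k := by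
  have hik := hij.trans hjk
  have h1 : ({i, j, k} : Finset (Fin 6)).erase i = {j, k} := by
    rw [Finset.erase_insert]; simp [hij.ne, hik.ne]
  have h2 : ({i, j, k} : Finset (Fin 6)).erase j = {i, k} := by
    rw [Finset.insert_comm, Finset.erase_insert]; simp [hij.ne', hjk.ne]
  have h3 : ({i, j, k} : Finset (Fin 6)).erase k = {i, j} := by
    rw [Finset.pair_comm, Finset.insert_comm, Finset.erase_insert]; simp [hik.ne', hjk.ne']
  have e : ∀ {a b : Fin 6} (h : a < b), extendZero μ {a, b} = alt μ a b := fun h => by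
    rw [alt_of_lt _ h, extendZero_eq μ (Finset.card_pair h.ne)]; rfl
  rw [coboundary_eq, hs, Finset.sum_insert (by simp [hij.ne, hik.ne]), Finset.sum_pair hjk.ne,
    h1, h2, h3, e hij, e hjk, e hik, cyc, alt_swap μ i k]
  simp [facetSign, Finset.filter_insert, Finset.filter_singleton, hij, hij.not_gt, hjk,
    hjk.not_gt, hik, hik.not_gt, hij.ne]
  ring

theorem coboundary_tetrahedron (M : Simplex 2 → ℂ) {i j k l : Fin 6} (hij : i < j) (hjk : j < k)
    (hkl : k < l) {t : Simplex 3} (ht : t.1 = {i, j, k, l}) :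
    coboundary M t = extendZero M {j, k, l} - extendZero M {i, k, l} + extendZero M {i, j, l} -
      extendZero M {i, j, k} := by
  have hik := hij.trans hjk
  have hjl := hjk.trans hkl
  have hil := hik.trans hkl
  have h1 : ({i, j, k, l} : Finset (Fin 6)).erase i = {j, k, l} := by
    rw [Finset.erase_insert]; simp [hij.ne, hik.ne, hil.ne]
  have h2 : ({i, j, k, l} : Finset (Fin 6)).erase j = {i, k, l} := by
    rw [Finset.insert_comm, Finset.erase_insert]; simp [hij.ne', hjk.ne, hjl.ne]
  have h3 : ({i, j, k, l} : Finset (Fin 6)).erase k = {i, j, l} := by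
    rw [Finset.insert_comm j k, Finset.insert_comm i k, Finset.erase_insert]
    simp [hik.ne', hjk.ne', hkl.ne]
  have h4 : ({i, j, k, l} : Finset (Fin 6)).erase l = {i, j, k} := by
    rw [Finset.pair_comm k l, Finset.insert_comm j l, Finset.insert_comm i l, Finset.erase_insert]
    simp [hil.ne', hjl.ne', hkl.ne']
  rw [coboundary_eq, ht, Finset.sum_insert (by simp [hij.ne, hik.ne, hil.ne]),
    Finset.sum_insert (by simp [hjk.ne, hjl.ne]), Finset.sum_pair hkl.ne, h1, h2, h3, h4]
  simp [facetSign, Finset.filter_insert, Finset.filter_singleton, hij, hij.not_gt, hjk,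
    hjk.not_gt, hik, hik.not_gt, hij.ne, hkl, hkl.not_gt, hil, hil.not_gt, hjl, hjl.not_gt, hik.ne,
    hjk.ne]
  ring

/-- Sums over the edges of `s` as sums over ordered pairs of vertices. -/
theorem two_smul_sum_edges {X : Type*} [AddCommGroup X] [Module ℂ X] (s : Finset (Fin 6))
    (μ : Simplex 1 → ℂ) (d : Simplex 1 → X) :
    (2 : ℂ) • ∑ a : Simplex 1 with a.1 ⊆ s, μ a • d a =
      ∑ i ∈ s, ∑ j ∈ s, alt μ i j • alt d i j := by
  have h1 : ∑ i ∈ s, ∑ j ∈ s, alt μ i j • alt d i j =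
      ∑ p ∈ s.offDiag, alt μ p.1 p.2 • alt d p.1 p.2 := by
    rw [← Finset.sum_product']
    symm
    refine Finset.sum_subset (fun p hp => ?_) fun p hp hp' => ?_
    · rw [Finset.mem_offDiag] at hp
      exact Finset.mem_product.2 ⟨hp.1, hp.2.1⟩
    · rw [Finset.mem_product] at hp
      rw [Finset.mem_offDiag] at hp'
      have : p.1 = p.2 := by
        by_contra h
        exact hp' ⟨hp.1, hp.2, h⟩
      rw [this, alt_self, zero_smul]
  have h2 : ∀ a : Simplex 1, ∑ p ∈ a.1.offDiag, alt μ p.1 p.2 • alt d p.1 p.2 =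
      (2 : ℂ) • (μ a • d a) := by
    intro a
    obtain ⟨i, j, h, rfl⟩ := exists_eq_edge a
    have : ({i, j} : Finset (Fin 6)).offDiag = {(i, j), (j, i)} := by
      ext ⟨p, q⟩
      simp only [Finset.mem_offDiag, Finset.mem_insert, Finset.mem_singleton, Prod.mk.injEq]
      have := h.ne
      constructor
      · rintro ⟨rfl | rfl, rfl | rfl, h'⟩ <;> simp_all
      · rintro (⟨rfl, rfl⟩ | ⟨rfl, rfl⟩) <;> simp [this, this.symm]
    change ∑ p ∈ ({i, j} : Finset (Fin 6)).offDiag, _ = _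
    rw [this, Finset.sum_pair (by simp [h.ne]), alt_swap μ i j, alt_swap d i j, neg_smul_neg,
      alt_of_lt _ h, alt_of_lt _ h, two_smul]
  rw [h1, Finset.smul_sum]
  simp only [← h2]
  rw [Finset.sum_sigma']
  refine Finset.sum_bij (fun q _ => q.2) ?_ ?_ ?_ ?_
  · rintro ⟨a, p⟩ hq
    simp only [Finset.mem_sigma, Finset.mem_filter, Finset.mem_univ, true_and,
      Finset.mem_offDiag] at hq ⊢
    exact ⟨hq.1 hq.2.1, hq.1 hq.2.2.1, hq.2.2.2⟩
  · have hpa : ∀ (a : Simplex 1) (p : Fin 6 × Fin 6), p ∈ a.1.offDiag → a.1 = {p.1, p.2} := by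
      intro a p hp
      rw [Finset.mem_offDiag] at hp
      symm
      apply Finset.eq_of_subset_of_card_le
      · simp [Finset.insert_subset_iff, hp.1, hp.2.1]
      · rw [a.2, Finset.card_pair hp.2.2]
    rintro ⟨a, p⟩ hq ⟨b, q⟩ hq' (rfl : p = q)
    have ha := hpa a p (Finset.mem_sigma.1 hq).2
    have hb := hpa b p (Finset.mem_sigma.1 hq').2
    have : a = b := Subtype.ext (ha.trans hb.symm)
    rw [this]
  · rintro ⟨i, j⟩ hp
    rw [Finset.mem_offDiag] at hp
    refine ⟨⟨edge i j hp.2.2, (i, j)⟩, ?_, rfl⟩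
    simp [edge, Finset.insert_subset_iff, hp.1, hp.2.1, hp.2.2]
  · intro _ _
    rfl

section Linear

theorem coboundary_add {k : ℕ} (f g : Simplex k → ℂ) (s : Simplex (k + 1)) :
    coboundary (f + g) s = coboundary f s + coboundary g s := by
  simp [coboundary, mul_add, Finset.sum_add_distrib]

theorem coboundary_smul {k : ℕ} (c : ℂ) (f : Simplex k → ℂ) (s : Simplex (k + 1)) :
    coboundary (c • f) s = c * coboundary f s := by
  simp only [coboundary, Pi.smul_apply, smul_eq_mul, Finset.mul_sum]
  exact Finset.sum_congr rfl fun v _ => by ring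

theorem cyc_rotate (μ : Simplex 1 → ℂ) (i j k : Fin 6) : cyc μ j k i = cyc μ i j k := by
  simp only [cyc]; ring

theorem cyc_swap (μ : Simplex 1 → ℂ) (i j k : Fin 6) : cyc μ j i k = -cyc μ i j k := by
  simp only [cyc, alt_swap μ i j, alt_swap μ i k, alt_swap μ j k]; ring

theorem cyc_add_cyc_add_cyc (μ : Simplex 1 → ℂ) (i j k l : Fin 6) :
    cyc μ j k l + cyc μ k i l + cyc μ i j l = cyc μ i j k := by
  simp only [cyc]
  rw [alt_swap μ j l, alt_swap μ k l, alt_swap μ i l]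
  ring

/-- An alternating function of three vertices vanishes if it does so on increasing triples. -/
theorem alternating_eq_zero {s : Finset (Fin 6)} (g : Fin 6 → Fin 6 → Fin 6 → ℂ)
    (hr : ∀ i j k, g j k i = g i j k) (hs : ∀ i j k, g j i k = -g i j k)
    (h : ∀ i j k, i ∈ s → j ∈ s → k ∈ s → i < j → j < k → g i j k = 0) (i j k : Fin 6)
    (hi : i ∈ s) (hj : j ∈ s) (hk : k ∈ s) : g i j k = 0 := by
  have hs' : ∀ i j, g i i j = 0 := fun i j => self_eq_neg.1 (hs i i j)
  -- it suffices to treat the triples whose first entry is the smallest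
  have key : ∀ i j k, i ∈ s → j ∈ s → k ∈ s → i < j → i < k → g i j k = 0 := by
    intro i j k hi hj hk hij hik
    rcases lt_trichotomy j k with hjk | hjk | hjk
    · exact h i j k hi hj hk hij hjk
    · subst hjk; rw [← hr i j j, hs']
    · rw [← hr i j k, ← neg_eq_zero, ← hs, hr i k j]
      exact h i k j hi hk hj hik hjk
  rcases lt_trichotomy i j with hij | hij | hij
  · rcases lt_trichotomy i k with hik | hik | hik
    · exact key i j k hi hj hk hij hik
    · subst hik; rw [← hr i j i, ← hr j i i, hs']
    · rw [hr k i j]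
      exact key k i j hk hi hj hik (hik.trans hij)
  · subst hij; exact hs' i k
  · rcases lt_trichotomy j k with hjk | hjk | hjk
    · rw [← hr i j k]
      exact key j k i hj hk hi hjk hij
    · subst hjk; rw [← hr i j j, hs']
    · rw [hr k i j]
      exact key k i j hk hi hj (hjk.trans hij) hjk

theorem cyc_eq_of_coboundary_eq {s : Finset (Fin 6)} {μ N : Simplex 1 → ℂ} {c : ℂ}
    (h : ∀ r : Simplex 2, r.1 ⊆ s → coboundary μ r = c * coboundary N r) {i j k : Fin 6}
    (hi : i ∈ s) (hj : j ∈ s) (hk : k ∈ s) : cyc μ i j k = c * cyc N i j k := by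
  rw [← sub_eq_zero]
  refine alternating_eq_zero (s := s) (fun i j k => cyc μ i j k - c * cyc N i j k) ?_ ?_ ?_
    i j k hi hj hk
  · intro i j k
    simp only [cyc_rotate]
  · intro i j k
    rw [cyc_swap μ i j k, cyc_swap N i j k]; ring
  · intro i j k hi hj hk hij hjk
    have hc : ({i, j, k} : Finset (Fin 6)).card = 2 + 1 := by
      rw [Finset.card_eq_three.2 ⟨i, j, k, hij.ne, (hij.trans hjk).ne, hjk.ne, rfl⟩]
    have := h ⟨{i, j, k}, hc⟩ (by simp [Finset.insert_subset_iff, hi, hj, hk])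
    rw [coboundary_triangle μ hij hjk rfl, coboundary_triangle N hij hjk rfl] at this
    exact sub_eq_zero.2 this

/-- On a simplex, a 1-cochain whose coboundary is a multiple of `δN` is the sum of a multiple of `N`
and a coboundary. -/
theorem exists_eq_add_coboundary {s : Finset (Fin 6)} (hs : s.Nonempty) {μ N : Simplex 1 → ℂ}
    {c : ℂ} (h : ∀ r : Simplex 2, r.1 ⊆ s → coboundary μ r = c * coboundary N r) :
    ∃ f : Simplex 0 → ℂ, ∀ a : Simplex 1, a.1 ⊆ s → μ a = (c • N + coboundary f) a := by
  obtain ⟨v, hv⟩ := hs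
  let f : Simplex 0 → ℂ := fun p => ∑ i ∈ p.1, (alt μ v i - c * alt N v i)
  refine ⟨f, fun a ha => ?_⟩
  obtain ⟨i, j, hij, rfl⟩ := exists_eq_edge a
  have hi : i ∈ s := ha (by simp [edge])
  have hj : j ∈ s := ha (by simp [edge])
  have hf : ∀ i, extendZero f {i} = alt μ v i - c * alt N v i := by
    intro i
    rw [extendZero_eq f (Finset.card_singleton i)]
    simp [f]
  have h1 := coboundary_edge f i j
  rw [hf, hf, alt_of_lt _ hij] at h1
  have h2 := cyc_eq_of_coboundary_eq h hv hi hj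
  rw [cyc, cyc, alt_swap μ v j, alt_swap N v j, alt_of_lt μ hij, alt_of_lt N hij] at h2
  rw [Pi.add_apply, h1, Pi.smul_apply, smul_eq_mul]
  linear_combination h2

end Linear

/-! ### The operators of 1-cochains -/

theorem cochainOp_apply (u : Simplex 4) (d : Simplex 1 → Op) (μ : Simplex 1 → ℂ) (t : Simplex 3) :
    cochainOp u d μ t = ∑ a : Simplex 1 with a.1 ⊆ u.1, μ a • d a t := by
  simp [cochainOp, Finset.sum_apply]

/-- `cochainOp` as a linear map. -/
noncomputable def cochainHom (u : Simplex 4) (d : Simplex 1 → Op) : (Simplex 1 → ℂ) →ₗ[ℂ] Op where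
  toFun := cochainOp u d
  map_add' μ ν := by simp [cochainOp, add_smul, Finset.sum_add_distrib]
  map_smul' c μ := by simp [cochainOp, mul_smul, Finset.smul_sum]

theorem cochainHom_apply (u : Simplex 4) (d : Simplex 1 → Op) (μ : Simplex 1 → ℂ) :
    cochainHom u d μ = cochainOp u d μ := rfl

theorem cochainOp_congr {u : Simplex 4} {d e : Simplex 1 → Op} {μ ν : Simplex 1 → ℂ}
    (h : ∀ a : Simplex 1, a.1 ⊆ u.1 → μ a = ν a) (h' : ∀ a : Simplex 1, a.1 ⊆ u.1 → d a = e a) :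
    cochainOp u d μ = cochainOp u e ν :=
  Finset.sum_congr rfl fun a ha => by
    rw [h a (Finset.mem_filter.1 ha).2, h' a (Finset.mem_filter.1 ha).2]

/-- Only the edges of `t` contribute to the component at `t`. -/
theorem cochainOp_apply_eq_sum {u : Simplex 4} {d : Simplex 1 → Op}
    (hd : ∀ a : Simplex 1, a.1 ⊆ u.1 → ∀ t : Simplex 3, ¬ (a.1 ⊆ t.1 ∧ t.1 ⊆ u.1) → d a t = 0)
    {t : Simplex 3} (ht : t.1 ⊆ u.1) (μ : Simplex 1 → ℂ) :
    cochainOp u d μ t = ∑ a : Simplex 1 with a.1 ⊆ t.1, μ a • d a t := by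
  rw [cochainOp_apply]
  refine (Finset.sum_subset (fun a ha => ?_) fun a ha ha' => ?_).symm
  · exact Finset.mem_filter.2 ⟨Finset.mem_univ _, (Finset.mem_filter.1 ha).2.trans ht⟩
  · rw [hd a (Finset.mem_filter.1 ha).2 t fun h =>
      ha' (Finset.mem_filter.2 ⟨Finset.mem_univ _, h.1⟩), smul_zero]

/-- The 1-cochain equal to one at a single edge gives the operator of that edge. -/
theorem cochainOp_single {u : Simplex 4} (d : Simplex 1 → Op) {a : Simplex 1} (ha : a.1 ⊆ u.1) :
    cochainOp u d (Pi.single a 1) = d a := by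
  rw [cochainOp, Finset.sum_eq_single a]
  · simp
  · intro b _ hb
    simp [hb]
  · intro h
    simp [ha] at h

theorem range_cochainHom (u : Simplex 4) (d : Simplex 1 → Op) :
    LinearMap.range (cochainHom u d) = Submodule.span ℂ (d '' {a | a.1 ⊆ u.1}) := by
  apply le_antisymm
  · rintro _ ⟨μ, rfl⟩
    rw [cochainHom_apply, cochainOp]
    refine Submodule.sum_mem _ fun a ha => Submodule.smul_mem _ _ (Submodule.subset_span ?_)
    exact Set.mem_image_of_mem d (Finset.mem_filter.1 ha).2
  · rw [Submodule.span_le]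
    rintro _ ⟨a, ha, rfl⟩
    exact ⟨Pi.single a 1, cochainOp_single d ha⟩

/-- The weighted squares `(δμ)²/Ω` of the coboundary of a 1-cochain. -/
noncomputable def energy (Ω : Simplex 2 → ℂ) (μ : Simplex 1 → ℂ) (s : Simplex 2) : ℂ :=
  coboundary μ s ^ 2 / Ω s

/-- The algebraic description of edge operators built from a 2-cocycle `Ω`: they are supported on
the tetrahedra containing the edge, cochains whose coboundary is proportional to `Ω` give zero, and
on every tetrahedron `t` the product of the two coefficients is a fixed multiple of `δ((δμ)²/Ω)`. -/
structure EdgeForm (Ω : Simplex 2 → ℂ) (u : Simplex 4) (d : Simplex 1 → Op) (κ : ℂ) : Prop where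
  support : ∀ a : Simplex 1, a.1 ⊆ u.1 → ∀ t : Simplex 3, ¬ (a.1 ⊆ t.1 ∧ t.1 ⊆ u.1) → d a t = 0
  cochainOp_eq_zero : ∀ (μ : Simplex 1 → ℂ) (c : ℂ),
    (∀ s : Simplex 2, s.1 ⊆ u.1 → coboundary μ s = c * Ω s) → cochainOp u d μ = 0
  mul_eq : ∀ t : Simplex 3, t.1 ⊆ u.1 → ∀ μ : Simplex 1 → ℂ,
    (cochainOp u d μ t).1 * (cochainOp u d μ t).2 =
      κ * incidence u t * coboundary (energy Ω μ) t

/-! ### Edge operators determine a quadratic form on every tetrahedron -/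

theorem distinct_of_card_eq_four {i j k l : Fin 6} (h : ({i, j, k, l} : Finset (Fin 6)).card = 4) :
    i ≠ j ∧ i ≠ k ∧ i ≠ l ∧ j ≠ k ∧ j ≠ l ∧ k ≠ l := by
  have h3 : ∀ a b c : Fin 6, ({a, b, c} : Finset (Fin 6)).card ≤ 3 := fun _ _ _ =>
    Finset.card_le_three
  have key : ∀ a b c, ({i, j, k, l} : Finset (Fin 6)) ≠ {a, b, c} := by
    intro a b c he
    have := h3 a b c
    rw [← he, h] at this
    omega
  refine ⟨?_, ?_, ?_, ?_, ?_, ?_⟩ <;> rintro rfl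
  · exact key i k l (by ext; simp)
  · exact key i j l (by ext; simp; tauto)
  · exact key i j k (by ext; simp; tauto)
  · exact key i j l (by ext; simp)
  · exact key i j k (by ext; simp; tauto)
  · exact key i j k (by ext; simp)

theorem alt_apply (d : Simplex 1 → Op) (i j : Fin 6) (t : Simplex 3) :
    alt d i j t = alt (fun a => d a t) i j := by
  rcases lt_trichotomy i j with h | h | h
  · simp [alt, h]
  · subst h; simp [alt]
  · simp [alt, h, h.not_gt]

/-- The component of `∑ μ_a d_a` at the tetrahedron `ijkl`. -/
theorem cochainOp_tetrahedron {u : Simplex 4} {d : Simplex 1 → Op}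
    (hd : ∀ a : Simplex 1, a.1 ⊆ u.1 → ∀ t : Simplex 3, ¬ (a.1 ⊆ t.1 ∧ t.1 ⊆ u.1) → d a t = 0)
    {t : Simplex 3} (htu : t.1 ⊆ u.1) {i j k l : Fin 6} (ht : t.1 = {i, j, k, l})
    (μ : Simplex 1 → ℂ) :
    cochainOp u d μ t = alt μ i j • alt d i j t + alt μ i k • alt d i k t +
      alt μ i l • alt d i l t + alt μ j k • alt d j k t + alt μ j l • alt d j l t +
      alt μ k l • alt d k l t := by
  obtain ⟨hij, hik, hil, hjk, hjl, hkl⟩ := distinct_of_card_eq_four (ht ▸ t.2)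
  have h1 := cochainOp_apply_eq_sum hd htu μ
  have h2 := two_smul_sum_edges t.1 μ (fun a => d a t)
  rw [← h1, ht] at h2
  simp only [← alt_apply] at h2
  have hs : ∀ g : Fin 6 → ℂ × ℂ, ∑ q ∈ ({i, j, k, l} : Finset (Fin 6)), g q =
      g i + g j + g k + g l := by
    intro g
    rw [Finset.sum_insert (by simp [hij, hik, hil]), Finset.sum_insert (by simp [hjk, hjl]),
      Finset.sum_pair hkl]
    abel
  simp only [hs, alt_self, zero_smul] at h2
  rw [alt_swap μ i j, alt_swap μ i k, alt_swap μ i l, alt_swap μ j k, alt_swap μ j l,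
    alt_swap μ k l, alt_swap d i j, alt_swap d i k, alt_swap d i l, alt_swap d j k, alt_swap d j l,
    alt_swap d k l] at h2
  simp only [Pi.neg_apply, neg_smul_neg] at h2
  refine smul_right_injective _ (two_ne_zero (α := ℂ)) ?_
  simp only [h2]
  module

/-- The pairing of the components of two operators at one tetrahedron. -/
def pairing (p q : ℂ × ℂ) : ℂ := p.1 * q.2 + q.1 * p.2

theorem pairing_add_right (p q r : ℂ × ℂ) : pairing p (q + r) = pairing p q + pairing p r := by
  simp [pairing]; ring

theorem pairing_comm (p q : ℂ × ℂ) : pairing p q = pairing q p := by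
  simp [pairing]; ring

theorem pairing_sub_right (p q r : ℂ × ℂ) : pairing p (q - r) = pairing p q - pairing p r := by
  simp [pairing]; ring

theorem pairing_smul_right (c : ℂ) (p q : ℂ × ℂ) : pairing p (c • q) = c * pairing p q := by
  simp [pairing]; ring

theorem alt_mem {V : Submodule ℂ Op} {u : Simplex 4} {d : Simplex 1 → Op}
    (hd : ∀ a : Simplex 1, a.1 ⊆ u.1 → d a ∈ V) {i j : Fin 6} (hi : i ∈ u.1) (hj : j ∈ u.1) :
    alt d i j ∈ V := by
  have h0 : ∀ i j, i ∈ u.1 → j ∈ u.1 → ∀ h : i ≠ j, d (edge i j h) ∈ V := fun i j hi hj h =>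
    hd _ (by simp [edge, Finset.insert_subset_iff, hi, hj])
  rcases lt_trichotomy i j with h | h | h
  · simpa [alt, h] using h0 i j hi hj h.ne
  · subst h; simp [alt]
  · simpa [alt, h, h.not_gt] using h0 j i hj hi h.ne

theorem alt_apply_eq_zero {u : Simplex 4} {d : Simplex 1 → Op}
    (hd : ∀ a : Simplex 1, a.1 ⊆ u.1 → ∀ t : Simplex 3, ¬ (a.1 ⊆ t.1 ∧ t.1 ⊆ u.1) → d a t = 0)
    {i j : Fin 6} (hi : i ∈ u.1) (hj : j ∈ u.1) {t : Simplex 3}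
    (h : ¬ (i ∈ t.1 ∧ j ∈ t.1 ∧ t.1 ⊆ u.1)) : alt d i j t = 0 := by
  have h0 : ∀ h : i ≠ j, d (edge i j h) t = 0 := fun h' =>
    hd _ (by simp [edge, Finset.insert_subset_iff, hi, hj]) t
      (by simpa [edge, Finset.insert_subset_iff, and_assoc] using h)
  rcases lt_trichotomy i j with h | h | h
  · simpa [alt, h] using h0 h.ne
  · subst h; simp [alt]
  · have := h0 h.ne'
    rw [edge_comm] at this
    simp [alt, h, h.not_gt, this]

/-- Operators of opposite edges of a tetrahedron are orthogonal there, because no other tetrahedron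
contains both edges. -/
theorem pairing_opposite {u : Simplex 4} {d : Simplex 1 → Op}
    (hd : ∀ a : Simplex 1, a.1 ⊆ u.1 → ∀ t : Simplex 3, ¬ (a.1 ⊆ t.1 ∧ t.1 ⊆ u.1) → d a t = 0)
    {V : Submodule ℂ Op} (hV : IsIsotropic V) (hdV : ∀ a : Simplex 1, a.1 ⊆ u.1 → d a ∈ V)
    {t : Simplex 3} (htu : t.1 ⊆ u.1) {i j k l : Fin 6} (ht : t.1 = {i, j, k, l}) :
    pairing (alt d i j t) (alt d k l t) = 0 := by
  have hi : i ∈ u.1 := htu (by simp [ht])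
  have hj : j ∈ u.1 := htu (by simp [ht])
  have hk : k ∈ u.1 := htu (by simp [ht])
  have hl : l ∈ u.1 := htu (by simp [ht])
  have h := hV _ (alt_mem hdV hi hj) _ (alt_mem hdV hk hl)
  rw [scalarProd, Finset.sum_eq_single t] at h
  · exact h
  · intro s _ hs
    by_cases h1 : i ∈ s.1 ∧ j ∈ s.1 ∧ s.1 ⊆ u.1
    · rw [alt_apply_eq_zero hd hk hl (t := s)]
      · simp
      · rintro ⟨h2, h3, -⟩
        refine hs (Subtype.ext (Finset.eq_of_subset_of_card_le ?_ ?_).symm)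
        · simp [ht, Finset.insert_subset_iff, h1, h2, h3]
        · rw [s.2, t.2]
    · rw [alt_apply_eq_zero hd hi hj h1]
      simp
  · simp

/-- The two tetrahedra containing the triangle `ijk` give opposite pairings of its edges. -/
theorem pairing_adjacent {u : Simplex 4} {d : Simplex 1 → Op}
    (hd : ∀ a : Simplex 1, a.1 ⊆ u.1 → ∀ t : Simplex 3, ¬ (a.1 ⊆ t.1 ∧ t.1 ⊆ u.1) → d a t = 0)
    {V : Submodule ℂ Op} (hV : IsIsotropic V) (hdV : ∀ a : Simplex 1, a.1 ⊆ u.1 → d a ∈ V)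
    {t t' : Simplex 3} {i j k l m : Fin 6} (ht : t.1 = {i, j, k, l}) (ht' : t'.1 = {i, j, k, m})
    (hu : u.1 = {i, j, k, l, m}) (hlm : l ≠ m) :
    pairing (alt d i j t) (alt d j k t) + pairing (alt d i j t') (alt d j k t') = 0 := by
  have hi : i ∈ u.1 := by simp [hu]
  have hj : j ∈ u.1 := by simp [hu]
  have hk : k ∈ u.1 := by simp [hu]
  obtain ⟨hij, hik, hil, hjk, hjl, hkl⟩ := distinct_of_card_eq_four (ht ▸ t.2)
  have h := hV _ (alt_mem hdV hi hj) _ (alt_mem hdV hj hk)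
  rw [scalarProd, Finset.sum_eq_add t t'] at h
  · exact h
  · intro h
    have : l ∈ t'.1 := by simp [← h, ht]
    rw [ht'] at this
    simp [hil.symm, hjl.symm, hkl.symm, hlm] at this
  · intro s _ hs
    by_cases h1 : i ∈ s.1 ∧ j ∈ s.1 ∧ s.1 ⊆ u.1
    · rw [alt_apply_eq_zero hd hj hk (t := s)]
      · simp
      · rintro ⟨-, h2, -⟩
        have hsub : ({i, j, k} : Finset (Fin 6)) ⊆ s.1 := by
          simp [Finset.insert_subset_iff, h1, h2]
        have hcard : ({i, j, k} : Finset (Fin 6)).card = 3 :=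
          Finset.card_eq_three.2 ⟨i, j, k, hij, hik, hjk, rfl⟩
        obtain ⟨y, hys, hy⟩ := Finset.exists_mem_notMem_of_card_lt_card
          (s := ({i, j, k} : Finset (Fin 6))) (t := s.1) (by rw [hcard, s.2]; omega)
        have hs' : s.1 = {i, j, k, y} := by
          symm
          apply Finset.eq_of_subset_of_card_le
          · intro z hz
            simp only [Finset.mem_insert, Finset.mem_singleton] at hz
            rcases hz with rfl | rfl | rfl | rfl
            exacts [h1.1, h1.2.1, h2, hys]
          · simp only [Finset.mem_insert, Finset.mem_singleton, not_or] at hy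
            have : ({i, j, k, y} : Finset (Fin 6)) = insert y {i, j, k} := by
              ext; simp; tauto
            rw [s.2, this, Finset.card_insert_of_notMem (by simp [hy]), hcard]
        have hyu := h1.2.2 hys
        rw [hu] at hyu
        simp only [Finset.mem_insert, Finset.mem_singleton, not_or] at hyu hy
        rcases hyu with h | h | h | h | h
        · exact hy.1 h
        · exact hy.2.1 h
        · exact hy.2.2 h
        · exact hs.1 (Subtype.ext (by rw [hs', ht, h]))
        · exact hs.2 (Subtype.ext (by rw [hs', ht', h]))
    · rw [alt_apply_eq_zero hd hi hj h1]
      simp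
  · simp
  · simp

/-- The relation between the components of the operators of the edges at the vertex `i`. -/
theorem vertex_relation {u : Simplex 4} {d : Simplex 1 → Op}
    (hd : ∀ a : Simplex 1, a.1 ⊆ u.1 → ∀ t : Simplex 3, ¬ (a.1 ⊆ t.1 ∧ t.1 ⊆ u.1) → d a t = 0)
    (h0 : ∀ f : Simplex 0 → ℂ, cochainOp u d (coboundary f) = 0)
    {t : Simplex 3} (htu : t.1 ⊆ u.1) {i j k l : Fin 6} (ht : t.1 = {i, j, k, l}) :
    alt d i j t + alt d i k t + alt d i l t = 0 := by
  obtain ⟨hij, hik, hil, hjk, hjl, hkl⟩ := distinct_of_card_eq_four (ht ▸ t.2)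
  have h := cochainOp_tetrahedron hd htu ht (coboundary fun p => if p.1 = {i} then 1 else 0)
  rw [h0] at h
  have e : ∀ q, extendZero (fun p : Simplex 0 => if p.1 = {i} then (1 : ℂ) else 0) {q} =
      if q = i then 1 else 0 := by
    intro q
    rw [extendZero_eq _ (Finset.card_singleton q)]
    simp
  simp only [coboundary_edge, e, hij.symm, hik.symm, hil.symm, if_true, if_false] at h
  have h' : (0 : ℂ × ℂ) = -(alt d i j t + alt d i k t + alt d i l t) := by
    refine Eq.trans h ?_
    module
  exact neg_eq_zero.1 h'.symm

/-- The relation that three vectors `X`, `Y`, `Z` of equal mutual pairings `h` satisfy determines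
their squares. -/
theorem pairing_of_relation {X Y Z : ℂ × ℂ} {ω₁ ω₂ ω₃ : ℂ} (h₁ : ω₁ ≠ 0) (h₂ : ω₂ ≠ 0)
    (h₃ : ω₃ ≠ 0) (h₀ : ω₁ + ω₂ + ω₃ ≠ 0) (hrel : ω₁ • X + ω₂ • Y + ω₃ • Z = 0)
    (hYZ : pairing Y Z = pairing X Y) (hZX : pairing Z X = pairing X Y) (w₁ w₂ w₃ : ℂ) :
    2 * ((w₁ • X + w₂ • Y + w₃ • Z).1 * (w₁ • X + w₂ • Y + w₃ • Z).2) =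
      pairing X Y * (ω₁ + ω₂ + ω₃) * ((w₁ + w₂ + w₃) ^ 2 / (ω₁ + ω₂ + ω₃) - w₁ ^ 2 / ω₁ -
        w₂ ^ 2 / ω₂ - w₃ ^ 2 / ω₃) := by
  obtain ⟨x₁, x₂⟩ := X
  obtain ⟨y₁, y₂⟩ := Y
  obtain ⟨z₁, z₂⟩ := Z
  have r₁ := congrArg Prod.fst hrel
  have r₂ := congrArg Prod.snd hrel
  simp only [pairing, Prod.fst_add, Prod.snd_add, Prod.smul_mk, smul_eq_mul, Prod.fst_zero,
    Prod.snd_zero] at *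
  set h := x₁ * y₂ + y₁ * x₂ with hh
  have sX : 2 * (x₁ * x₂) = -((ω₂ + ω₃) * h) / ω₁ := by
    rw [eq_div_iff h₁]
    linear_combination x₂ * r₁ + x₁ * r₂ - ω₂ * hh - ω₃ * hZX
  have sY : 2 * (y₁ * y₂) = -((ω₁ + ω₃) * h) / ω₂ := by
    rw [eq_div_iff h₂]
    linear_combination y₂ * r₁ + y₁ * r₂ - ω₁ * hh - ω₃ * hYZ
  have sZ : 2 * (z₁ * z₂) = -((ω₁ + ω₂) * h) / ω₃ := by
    rw [eq_div_iff h₃]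
    linear_combination z₂ * r₁ + z₁ * r₂ - ω₁ * hZX - ω₂ * hYZ
  have lhs : 2 * ((w₁ * x₁ + w₂ * y₁ + w₃ * z₁) * (w₁ * x₂ + w₂ * y₂ + w₃ * z₂)) =
      w₁ ^ 2 * (2 * (x₁ * x₂)) + w₂ ^ 2 * (2 * (y₁ * y₂)) + w₃ ^ 2 * (2 * (z₁ * z₂)) +
        2 * (w₁ * w₂ + w₂ * w₃ + w₃ * w₁) * h := by
    linear_combination (-2 * w₁ * w₂) * hh + 2 * w₂ * w₃ * hYZ + 2 * w₃ * w₁ * hZX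
  rw [lhs, sX, sY, sZ]
  field_simp
  ring

/-- The properties of edge operators, built from `δN`, that determine their pairings. -/
structure PreEdgeForm (N : Simplex 1 → ℂ) (u : Simplex 4) (d : Simplex 1 → Op) : Prop where
  support : ∀ a : Simplex 1, a.1 ⊆ u.1 → ∀ t : Simplex 3, ¬ (a.1 ⊆ t.1 ∧ t.1 ⊆ u.1) → d a t = 0
  isotropic : ∃ V : Submodule ℂ Op, IsIsotropic V ∧ ∀ a : Simplex 1, a.1 ⊆ u.1 → d a ∈ V
  coboundary_eq_zero : ∀ f : Simplex 0 → ℂ, cochainOp u d (coboundary f) = 0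
  cochainOp_eq_zero : cochainOp u d N = 0
  cyc_ne_zero : ∀ i j k, i ≠ j → i ≠ k → j ≠ k → cyc N i j k ≠ 0

/-- The common value, up to sign, of the pairings of the edges of the triangle `ijk` at `t`, times
the value of `δN` at that triangle. -/
noncomputable def weightedPairing (N : Simplex 1 → ℂ) (d : Simplex 1 → Op) (t : Simplex 3)
    (i j k : Fin 6) : ℂ := pairing (alt d i j t) (alt d j k t) * cyc N i j k

namespace PreEdgeForm

variable {N : Simplex 1 → ℂ} {u : Simplex 4} {d : Simplex 1 → Op} {t : Simplex 3} {i j k l : Fin 6}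

/-- The edges at the vertex `l` expressed through those of the triangle `ijk`. -/
theorem alt_apply_eq (H : PreEdgeForm N u d) (htu : t.1 ⊆ u.1) (ht : t.1 = {i, j, k, l}) :
    alt d i l t = alt d k i t - alt d i j t ∧ alt d j l t = alt d i j t - alt d j k t ∧
      alt d k l t = alt d j k t - alt d k i t := by
  have hi := vertex_relation H.support H.coboundary_eq_zero htu ht
  have hj := vertex_relation H.support H.coboundary_eq_zero htu (i := j) (j := i) (k := k) (l := l)
    (by rw [ht, Finset.insert_comm])
  have hk := vertex_relation H.support H.coboundary_eq_zero htu (i := k) (j := i) (k := j) (l := l)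
    (by rw [ht, Finset.insert_comm j k, Finset.insert_comm i k])
  rw [alt_swap d k i, Pi.neg_apply] at hi
  rw [alt_swap d i j, Pi.neg_apply] at hj
  rw [alt_swap d j k, Pi.neg_apply] at hk
  refine ⟨?_, ?_, ?_⟩
  · linear_combination (exp := 1) hi
  · linear_combination (exp := 1) hj
  · linear_combination (exp := 1) hk

theorem cochainOp_apply_eq (H : PreEdgeForm N u d) (htu : t.1 ⊆ u.1) (ht : t.1 = {i, j, k, l})
    (μ : Simplex 1 → ℂ) :
    cochainOp u d μ t = cyc μ j k l • alt d j k t + cyc μ k i l • alt d k i t +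
      cyc μ i j l • alt d i j t := by
  obtain ⟨hi, hj, hk⟩ := H.alt_apply_eq htu ht
  rw [cochainOp_tetrahedron H.support htu ht, hi, hj, hk, alt_swap d k i, Pi.neg_apply, cyc, cyc,
    cyc, alt_swap μ k i, alt_swap μ j l, alt_swap μ k l, alt_swap μ i l]
  module

theorem pairing_eq (H : PreEdgeForm N u d) (htu : t.1 ⊆ u.1) (ht : t.1 = {i, j, k, l}) :
    pairing (alt d j k t) (alt d k i t) = pairing (alt d i j t) (alt d j k t) ∧
      pairing (alt d k i t) (alt d i j t) = pairing (alt d i j t) (alt d j k t) := by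
  obtain ⟨V, hV, hdV⟩ := H.isotropic
  obtain ⟨hi, hj, hk⟩ := H.alt_apply_eq htu ht
  have h1 := pairing_opposite H.support hV hdV htu ht
  have h2 := pairing_opposite H.support hV hdV htu (i := j) (j := k) (k := i) (l := l)
    (by rw [ht, Finset.insert_comm i j, Finset.insert_comm i k])
  rw [hk, pairing_sub_right] at h1
  rw [hi, pairing_sub_right, pairing_comm _ (alt d i j t)] at h2
  rw [pairing_comm (alt d k i t)]
  exact ⟨by linear_combination h2, by linear_combination -h1⟩

theorem weightedPairing_rotate (H : PreEdgeForm N u d) (htu : t.1 ⊆ u.1)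
    (ht : t.1 = {i, j, k, l}) : weightedPairing N d t j k i = weightedPairing N d t i j k := by
  rw [weightedPairing, weightedPairing, (H.pairing_eq htu ht).1, cyc_rotate]

/-- The weighted pairing is alternating in its last two vertices. This is where the vanishing of
the operator of `N` enters. -/
theorem weightedPairing_swap (H : PreEdgeForm N u d) (htu : t.1 ⊆ u.1)
    (ht : t.1 = {i, j, k, l}) : weightedPairing N d t i j l = -weightedPairing N d t i j k := by
  obtain ⟨-, hj, -⟩ := H.alt_apply_eq htu ht
  obtain ⟨-, hp⟩ := H.pairing_eq htu ht
  have h := H.cochainOp_apply_eq htu ht N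
  rw [H.cochainOp_eq_zero] at h
  have h' := congrArg (pairing (alt d i j t)) h
  rw [pairing_add_right, pairing_add_right, pairing_smul_right, pairing_smul_right,
    pairing_smul_right, pairing_comm _ (alt d k i t), hp] at h'
  have h0 : pairing (alt d i j t) ((0 : Op) t) = 0 := by simp [pairing]
  rw [h0] at h'
  rw [weightedPairing, weightedPairing, hj, pairing_sub_right, ← cyc_add_cyc_add_cyc N i j k l]
  linear_combination -h'

theorem weightedPairing_adjacent (H : PreEdgeForm N u d) {t' : Simplex 3} {m : Fin 6}
    (ht : t.1 = {i, j, k, l}) (ht' : t'.1 = {i, j, k, m}) (hu : u.1 = {i, j, k, l, m})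
    (hlm : l ≠ m) : weightedPairing N d t' i j k = -weightedPairing N d t i j k := by
  obtain ⟨V, hV, hdV⟩ := H.isotropic
  have h := pairing_adjacent H.support hV hdV ht ht' hu hlm
  rw [weightedPairing, weightedPairing]
  linear_combination cyc N i j k * h

theorem two_mul_eq (H : PreEdgeForm N u d) (htu : t.1 ⊆ u.1) (ht : t.1 = {i, j, k, l})
    (μ : Simplex 1 → ℂ) :
    2 * ((cochainOp u d μ t).1 * (cochainOp u d μ t).2) = weightedPairing N d t i j k *
      (cyc μ i j k ^ 2 / cyc N i j k - cyc μ j k l ^ 2 / cyc N j k l -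
        cyc μ k i l ^ 2 / cyc N k i l - cyc μ i j l ^ 2 / cyc N i j l) := by
  obtain ⟨hij, hik, hil, hjk, hjl, hkl⟩ := distinct_of_card_eq_four (ht ▸ t.2)
  obtain ⟨h1, h2⟩ := H.pairing_eq htu ht
  have h := H.cochainOp_apply_eq htu ht N
  rw [H.cochainOp_eq_zero] at h
  have key := pairing_of_relation (H.cyc_ne_zero j k l hjk hjl hkl)
    (H.cyc_ne_zero k i l hik.symm hkl hil) (H.cyc_ne_zero i j l hij hil hjl)
    (by rw [cyc_add_cyc_add_cyc]; exact H.cyc_ne_zero i j k hij hik hjk) h.symm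
    (h2.trans h1.symm) h1.symm (cyc μ j k l) (cyc μ k i l) (cyc μ i j l)
  rw [← H.cochainOp_apply_eq htu ht, cyc_add_cyc_add_cyc, cyc_add_cyc_add_cyc, h1] at key
  exact key

/-- The quadratic form of a tetrahedron with increasing vertices. -/
theorem two_mul_eq_coboundary (H : PreEdgeForm N u d) (htu : t.1 ⊆ u.1)
    (ht : t.1 = {i, j, k, l}) (hij : i < j) (hjk : j < k) (hkl : k < l) (μ : Simplex 1 → ℂ) :
    2 * ((cochainOp u d μ t).1 * (cochainOp u d μ t).2) =
      -weightedPairing N d t i j k * coboundary (energy (coboundary N) μ) t := by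
  have e : ∀ {a b c : Fin 6}, a < b → b < c → extendZero (energy (coboundary N) μ) {a, b, c} =
      cyc μ a b c ^ 2 / cyc N a b c := by
    intro a b c hab hbc
    have hc : ({a, b, c} : Finset (Fin 6)).card = 2 + 1 :=
      Finset.card_eq_three.2 ⟨a, b, c, hab.ne, (hab.trans hbc).ne, hbc.ne, rfl⟩
    rw [extendZero_eq _ hc, energy, coboundary_triangle μ hab hbc rfl,
      coboundary_triangle N hab hbc rfl]
  rw [H.two_mul_eq htu ht, coboundary_tetrahedron _ hij hjk hkl ht, e hjk hkl,
    e (hij.trans hjk) hkl, e hij (hjk.trans hkl), e hij hjk, cyc_swap μ i k l, cyc_swap N i k l,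
    neg_sq, div_neg]
  ring

/-- The quadratic forms of the tetrahedra of `u` are proportional to those given by the energy, with
the same factor up to the incidence numbers. -/
theorem exists_mul_eq (H : PreEdgeForm N u d) : ∃ κ : ℂ, ∀ t : Simplex 3, t.1 ⊆ u.1 →
    ∀ μ : Simplex 1 → ℂ, (cochainOp u d μ t).1 * (cochainOp u d μ t).2 =
      κ * incidence u t * coboundary (energy (coboundary N) μ) t := by
  obtain ⟨a, b, c, e, f, hab, hbc, hce, hef, hu⟩ := exists_sorted₅ u
  have hac := hab.trans hbc
  have hae := hac.trans hce
  have haf := hae.trans hef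
  have hbe := hbc.trans hce
  have hbf := hbe.trans hef
  have hcf := hce.trans hef
  have ha : a ∈ u.1 := by simp [hu]
  have hb : b ∈ u.1 := by simp [hu]
  have hc : c ∈ u.1 := by simp [hu]
  have he : e ∈ u.1 := by simp [hu]
  have hf : f ∈ u.1 := by simp [hu]
  have h₀ : (facet u a ha).1 = {b, c, e, f} := by
    change u.1.erase a = _
    rw [hu, Finset.erase_insert (by simp [hab.ne, hac.ne, hae.ne, haf.ne])]
  have h₁ : (facet u b hb).1 = {a, c, e, f} := by
    change u.1.erase b = _
    rw [hu, Finset.insert_comm, Finset.erase_insert (by simp [hab.ne', hbc.ne, hbe.ne, hbf.ne])]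
  have h₂ : (facet u c hc).1 = {a, b, e, f} := by
    change u.1.erase c = _
    rw [hu, Finset.insert_comm b c, Finset.insert_comm a c,
      Finset.erase_insert (by simp [hac.ne', hbc.ne', hce.ne, hcf.ne])]
  have h₃ : (facet u e he).1 = {a, b, c, f} := by
    change u.1.erase e = _
    rw [hu, Finset.insert_comm c e, Finset.insert_comm b e, Finset.insert_comm a e,
      Finset.erase_insert (by simp [hae.ne', hbe.ne', hce.ne', hef.ne])]
  have h₄ : (facet u f hf).1 = {a, b, c, e} := by
    change u.1.erase f = _
    rw [hu, Finset.pair_comm, Finset.insert_comm c f, Finset.insert_comm b f,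
      Finset.insert_comm a f,
      Finset.erase_insert (by simp [haf.ne', hbf.ne', hcf.ne', hef.ne'])]
  have s := fun v hv => facet_subset u v hv
  set K := weightedPairing N d (facet u f hf) a b c with hK
  -- neighbouring tetrahedra share a triangle, which transports the constant between them
  have k₃ : weightedPairing N d (facet u e he) a b c = -K :=
    H.weightedPairing_adjacent h₄ h₃ hu hef.ne
  have k₂ : weightedPairing N d (facet u c hc) a b e = K := by
    have e₁ := H.weightedPairing_swap (s e he) h₃
    have e₂ := H.weightedPairing_adjacent (t := facet u e he) (t' := facet u c hc) (i := a)
      (j := b) (k := f) (l := c) (m := e) (by rw [h₃, Finset.pair_comm])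
      (by rw [h₂, Finset.pair_comm]) (by rw [hu]; ext; simp; tauto) hce.ne
    have e₃ := H.weightedPairing_swap (s c hc) (i := a) (j := b) (k := f) (l := e)
      (by rw [h₂, Finset.pair_comm])
    rw [e₃, e₂, e₁, k₃]; ring
  have k₁ : weightedPairing N d (facet u b hb) a c e = -K := by
    have e₀ := H.weightedPairing_rotate (s c hc) (i := e) (j := a) (k := b) (l := f)
      (by rw [h₂]; ext; simp; tauto)
    have e₁ := H.weightedPairing_swap (s c hc) (i := e) (j := a) (k := b) (l := f)
      (by rw [h₂]; ext; simp; tauto)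
    have e₂ := H.weightedPairing_adjacent (t := facet u c hc) (t' := facet u b hb) (i := e)
      (j := a) (k := f) (l := b) (m := c) (by rw [h₂]; ext; simp; tauto)
      (by rw [h₁]; ext; simp; tauto) (by rw [hu]; ext; simp; tauto) hbc.ne
    have e₃ := H.weightedPairing_swap (s b hb) (i := e) (j := a) (k := f) (l := c)
      (by rw [h₁]; ext; simp; tauto)
    have e₄ := H.weightedPairing_rotate (s b hb) (i := e) (j := a) (k := c) (l := f)
      (by rw [h₁]; ext; simp; tauto)
    rw [e₄, e₃, e₂, e₁, ← e₀, k₂]; ring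
  have k₀ : weightedPairing N d (facet u a ha) b c e = K := by
    have e₀ := H.weightedPairing_rotate (s b hb) h₁
    have e₁ := H.weightedPairing_swap (s b hb) (i := c) (j := e) (k := a) (l := f)
      (by rw [h₁]; ext; simp; tauto)
    have e₂ := H.weightedPairing_adjacent (t := facet u b hb) (t' := facet u a ha) (i := c)
      (j := e) (k := f) (l := a) (m := b) (by rw [h₁]; ext; simp; tauto)
      (by rw [h₀]; ext; simp; tauto) (by rw [hu]; ext; simp; tauto) hab.ne
    have e₃ := H.weightedPairing_swap (s a ha) (i := c) (j := e) (k := f) (l := b)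
      (by rw [h₀]; ext; simp; tauto)
    have e₄ := H.weightedPairing_rotate (s a ha) h₀
    rw [← e₄, e₃, e₂, e₁, e₀, k₁]; ring
  refine ⟨-K / 2, fun t ht μ => ?_⟩
  obtain ⟨v, hv, rfl⟩ := exists_eq_facet ht
  rw [incidence_facet]
  have hv' := hv
  rw [hu] at hv'
  simp only [Finset.mem_insert, Finset.mem_singleton] at hv'
  have hsign : facetSign u.1 a = 1 ∧ facetSign u.1 b = -1 ∧ facetSign u.1 c = 1 ∧
      facetSign u.1 e = -1 ∧ facetSign u.1 f = 1 := by
    rw [hu]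
    simp [facetSign, Finset.filter_insert, Finset.filter_singleton, hab, hac, hae, haf, hbc, hbe,
      hbf, hce, hcf, hef, hab.not_gt, hac.not_gt, hae.not_gt, haf.not_gt, hbc.not_gt, hbe.not_gt,
      hbf.not_gt, hce.not_gt, hcf.not_gt, hef.not_gt, hab.ne, hac.ne, hae.ne, hbc.ne, hbe.ne,
      hce.ne]
    norm_num
  obtain ⟨s₀, s₁, s₂, s₃, s₄⟩ := hsign
  rcases hv' with rfl | rfl | rfl | rfl | rfl
  · have := H.two_mul_eq_coboundary ht h₀ hbc hce hef μ
    rw [k₀] at this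
    rw [s₀]; linear_combination this / 2
  · have := H.two_mul_eq_coboundary ht h₁ hac hce hef μ
    rw [k₁] at this
    rw [s₁]; linear_combination this / 2
  · have := H.two_mul_eq_coboundary ht h₂ hab hbe hef μ
    rw [k₂] at this
    rw [s₂]; linear_combination this / 2
  · have := H.two_mul_eq_coboundary ht h₃ hab hbc hcf μ
    rw [k₃] at this
    rw [s₃]; linear_combination this / 2
  · have := H.two_mul_eq_coboundary ht h₄ hab hbc hce μ
    rw [← hK] at this
    rw [s₄]; linear_combination this / 2

end PreEdgeForm

theorem cyc_ne_zero {N : Simplex 1 → ℂ} (hN : ∀ s, coboundary N s ≠ 0) (i j k : Fin 6)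
    (hij : i ≠ j) (hik : i ≠ k) (hjk : j ≠ k) : cyc N i j k ≠ 0 := by
  have key : ∀ i j k, i < j → j < k → cyc N i j k ≠ 0 := by
    intro i j k hij hjk
    have hc : ({i, j, k} : Finset (Fin 6)).card = 2 + 1 :=
      Finset.card_eq_three.2 ⟨i, j, k, hij.ne, (hij.trans hjk).ne, hjk.ne, rfl⟩
    rw [← coboundary_triangle N hij hjk (s := ⟨{i, j, k}, hc⟩) rfl]
    exact hN _
  have e : cyc N i j k = -cyc N i k j := by
    rw [← cyc_rotate N i j k, cyc_swap N k j i, cyc_rotate N i k j]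
  rcases lt_or_gt_of_ne hij with h₁ | h₁ <;> rcases lt_or_gt_of_ne hik with h₂ | h₂ <;>
    rcases lt_or_gt_of_ne hjk with h₃ | h₃
  · exact key i j k h₁ h₃
  · rw [e, neg_ne_zero]
    exact key i k j h₂ h₃
  · exact absurd (h₁.trans h₃) h₂.not_gt
  · rw [cyc_rotate N k i j]
    exact key k i j h₂ h₁
  · rw [cyc_swap N j i k, neg_ne_zero]
    exact key j i k h₁ h₂
  · exact absurd (h₂.trans h₃) h₁.not_gt
  · rw [← cyc_rotate]
    exact key j k i h₃ h₂
  · rw [e, neg_ne_zero, ← cyc_rotate N i k j]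
    exact key k j i h₃ h₁

/-- A system of edge operators built from `Ω = δN` has the algebraic description of `EdgeForm` with
a nonzero factor. -/
theorem BuiltFrom.exists_edgeForm {N : Simplex 1 → ℂ} (hN : ∀ s, coboundary N s ≠ 0)
    {u : Simplex 4} {V : Submodule ℂ Op} {d : Simplex 1 → Op}
    (h : BuiltFrom (coboundary N) u V d) : ∃ κ : ℂ, κ ≠ 0 ∧ EdgeForm (coboundary N) u d κ := by
  classical
  have hmem : ∀ a : Simplex 1, a.1 ⊆ u.1 → d a ∈ edgeOps V a := fun a ha => by
    rw [h.edgeSystem.edgeOps_eq a ha]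
    exact Submodule.mem_span_singleton_self _
  have hVu : V ≤ opSpace u := h.maximalIsotropic.prop.1
  have hu : u.1.Nonempty := Finset.card_pos.1 (by rw [u.2]; omega)
  have hzero : ∀ (μ : Simplex 1 → ℂ) (c : ℂ),
      (∀ s : Simplex 2, s.1 ⊆ u.1 → coboundary μ s = c * coboundary N s) →
      cochainOp u d μ = 0 := by
    intro μ c hμ
    obtain ⟨ν, hν, hνN⟩ := h.exists_cochain
    obtain ⟨f, hf⟩ := exists_eq_add_coboundary hu (μ := μ) (N := ν) (c := c)
      fun s hs => by rw [hμ s hs, hνN s hs]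
    rw [cochainOp_congr hf fun _ _ => rfl, ← cochainHom_apply, map_add, map_smul, cochainHom_apply,
      cochainHom_apply, hν, h.edgeSystem.coboundary_eq_zero, smul_zero, add_zero]
  have hsupp : ∀ a : Simplex 1, a.1 ⊆ u.1 → ∀ t : Simplex 3, ¬ (a.1 ⊆ t.1 ∧ t.1 ⊆ u.1) →
      d a t = 0 := by
    intro a ha t ht
    by_cases hat : a.1 ⊆ t.1
    · exact hVu (hmem a ha).1 t fun h => ht ⟨hat, h⟩
    · exact (hmem a ha).2 t hat
  have hpre : PreEdgeForm N u d :=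
    { support := hsupp
      isotropic := ⟨V, h.maximalIsotropic.prop.2, fun a ha => (hmem a ha).1⟩
      coboundary_eq_zero := h.edgeSystem.coboundary_eq_zero
      cochainOp_eq_zero := hzero N 1 fun s _ => (one_mul _).symm
      cyc_ne_zero := cyc_ne_zero hN }
  obtain ⟨κ, hκ⟩ := hpre.exists_mul_eq
  refine ⟨κ, ?_, hsupp, hzero, hκ⟩
  rintro rfl
  -- all components lie on isotropic lines, so that `V` is a direct sum of such lines
  let P : Simplex 3 → Prop := fun t => ∀ μ, (cochainOp u d μ t).1 = 0
  have hP : ∀ t : Simplex 3, t.1 ⊆ u.1 → ¬ P t → ∀ μ, (cochainOp u d μ t).2 = 0 := by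
    intro t ht hPt μ
    obtain ⟨ν, hν⟩ := not_forall.1 hPt
    have e : ∀ μ, (cochainOp u d μ t).1 * (cochainOp u d μ t).2 = 0 := fun μ => by
      rw [hκ t ht μ]; ring
    have hν₂ := (mul_eq_zero.1 (e ν)).resolve_left hν
    by_contra hμ
    have hμ₁ := (mul_eq_zero.1 (e μ)).resolve_right hμ
    have := e (μ + ν)
    rw [← cochainHom_apply, map_add, cochainHom_apply, cochainHom_apply, Pi.add_apply,
      Prod.fst_add, Prod.snd_add, hν₂, hμ₁, add_zero, zero_add] at this
    exact mul_ne_zero hν hμ this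
  let L : Submodule ℂ Op :=
    { carrier := {e | e ∈ opSpace u ∧ ∀ t, (P t → (e t).1 = 0) ∧ (¬ P t → (e t).2 = 0)}
      add_mem' := fun {a b} ha hb => ⟨(opSpace u).add_mem ha.1 hb.1, fun t =>
        ⟨fun h => by simp [(ha.2 t).1 h, (hb.2 t).1 h],
          fun h => by simp [(ha.2 t).2 h, (hb.2 t).2 h]⟩⟩
      zero_mem' := ⟨(opSpace u).zero_mem, fun t => ⟨fun _ => rfl, fun _ => rfl⟩⟩
      smul_mem' := fun c a ha => ⟨(opSpace u).smul_mem c ha.1, fun t =>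
        ⟨fun h => by simp [(ha.2 t).1 h], fun h => by simp [(ha.2 t).2 h]⟩⟩ }
  have hLV : L ≤ V := by
    refine h.maximalIsotropic.le_of_ge ⟨fun e he => he.1, ?_⟩ ?_
    · intro e he e' he'
      refine Finset.sum_eq_zero fun t _ => ?_
      by_cases hPt : P t
      · rw [(he.2 t).1 hPt, (he'.2 t).1 hPt]; ring
      · rw [(he.2 t).2 hPt, (he'.2 t).2 hPt]; ring
    · intro e he
      refine ⟨hVu he, fun t => ?_⟩
      rw [← h.edgeSystem.span_eq, ← range_cochainHom] at he
      obtain ⟨μ, rfl⟩ := he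
      refine ⟨fun hPt => hPt μ, fun hPt => ?_⟩
      by_cases ht : t.1 ⊆ u.1
      · exact hP t ht hPt μ
      · have h0 : cochainHom u d μ ∈ V := by
          rw [← h.edgeSystem.span_eq, ← range_cochainHom]
          exact ⟨μ, rfl⟩
        rw [hVu h0 t ht]; rfl
  -- but then there are too many edge operators
  let b : Simplex 3 → ℂ × ℂ := fun t => if P t then (0, 1) else (1, 0)
  have hb : ∀ t, b t ≠ 0 := by
    intro t
    by_cases hPt : P t <;> simp [b, hPt]
  have hsingle : ∀ t : Simplex 3, t.1 ⊆ u.1 → (Pi.single t (b t) : Op) ∈ L := by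
    intro t ht
    refine ⟨fun s hs => ?_, fun s => ?_⟩
    · have : s ≠ t := fun h => hs (h ▸ ht)
      simp [this]
    · by_cases hst : s = t
      · subst hst
        exact ⟨fun hPs => by simp [b, hPs], fun hPs => by simp [b, hPs]⟩
      · simp [hst]
  obtain ⟨v₀, v₁, v₂, v₃, v₄, h₀₁, h₁₂, h₂₃, h₃₄, hv⟩ := exists_sorted₅ u
  have m₃ : v₃ ∈ u.1 := by simp [hv]
  have m₄ : v₄ ∈ u.1 := by simp [hv]
  have hau : (edge v₀ v₁ h₀₁.ne).1 ⊆ u.1 := by simp [edge, Finset.insert_subset_iff, hv]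
  have hedge : ∀ (v : Fin 6) (hv : v ∈ u.1), v ≠ v₀ → v ≠ v₁ →
      ∃ c : ℂ, c • d (edge v₀ v₁ h₀₁.ne) = Pi.single (facet u v hv) (b (facet u v hv)) := by
    intro v hv hv₀ hv₁
    rw [← Submodule.mem_span_singleton, ← h.edgeSystem.edgeOps_eq _ hau]
    refine ⟨hLV (hsingle _ (facet_subset u v hv)), fun t ht => ?_⟩
    have : t ≠ facet u v hv := by
      rintro rfl
      refine ht fun z hz => ?_
      have hz' := hau hz
      simp only [edge, Finset.mem_insert, Finset.mem_singleton] at hz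
      refine Finset.mem_erase.2 ⟨?_, hz'⟩
      rcases hz with rfl | rfl
      · exact hv₀.symm
      · exact hv₁.symm
    simp [this]
  obtain ⟨c, hc⟩ := hedge v₃ m₃ ((h₀₁.trans h₁₂).trans h₂₃).ne' (h₁₂.trans h₂₃).ne'
  obtain ⟨c', hc'⟩ := hedge v₄ m₄ (((h₀₁.trans h₁₂).trans h₂₃).trans h₃₄).ne'
    ((h₁₂.trans h₂₃).trans h₃₄).ne'
  have hne : facet u v₃ m₃ ≠ facet u v₄ m₄ := by
    intro heq
    have h1 : v₃ ∈ (facet u v₄ m₄).1 := Finset.mem_erase.2 ⟨h₃₄.ne, m₃⟩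
    rw [← heq] at h1
    exact (Finset.mem_erase.1 h1).1 rfl
  have e₁ := congrFun hc (facet u v₃ m₃)
  have e₂ := congrFun hc' (facet u v₃ m₃)
  rw [Pi.smul_apply, Pi.single_eq_same] at e₁
  rw [Pi.smul_apply, Pi.single_eq_of_ne hne] at e₂
  have hd3 : d (edge v₀ v₁ h₀₁.ne) (facet u v₃ m₃) ≠ 0 := by
    intro h0
    rw [h0, smul_zero] at e₁
    exact hb _ e₁.symm
  have hc0 : c' = 0 := (smul_eq_zero.1 e₂).resolve_right hd3
  have e₃ := congrFun hc' (facet u v₄ m₄)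
  rw [hc0, zero_smul, Pi.single_eq_same] at e₃
  exact hb _ e₃.symm

/-! ### The kernel of the form of a tetrahedron -/

theorem edge_inj {i j a b : Fin 6} (hij : i < j) (hab : a < b) :
    edge a b hab.ne = edge i j hij.ne ↔ a = i ∧ b = j := by
  constructor
  · intro h
    have h' : ({a, b} : Finset (Fin 6)) = {i, j} := congrArg Subtype.val h
    have ha : a ∈ ({i, j} : Finset (Fin 6)) := h' ▸ by simp
    have hb : b ∈ ({i, j} : Finset (Fin 6)) := h' ▸ by simp
    simp only [Finset.mem_insert, Finset.mem_singleton] at ha hb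
    omega
  · rintro ⟨rfl, rfl⟩
    rfl

theorem alt_single {i j a b : Fin 6} (hij : i < j) (hab : a < b) :
    alt (Pi.single (edge i j hij.ne) (1 : ℂ) : Simplex 1 → ℂ) a b =
      if a = i ∧ b = j then 1 else 0 := by
  rw [alt_of_lt _ hab, Pi.single_apply]
  simp only [edge_inj hij hab]

theorem coboundary_single {i j a b c : Fin 6} (hij : i < j) (hab : a < b) (hbc : b < c)
    {s : Simplex 2} (hs : s.1 = {a, b, c}) :
    coboundary (Pi.single (edge i j hij.ne) (1 : ℂ) : Simplex 1 → ℂ) s =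
      (if a = i ∧ b = j then 1 else 0) + (if b = i ∧ c = j then 1 else 0) -
        (if a = i ∧ c = j then 1 else 0) := by
  rw [coboundary_triangle _ hab hbc hs, cyc, alt_swap _ a c, alt_single hij hab, alt_single hij hbc,
    alt_single hij (hab.trans hbc)]
  ring

/-- The faces of a tetrahedron with increasing vertices. -/
theorem face_cases {t : Simplex 3} {i j k l : Fin 6} (ht : t.1 = {i, j, k, l}) {s : Simplex 2}
    (hs : s.1 ⊆ t.1) : s.1 = {j, k, l} ∨ s.1 = {i, k, l} ∨ s.1 = {i, j, l} ∨ s.1 = {i, j, k} := by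
  obtain ⟨v, hv, rfl⟩ := exists_eq_facet hs
  obtain ⟨hij, hik, hil, hjk, hjl, hkl⟩ := distinct_of_card_eq_four (ht ▸ t.2)
  have hv' := hv
  rw [ht] at hv'
  simp only [Finset.mem_insert, Finset.mem_singleton] at hv'
  have e : (facet t v hv).1 = t.1.erase v := rfl
  rw [e, ht]
  rcases hv' with rfl | rfl | rfl | rfl
  · left; rw [Finset.erase_insert (by simp [hij, hik, hil])]
  · right; left
    rw [Finset.insert_comm, Finset.erase_insert (by simp [hij.symm, hjk, hjl])]
  · right; right; left
    rw [Finset.insert_comm j v, Finset.insert_comm i v,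
      Finset.erase_insert (by simp [hik.symm, hjk.symm, hkl])]
  · right; right; right
    rw [Finset.pair_comm k v, Finset.insert_comm j v, Finset.insert_comm i v,
      Finset.erase_insert (by simp [hil.symm, hjl.symm, hkl.symm])]

/-- The quadratic form `δ((δμ)²/Ω)` of a tetrahedron has radical spanned by `Ω`: this is where it
matters that no value of `Ω` is zero. -/
theorem exists_coboundary_eq_of_apply_eq_zero {Ω : Simplex 2 → ℂ} (hΩ : ∀ s, Ω s ≠ 0)
    {t : Simplex 3} (F : (Simplex 1 → ℂ) →ₗ[ℂ] ℂ × ℂ) {κ : ℂ} (hκ : κ ≠ 0)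
    (hF : ∀ μ, (F μ).1 * (F μ).2 = κ * coboundary (energy Ω μ) t) {μ : Simplex 1 → ℂ}
    (hμ : F μ = 0) : ∃ c : ℂ, ∀ s : Simplex 2, s.1 ⊆ t.1 → coboundary μ s = c * Ω s := by
  obtain ⟨i, j, k, l, hij, hjk, hkl, ht⟩ := exists_sorted₄ t
  have hik := hij.trans hjk
  have hjl := hjk.trans hkl
  have hil := hik.trans hkl
  have h3 : ∀ {a b c : Fin 6}, a < b → b < c → ({a, b, c} : Finset (Fin 6)).card = 2 + 1 :=
    fun hab hbc => Finset.card_eq_three.2 ⟨_, _, _, hab.ne, (hab.trans hbc).ne, hbc.ne, rfl⟩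
  have e : ∀ (ν : Simplex 1 → ℂ) {a b c : Fin 6} (hab : a < b) (hbc : b < c),
      extendZero (energy Ω ν) {a, b, c} = coboundary ν ⟨{a, b, c}, h3 hab hbc⟩ ^ 2 /
        Ω ⟨{a, b, c}, h3 hab hbc⟩ := fun ν a b c hab hbc => extendZero_eq _ (h3 hab hbc)
  set s₀ : Simplex 2 := ⟨{j, k, l}, h3 hjk hkl⟩ with hs₀
  set s₁ : Simplex 2 := ⟨{i, k, l}, h3 hik hkl⟩ with hs₁
  set s₂ : Simplex 2 := ⟨{i, j, l}, h3 hij hjl⟩ with hs₂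
  set s₃ : Simplex 2 := ⟨{i, j, k}, h3 hij hjk⟩ with hs₃
  have E : ∀ ν, coboundary (energy Ω ν) t = coboundary ν s₀ ^ 2 / Ω s₀ -
      coboundary ν s₁ ^ 2 / Ω s₁ + coboundary ν s₂ ^ 2 / Ω s₂ - coboundary ν s₃ ^ 2 / Ω s₃ := by
    intro ν
    rw [coboundary_tetrahedron _ hij hjk hkl ht, e ν hjk hkl, e ν hik hkl, e ν hij hjl, e ν hij hjk]
  have hE0 : coboundary (energy Ω μ) t = 0 := by
    have := hF μ
    rw [hμ] at this
    simpa [hκ] using this.symm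
  have hE1 : ∀ ν, coboundary (energy Ω (μ + ν)) t = coboundary (energy Ω ν) t := by
    intro ν
    have h1 := hF (μ + ν)
    rw [map_add, hμ, zero_add, hF ν] at h1
    exact (mul_left_cancel₀ hκ h1).symm
  have polar : ∀ ν, coboundary ν s₀ * (coboundary μ s₀ / Ω s₀) -
      coboundary ν s₁ * (coboundary μ s₁ / Ω s₁) + coboundary ν s₂ * (coboundary μ s₂ / Ω s₂) -
      coboundary ν s₃ * (coboundary μ s₃ / Ω s₃) = 0 := by
    intro ν
    have h1 := hE1 ν
    rw [E] at hE0
    rw [E, E] at h1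
    simp only [coboundary_add] at h1
    linear_combination (h1 - hE0) / 2
  have p₁ := polar (Pi.single (edge i j hij.ne) 1)
  have p₂ := polar (Pi.single (edge k l hkl.ne) 1)
  have p₃ := polar (Pi.single (edge j k hjk.ne) 1)
  rw [coboundary_single hij hjk hkl rfl, coboundary_single hij hik hkl rfl,
    coboundary_single hij hij hjl rfl, coboundary_single hij hij hjk rfl] at p₁
  rw [coboundary_single hkl hjk hkl rfl, coboundary_single hkl hik hkl rfl,
    coboundary_single hkl hij hjl rfl, coboundary_single hkl hij hjk rfl] at p₂
  rw [coboundary_single hjk hjk hkl rfl, coboundary_single hjk hik hkl rfl,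
    coboundary_single hjk hij hjl rfl, coboundary_single hjk hij hjk rfl] at p₃
  simp [hij.ne, hij.ne', hjk.ne, hjk.ne', hkl.ne, hkl.ne', hik.ne, hik.ne', hjl.ne,
    hjl.ne'] at p₁ p₂ p₃
  have key : ∀ s, coboundary μ s / Ω s = coboundary μ s₃ / Ω s₃ →
      coboundary μ s = coboundary μ s₃ / Ω s₃ * Ω s := by
    intro s h
    rw [← h, div_mul_cancel₀ _ (hΩ s)]
  refine ⟨coboundary μ s₃ / Ω s₃, fun s hs => key s ?_⟩
  rcases face_cases ht hs with h | h | h | h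
  · rw [show s = s₀ from Subtype.ext h]; linear_combination p₃
  · rw [show s = s₁ from Subtype.ext h]; linear_combination p₃ - p₂
  · rw [show s = s₂ from Subtype.ext h]; linear_combination p₁
  · rw [show s = s₃ from Subtype.ext h]

/-- The form of a tetrahedron has rank two. -/
theorem surjective_of_mul_eq {Ω : Simplex 2 → ℂ} (hΩ : ∀ s, Ω s ≠ 0)
    {t : Simplex 3} (F : (Simplex 1 → ℂ) →ₗ[ℂ] ℂ × ℂ) {κ : ℂ} (hκ : κ ≠ 0)
    (hF : ∀ μ, (F μ).1 * (F μ).2 = κ * coboundary (energy Ω μ) t) : Function.Surjective F := by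
  obtain ⟨i, j, k, l, hij, hjk, hkl, ht⟩ := exists_sorted₄ t
  have hik := hij.trans hjk
  have hjl := hjk.trans hkl
  have hil := hik.trans hkl
  have h3 : ∀ {a b c : Fin 6}, a < b → b < c → ({a, b, c} : Finset (Fin 6)).card = 2 + 1 :=
    fun hab hbc => Finset.card_eq_three.2 ⟨_, _, _, hab.ne, (hab.trans hbc).ne, hbc.ne, rfl⟩
  have hli : LinearIndependent ℂ
      ![F (Pi.single (edge i j hij.ne) 1), F (Pi.single (edge j k hjk.ne) 1)] := by
    rw [LinearIndependent.pair_iff]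
    intro a b hab
    rw [← map_smul, ← map_smul, ← map_add] at hab
    obtain ⟨c, hc⟩ := exists_coboundary_eq_of_apply_eq_zero hΩ F hκ hF hab
    have c₀ := hc ⟨{j, k, l}, h3 hjk hkl⟩ (by rw [ht]; exact Finset.subset_insert _ _)
    have c₁ := hc ⟨{i, k, l}, h3 hik hkl⟩
      (by rw [ht]; simp [Finset.insert_subset_iff])
    have c₂ := hc ⟨{i, j, l}, h3 hij hjl⟩
      (by rw [ht]; simp [Finset.insert_subset_iff])
    rw [coboundary_add, coboundary_smul, coboundary_smul] at c₀ c₁ c₂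
    rw [coboundary_single hij hjk hkl rfl, coboundary_single hjk hjk hkl rfl] at c₀
    rw [coboundary_single hij hik hkl rfl, coboundary_single hjk hik hkl rfl] at c₁
    rw [coboundary_single hij hij hjl rfl, coboundary_single hjk hij hjl rfl] at c₂
    simp [hij.ne, hij.ne', hjk.ne, hjk.ne', hkl.ne', hik.ne', hjl.ne', hΩ] at c₀ c₁ c₂
    subst c₁
    simpa using And.intro c₂ c₀
  have hspan := hli.span_eq_top_of_card_eq_finrank' (by simp)
  rw [← LinearMap.range_eq_top, ← top_le_iff, ← hspan, Submodule.span_le]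
  rintro _ ⟨q, rfl⟩
  fin_cases q
  · exact ⟨_, rfl⟩
  · exact ⟨_, rfl⟩

/-- The cone over a 1-cochain with apex `v`. -/
noncomputable def cone (μ : Simplex 1 → ℂ) (v : Fin 6) (p : Simplex 0) : ℂ := ∑ i ∈ p.1, alt μ v i

theorem alt_coboundary_cone (μ : Simplex 1 → ℂ) (v i j : Fin 6) :
    alt (coboundary (cone μ v)) i j = alt μ v j - alt μ v i := by
  rw [coboundary_edge, extendZero_eq _ (Finset.card_singleton i),
    extendZero_eq _ (Finset.card_singleton j)]
  simp [cone]

namespace EdgeForm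

variable {N : Simplex 1 → ℂ} {u : Simplex 4} {d : Simplex 1 → Op} {κ : ℂ}

theorem cochainOp_mem_opSpace {Ω : Simplex 2 → ℂ} (H : EdgeForm Ω u d κ) (μ : Simplex 1 → ℂ) :
    cochainOp u d μ ∈ opSpace u := by
  intro t ht
  rw [cochainOp_apply]
  exact Finset.sum_eq_zero fun a ha => by
    rw [H.support a (Finset.mem_filter.1 ha).2 t fun h => ht h.2, smul_zero]

/-- The component at `t` as a linear map. -/
noncomputable def component (u : Simplex 4) (d : Simplex 1 → Op) (t : Simplex 3) :
    (Simplex 1 → ℂ) →ₗ[ℂ] ℂ × ℂ := LinearMap.proj t ∘ₗ cochainHom u d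

theorem component_apply (t : Simplex 3) (μ : Simplex 1 → ℂ) :
    component u d t μ = cochainOp u d μ t := rfl

theorem exists_coboundary_eq (hN : ∀ s, coboundary N s ≠ 0) (hκ : κ ≠ 0)
    (H : EdgeForm (coboundary N) u d κ) {t : Simplex 3} (ht : t.1 ⊆ u.1) {μ : Simplex 1 → ℂ}
    (hμ : cochainOp u d μ t = 0) :
    ∃ c : ℂ, ∀ s : Simplex 2, s.1 ⊆ t.1 → coboundary μ s = c * coboundary N s :=
  exists_coboundary_eq_of_apply_eq_zero hN (component u d t)
    (mul_ne_zero hκ (incidence_ne_zero ht)) (H.mul_eq t ht) hμ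

end EdgeForm

theorem exists_triangle_subset {u : Simplex 4} {t₁ t₂ : Simplex 3} (h₁ : t₁.1 ⊆ u.1)
    (h₂ : t₂.1 ⊆ u.1) : ∃ s : Simplex 2, s.1 ⊆ t₁.1 ∧ s.1 ⊆ t₂.1 := by
  have h : 3 ≤ (t₁.1 ∩ t₂.1).card := by
    have := Finset.card_union_add_card_inter t₁.1 t₂.1
    have h' := Finset.card_le_card (Finset.union_subset h₁ h₂)
    rw [t₁.2, t₂.2] at this
    rw [u.2] at h'
    omega
  obtain ⟨s, hs, hc⟩ := Finset.exists_subset_card_eq h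
  exact ⟨⟨s, hc⟩, hs.trans Finset.inter_subset_left, hs.trans Finset.inter_subset_right⟩

/-- The factors of proportionality on two tetrahedra of a 4-simplex agree, because the tetrahedra
share a triangle. -/
theorem factor_unique {N μ : Simplex 1 → ℂ} (hN : ∀ s, coboundary N s ≠ 0) {u : Simplex 4}
    {t₁ t₂ : Simplex 3} (h₁ : t₁.1 ⊆ u.1) (h₂ : t₂.1 ⊆ u.1) {c₁ c₂ : ℂ}
    (e₁ : ∀ s : Simplex 2, s.1 ⊆ t₁.1 → coboundary μ s = c₁ * coboundary N s)
    (e₂ : ∀ s : Simplex 2, s.1 ⊆ t₂.1 → coboundary μ s = c₂ * coboundary N s) : c₁ = c₂ := by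
  obtain ⟨s, hs₁, hs₂⟩ := exists_triangle_subset h₁ h₂
  exact mul_right_cancel₀ (hN s) ((e₁ s hs₁).symm.trans (e₂ s hs₂))

/-! ### The spaces spanned by edge operators -/

theorem subset_facet_iff {u : Simplex 4} {k : ℕ} {s : Simplex k} (hs : s.1 ⊆ u.1) (v : Fin 6)
    (hv : v ∈ u.1) : s.1 ⊆ (facet u v hv).1 ↔ v ∉ s.1 := by
  change s.1 ⊆ u.1.erase v ↔ _
  rw [Finset.subset_erase]
  simp [hs]

namespace EdgeForm

variable {N : Simplex 1 → ℂ} {u : Simplex 4} {d : Simplex 1 → Op} {κ : ℂ}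

/-- If the operator of `μ` vanishes at three tetrahedra of `u`, then `δμ` is proportional to `δN`
on `u`, so that the operator is zero. -/
theorem exists_coboundary_eq_of_three (hN : ∀ s, coboundary N s ≠ 0) (hκ : κ ≠ 0)
    (H : EdgeForm (coboundary N) u d κ) {μ : Simplex 1 → ℂ} {p q r : Fin 6} (hp : p ∈ u.1)
    (hq : q ∈ u.1) (hr : r ∈ u.1) (hpq : p ≠ q) (hpr : p ≠ r) (hqr : q ≠ r)
    (h₁ : cochainOp u d μ (facet u p hp) = 0) (h₂ : cochainOp u d μ (facet u q hq) = 0)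
    (h₃ : cochainOp u d μ (facet u r hr) = 0) :
    ∃ c : ℂ, ∀ s : Simplex 2, s.1 ⊆ u.1 → coboundary μ s = c * coboundary N s := by
  have s := fun v hv => facet_subset u v hv
  obtain ⟨c, e₁⟩ := H.exists_coboundary_eq hN hκ (s p hp) h₁
  obtain ⟨c₂, e₂⟩ := H.exists_coboundary_eq hN hκ (s q hq) h₂
  obtain ⟨c₃, e₃⟩ := H.exists_coboundary_eq hN hκ (s r hr) h₃
  obtain rfl := factor_unique hN (s p hp) (s q hq) e₁ e₂
  obtain rfl := factor_unique hN (s p hp) (s r hr) e₁ e₃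
  refine ⟨c, fun σ hσ => ?_⟩
  by_cases hpσ : p ∈ σ.1
  swap
  · exact e₁ σ ((subset_facet_iff hσ p hp).2 hpσ)
  by_cases hqσ : q ∈ σ.1
  swap
  · exact e₂ σ ((subset_facet_iff hσ q hq).2 hqσ)
  by_cases hrσ : r ∈ σ.1
  swap
  · exact e₃ σ ((subset_facet_iff hσ r hr).2 hrσ)
  -- the remaining triangle `pqr` is a face of a tetrahedron whose other faces have been treated
  obtain ⟨y, hyu, hy⟩ := Finset.exists_mem_notMem_of_card_lt_card (s := σ.1) (t := u.1)
    (by rw [σ.2, u.2]; omega)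
  let t : Simplex 3 := ⟨insert y σ.1, by rw [Finset.card_insert_of_notMem hy, σ.2]⟩
  have hσ' : σ.1 = {p, q, r} := by
    symm
    apply Finset.eq_of_subset_of_card_le
    · simp [Finset.insert_subset_iff, hpσ, hqσ, hrσ]
    · rw [σ.2, Finset.card_eq_three.2 ⟨p, q, r, hpq, hpr, hqr, rfl⟩]
  have hdd := coboundary_coboundary (μ - c • N) t
  rw [coboundary_eq, Finset.sum_eq_single y] at hdd
  · have e : t.1.erase y = σ.1 := Finset.erase_insert hy
    have hne : facetSign t.1 y ≠ 0 := by simp [facetSign]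
    have h0 := (mul_eq_zero.1 hdd).resolve_left hne
    rw [e, extendZero_eq _ σ.2, sub_eq_add_neg, ← neg_smul, coboundary_add, coboundary_smul] at h0
    linear_combination h0
  · intro v hv hvy
    have hvσ : v ∈ σ.1 := (Finset.mem_insert.1 hv).resolve_left hvy
    have hc : (t.1.erase v).card = 2 + 1 := by rw [Finset.card_erase_of_mem hv, t.2]
    have hsub : t.1.erase v ⊆ u.1 := (Finset.erase_subset _ _).trans
      (Finset.insert_subset hyu hσ)
    rw [extendZero_eq _ hc, sub_eq_add_neg, ← neg_smul, coboundary_add, coboundary_smul]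
    have hv' := hvσ
    rw [hσ'] at hv'
    simp only [Finset.mem_insert, Finset.mem_singleton] at hv'
    have : coboundary μ ⟨t.1.erase v, hc⟩ = c * coboundary N ⟨t.1.erase v, hc⟩ := by
      rcases hv' with rfl | rfl | rfl
      · exact e₁ _ ((subset_facet_iff hsub _ hp).2 (by simp))
      · exact e₂ _ ((subset_facet_iff hsub _ hq).2 (by simp))
      · exact e₃ _ ((subset_facet_iff hsub _ hr).2 (by simp))
    rw [this]; ring
  · intro h
    exact absurd (Finset.mem_insert_self y σ.1) h

theorem exists_coboundary_eq_of_eq_zero (hN : ∀ s, coboundary N s ≠ 0) (hκ : κ ≠ 0)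
    (H : EdgeForm (coboundary N) u d κ) {μ : Simplex 1 → ℂ} (h : cochainOp u d μ = 0) :
    ∃ c : ℂ, ∀ s : Simplex 2, s.1 ⊆ u.1 → coboundary μ s = c * coboundary N s := by
  obtain ⟨p, q, r, l, m, hpq, hqr, -, -, hu⟩ := exists_sorted₅ u
  exact H.exists_coboundary_eq_of_three hN hκ (p := p) (q := q) (r := r) (by simp [hu]) (by simp [hu])
    (by simp [hu]) hpq.ne (hpq.trans hqr).ne hqr.ne (congrFun h _) (congrFun h _) (congrFun h _)

/-- Only multiples of `d_a` vanish at the tetrahedra not containing the edge `a`. -/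
theorem mem_span_of_apply_eq_zero (hN : ∀ s, coboundary N s ≠ 0) (hκ : κ ≠ 0)
    (H : EdgeForm (coboundary N) u d κ) {a : Simplex 1} (ha : a.1 ⊆ u.1) {μ : Simplex 1 → ℂ}
    (h : ∀ t : Simplex 3, ¬ a.1 ⊆ t.1 → cochainOp u d μ t = 0) :
    cochainOp u d μ ∈ Submodule.span ℂ {d a} := by
  obtain ⟨p, q, hpq, rfl⟩ := exists_eq_edge a
  have hp : p ∈ u.1 := ha (by simp [edge])
  have hq : q ∈ u.1 := ha (by simp [edge])
  have s := fun v hv => facet_subset u v hv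
  obtain ⟨c, e₁⟩ := H.exists_coboundary_eq hN hκ (s p hp)
    (h _ (by rw [subset_facet_iff ha]; simp [edge]))
  obtain ⟨c₂, e₂⟩ := H.exists_coboundary_eq hN hκ (s q hq)
    (h _ (by rw [subset_facet_iff ha]; simp [edge]))
  obtain rfl := factor_unique hN (s p hp) (s q hq) e₁ e₂
  obtain ⟨v, hvu, hv⟩ := Finset.exists_mem_notMem_of_card_lt_card (s := ({p, q} : Finset (Fin 6)))
    (t := u.1) (by rw [Finset.card_pair hpq.ne, u.2]; omega)
  simp only [Finset.mem_insert, Finset.mem_singleton, not_or] at hv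
  -- subtracting a multiple of `N` and a coboundary leaves a cochain supported at the edge `pq`
  let ξ : Simplex 1 → ℂ := c • N + coboundary (cone (μ - c • N) v)
  have hξ0 : cochainOp u d ξ = 0 := H.cochainOp_eq_zero ξ c fun σ _ => by
    rw [coboundary_add, coboundary_smul, coboundary_coboundary, add_zero]
  have hξ : ∀ b : Simplex 1, b.1 ⊆ u.1 → b ≠ edge p q hpq.ne → μ b = ξ b := by
    intro b hb hne
    obtain ⟨i, j, hij, rfl⟩ := exists_eq_edge b
    have hi : i ∈ u.1 := hb (by simp [edge])
    have hj : j ∈ u.1 := hb (by simp [edge])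
    have hcyc : cyc (μ - c • N) v i j = 0 := by
      have key : ∀ (w : Fin 6) (hw : w ∈ u.1), w ≠ v → w ≠ i → w ≠ j →
          (∀ s : Simplex 2, s.1 ⊆ (facet u w hw).1 → coboundary μ s = c * coboundary N s) →
          cyc (μ - c • N) v i j = 0 := by
        intro w hw h1 h2 h3 e
        have := cyc_eq_of_coboundary_eq (s := (facet u w hw).1) (μ := μ - c • N) (N := N) (c := 0)
          (fun r hr => by
            rw [sub_eq_add_neg, ← neg_smul, coboundary_add, coboundary_smul, e r hr]; ring)
          (i := v) (j := i) (k := j) (Finset.mem_erase.2 ⟨h1.symm, hvu⟩)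
          (Finset.mem_erase.2 ⟨h2.symm, hi⟩) (Finset.mem_erase.2 ⟨h3.symm, hj⟩)
        rw [this, zero_mul]
      by_cases hpij : p = i ∨ p = j
      · refine key q hq (Ne.symm hv.2) ?_ ?_ e₂
        · rintro rfl
          rcases hpij with rfl | rfl
          · exact hpq.ne rfl
          · exact hij.not_gt hpq
        · rintro rfl
          rcases hpij with rfl | rfl
          · exact hne rfl
          · exact hpq.ne rfl
      · rw [not_or] at hpij
        exact key p hp (Ne.symm hv.1) hpij.1 hpij.2 e₁
    have h1 := alt_coboundary_cone (μ - c • N) v i j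
    rw [alt_of_lt _ hij] at h1
    rw [cyc, alt_swap _ v j, alt_of_lt _ hij] at hcyc
    have h2 : (μ - c • N) (edge i j hij.ne) = μ (edge i j hij.ne) - c * N (edge i j hij.ne) := rfl
    change μ (edge i j hij.ne) = c * N (edge i j hij.ne) + _
    rw [h1]
    linear_combination hcyc - h2
  have hdiff : cochainOp u d μ = (μ - ξ) (edge p q hpq.ne) • d (edge p q hpq.ne) := by
    rw [← sub_zero (cochainOp u d μ), ← hξ0, ← cochainHom_apply, ← cochainHom_apply, ← map_sub,
      cochainHom_apply, cochainOp, Finset.sum_eq_single (edge p q hpq.ne)]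
    · intro b hb hne
      rw [Pi.sub_apply, hξ b (Finset.mem_filter.1 hb).2 hne, sub_self, zero_smul]
    · intro h
      simp [ha] at h
  rw [hdiff]
  exact Submodule.smul_mem _ _ (Submodule.mem_span_singleton_self _)

/-- By `EdgeForm.mul_eq`, the scalar squares are values of `δδ`. -/
theorem isIsotropic_range {Ω : Simplex 2 → ℂ} (H : EdgeForm Ω u d κ) :
    IsIsotropic (LinearMap.range (cochainHom u d)) := by
  have hq : ∀ μ, scalarProd (cochainHom u d μ) (cochainHom u d μ) = 0 := by
    intro μ
    have h1 : scalarProd (cochainHom u d μ) (cochainHom u d μ) =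
        ∑ t : Simplex 3 with t.1 ⊆ u.1,
          2 * κ * (incidence u t * coboundary (energy Ω μ) t) := by
      rw [scalarProd, Finset.sum_filter]
      refine Finset.sum_congr rfl fun t _ => ?_
      split_ifs with ht
      · rw [cochainHom_apply]
        linear_combination 2 * H.mul_eq t ht μ
      · rw [cochainHom_apply, H.cochainOp_mem_opSpace μ t ht]; simp
    rw [h1, ← Finset.mul_sum, ← coboundary_eq_sum_incidence, coboundary_coboundary, mul_zero]
  rintro _ ⟨μ, rfl⟩ _ ⟨ν, rfl⟩
  have h := hq (μ + ν)
  simp only [map_add, ← scalarForm_apply, LinearMap.add_apply] at h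
  simp only [scalarForm_apply] at h
  rw [hq, hq, scalarProd_comm (cochainHom u d ν)] at h
  have : 2 * scalarProd (cochainHom u d μ) (cochainHom u d ν) = 0 := by linear_combination h
  exact (mul_eq_zero.1 this).resolve_left two_ne_zero

end EdgeForm

/-- A lower bound for the dimension of the space consisting of the operators coinciding on `B` with
an operator of a cochain supported on `A` and having no `x`-part outside `B`. -/
theorem card_add_card_le_finrank (A : Set (Simplex 1)) (B : Set (Simplex 3))
    (φ : (Simplex 1 → ℂ) →ₗ[ℂ] Op) (n : Simplex 1 → ℂ)
    (h : ∀ μ : Simplex 1 → ℂ, (∀ a ∉ A, μ a = 0) → (∀ t ∈ B, φ μ t = 0) →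
      ∃ c : ℂ, ∀ a ∈ A, μ a = c * n a)
    (L : Submodule ℂ Op)
    (hL : ∀ (μ : Simplex 1 → ℂ) (e : Op), (∀ t ∈ B, e t = φ μ t) → (∀ t ∉ B, (e t).2 = 0) → e ∈ L) :
    Nat.card A + Nat.card (Bᶜ : Set (Simplex 3)) ≤ finrank ℂ L + 1 := by
  classical
  let ext : (A → ℂ) →ₗ[ℂ] (Simplex 1 → ℂ) :=
    { toFun := fun f a => if h : a ∈ A then f ⟨a, h⟩ else 0
      map_add' := fun f g => by funext a; by_cases h : a ∈ A <;> simp [h]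
      map_smul' := fun c f => by funext a; by_cases h : a ∈ A <;> simp [h] }
  have hext : ∀ f (a : A), ext f a = f a := fun f a => dif_pos a.2
  let g : (A → ℂ) × ((Bᶜ : Set (Simplex 3)) → ℂ) →ₗ[ℂ] Op :=
    { toFun := fun p t => if h : t ∈ B then φ (ext p.1) t else (p.2 ⟨t, h⟩, 0)
      map_add' := fun p q => by
        funext t
        by_cases h : t ∈ B <;> simp [h]
      map_smul' := fun c p => by
        funext t
        by_cases h : t ∈ B <;> simp [h] }
  have hgB : ∀ p, ∀ t ∈ B, g p t = φ (ext p.1) t := fun p t ht => dif_pos ht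
  have hgB' : ∀ p (t : (Bᶜ : Set (Simplex 3))), g p t = (p.2 t, 0) := fun p t => dif_neg t.2
  have hle : LinearMap.range g ≤ L := by
    rintro _ ⟨p, rfl⟩
    exact hL (ext p.1) _ (hgB p) fun t ht => by rw [hgB' p ⟨t, ht⟩]
  have hker : LinearMap.ker g ≤ Submodule.span ℂ
      ({((fun a : A => n a), 0)} : Set ((A → ℂ) × ((Bᶜ : Set (Simplex 3)) → ℂ))) := by
    intro p hp
    have hp' : g p = 0 := hp
    obtain ⟨c, hc⟩ := h (ext p.1) (fun a ha => dif_neg ha) fun t ht => by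
      rw [← hgB p t ht, hp']; rfl
    refine Submodule.mem_span_singleton.2 ⟨c, Prod.ext ?_ ?_⟩
    · funext a
      have := hc a a.2
      rw [hext] at this
      exact this.symm
    · funext t
      have := congrArg Prod.fst (hgB' p t)
      rw [hp'] at this
      simpa using this
  have h1 : finrank ℂ (LinearMap.ker g) ≤ 1 :=
    (Submodule.finrank_mono hker).trans ((finrank_span_le_card _).trans (by simp))
  have h2 := LinearMap.finrank_range_add_finrank_ker g
  have h3 := Submodule.finrank_mono hle
  rw [Module.finrank_prod, Module.finrank_fintype_fun_eq_card, Module.finrank_fintype_fun_eq_card,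
    ← Nat.card_eq_fintype_card, ← Nat.card_eq_fintype_card] at h2
  omega

/-- A 1-cochain vanishing at the edges through the vertex `v` is determined by its coboundary on
the triangles through `v`. -/
theorem eq_mul_of_cyc_eq {μ N : Simplex 1 → ℂ} {v : Fin 6} {c : ℂ}
    (hμ : ∀ a : Simplex 1, v ∈ a.1 → μ a = 0) {a : Simplex 1}
    (h : ∀ i j, i ∈ a.1 → j ∈ a.1 → cyc μ v i j = c * cyc N v i j) :
    μ a = c * (N - coboundary (cone N v)) a := by
  obtain ⟨i, j, hij, rfl⟩ := exists_eq_edge a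
  have h2 := h i j (by simp [edge]) (by simp [edge])
  have hvμ : ∀ i, alt μ v i = 0 := by
    intro i
    rcases lt_trichotomy v i with h | h | h
    · rw [alt_of_lt _ h]; exact hμ _ (by simp [edge])
    · rw [h, alt_self]
    · rw [alt_swap, alt_of_lt _ h, hμ _ (by simp [edge]), neg_zero]
  rw [cyc, cyc, alt_swap μ v j, hvμ, hvμ, alt_of_lt μ hij, alt_of_lt N hij, alt_swap N v j] at h2
  have h4 := alt_coboundary_cone N v i j
  rw [alt_of_lt _ hij] at h4
  rw [Pi.sub_apply, h4]
  linear_combination h2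

theorem card_simplex_subset (k : ℕ) (w : Finset (Fin 6)) :
    Nat.card {s : Simplex k | s.1 ⊆ w} = w.card.choose (k + 1) := by
  rw [← Finset.card_powersetCard, ← Fintype.card_coe, ← Nat.card_eq_fintype_card]
  refine Nat.card_congr
    { toFun := fun s => ⟨s.1.1, Finset.mem_powersetCard.2 ⟨s.2, s.1.2⟩⟩
      invFun := fun s => ⟨⟨s.1, (Finset.mem_powersetCard.1 s.2).2⟩,
        (Finset.mem_powersetCard.1 s.2).1⟩
      left_inv := fun _ => rfl
      right_inv := fun _ => rfl }

theorem card_simplex (k : ℕ) : Fintype.card (Simplex k) = (6).choose (k + 1) := by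
  rw [Fintype.card_finset_len, Fintype.card_fin]

namespace EdgeForm

variable {N : Simplex 1 → ℂ} {u : Simplex 4} {d : Simplex 1 → Op} {κ : ℂ}

/-- The space spanned by the edge operators contains everything in `opSpace u` orthogonal to it,
because its extension by the `∂_t` with `t` not in `u` is isotropic of dimension fifteen. -/
theorem mem_of_orthogonal (hN : ∀ s, coboundary N s ≠ 0) (hκ : κ ≠ 0)
    (H : EdgeForm (coboundary N) u d κ) {e : Op} (he : e ∈ opSpace u)
    (horth : ∀ f ∈ LinearMap.range (cochainHom u d), scalarProd f e = 0) :
    e ∈ LinearMap.range (cochainHom u d) := by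
  set V := LinearMap.range (cochainHom u d) with hV
  have hVu : V ≤ opSpace u := by
    rintro _ ⟨μ, rfl⟩
    exact H.cochainOp_mem_opSpace μ
  obtain ⟨v, hv⟩ : u.1.Nonempty := Finset.card_pos.1 (by rw [u.2]; omega)
  have hdim := card_add_card_le_finrank {a : Simplex 1 | a.1 ⊆ u.1.erase v}
    {t : Simplex 3 | t.1 ⊆ u.1} (cochainHom u d) (N - coboundary (cone N v)) (by
      intro μ hμ h0
      have h1 : cochainOp u d μ = 0 := by
        funext t
        by_cases ht : t.1 ⊆ u.1
        · exact h0 t ht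
        · exact H.cochainOp_mem_opSpace μ t ht
      obtain ⟨c, hc⟩ := H.exists_coboundary_eq_of_eq_zero hN hκ h1
      refine ⟨c, fun a ha => ?_⟩
      refine eq_mul_of_cyc_eq (fun b hb => hμ b fun h => ?_) fun i j hi hj => ?_
      · simpa using h hb
      · exact cyc_eq_of_coboundary_eq hc hv (Finset.mem_of_mem_erase (ha hi))
          (Finset.mem_of_mem_erase (ha hj)))
    (extendedSpace u V) (fun μ e h1 h2 => ⟨⟨cochainHom u d μ, ⟨μ, rfl⟩,
      H.cochainOp_mem_opSpace μ, h1⟩, h2⟩)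
  have hcompl : Nat.card ({t : Simplex 3 | t.1 ⊆ u.1}ᶜ : Set (Simplex 3)) = 10 := by
    have h1 := Set.ncard_add_ncard_compl {t : Simplex 3 | t.1 ⊆ u.1}
    have h2 : Set.ncard {t : Simplex 3 | t.1 ⊆ u.1} = 5 := by
      have := card_simplex_subset 3 u.1
      rw [u.2] at this
      exact this
    rw [h2, Nat.card_eq_fintype_card, card_simplex] at h1
    have h3 : Nat.choose 6 (3 + 1) = 15 := rfl
    rw [h3] at h1
    change Set.ncard _ = 10
    omega
  rw [hcompl, card_simplex_subset, Finset.card_erase_of_mem hv, u.2] at hdim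
  have hL : e ∈ extendedSpace u V := by
    refine mem_of_forall_scalarProd_eq_zero ?_ ?_ ?_
    · rintro f₁ ⟨⟨g₁, hg₁, hgu₁, h₁⟩, h₁'⟩ f₂ ⟨⟨g₂, hg₂, hgu₂, h₂⟩, h₂'⟩
      rw [← H.isIsotropic_range g₁ hg₁ g₂ hg₂]
      refine Finset.sum_congr rfl fun t _ => ?_
      by_cases ht : t.1 ⊆ u.1
      · rw [h₁ t ht, h₂ t ht]
      · rw [h₁' t ht, h₂' t ht, hgu₁ t ht]
        simp
    · rw [card_simplex]
      change 15 ≤ _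
      have : Nat.choose (4 + 1 - 1) (1 + 1) = 6 := rfl
      omega
    · rintro f ⟨⟨g, hg, hgu, h⟩, h'⟩
      rw [← horth g hg]
      refine Finset.sum_congr rfl fun t _ => ?_
      by_cases ht : t.1 ⊆ u.1
      · rw [h t ht]
      · rw [he t ht, hgu t ht]
        simp
  obtain ⟨⟨g, hg, hgu, h⟩, -⟩ := hL
  have : e = g := by
    funext t
    by_cases ht : t.1 ⊆ u.1
    · exact h t ht
    · rw [he t ht, hgu t ht]
  rw [this]
  exact hg

/-- Operators with the algebraic description of `EdgeForm` are edge operators built from `δN`. -/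
theorem builtFrom (hN : ∀ s, coboundary N s ≠ 0) (hκ : κ ≠ 0)
    (H : EdgeForm (coboundary N) u d κ) :
    BuiltFrom (coboundary N) u (LinearMap.range (cochainHom u d)) d := by
  have hVu : LinearMap.range (cochainHom u d) ≤ opSpace u := by
    rintro _ ⟨μ, rfl⟩
    exact H.cochainOp_mem_opSpace μ
  have hmem : ∀ a : Simplex 1, a.1 ⊆ u.1 → d a ∈ LinearMap.range (cochainHom u d) :=
    fun a ha => ⟨Pi.single a 1, cochainOp_single d ha⟩
  refine ⟨⟨⟨hVu, H.isIsotropic_range⟩, fun V' hV' hle e he => ?_⟩, ⟨?_, ?_, ?_, ?_⟩, ⟨N, ?_, ?_⟩, ?_⟩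
  · exact H.mem_of_orthogonal hN hκ (hV'.1 he) fun f hf => hV'.2 f (hle hf) e he
  · -- an edge with zero operator would have coboundary proportional to `δN`
    intro a ha h0
    obtain ⟨i, j, hij, rfl⟩ := exists_eq_edge a
    rw [← cochainOp_single d ha] at h0
    obtain ⟨c, hc⟩ := H.exists_coboundary_eq_of_eq_zero hN hκ h0
    have hi : i ∈ u.1 := ha (by simp [edge])
    have hj : j ∈ u.1 := ha (by simp [edge])
    have h3 : (1 + 1 + 1) ≤ (u.1.erase i).card := by
      rw [Finset.card_erase_of_mem hi, u.2]; omega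
    obtain ⟨s, hs, hsc⟩ := Finset.exists_subset_card_eq h3
    have hsu : s ⊆ u.1 := hs.trans (Finset.erase_subset _ _)
    have hsi : i ∉ s := fun h => by simpa using hs h
    obtain ⟨p, q, r, hpq, hqr, hpqr⟩ := exists_sorted₃ ⟨s, hsc⟩
    have e1 := hc ⟨s, hsc⟩ hsu
    have hpi : p ≠ i := by rintro rfl; exact hsi (by rw [show s = _ from hpqr]; simp)
    have hqi : q ≠ i := by rintro rfl; exact hsi (by rw [show s = _ from hpqr]; simp)
    rw [coboundary_single hij hpq hqr hpqr] at e1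
    simp only [hpi, hqi, false_and, if_false] at e1
    have hc0 : c = 0 := by
      have := hN ⟨s, hsc⟩
      simpa [this] using e1
    obtain ⟨y, hyu, hy⟩ := Finset.exists_mem_notMem_of_card_lt_card
      (s := ({i, j} : Finset (Fin 6))) (t := u.1) (by rw [Finset.card_pair hij.ne, u.2]; omega)
    simp only [Finset.mem_insert, Finset.mem_singleton, not_or] at hy
    have e2 := cyc_eq_of_coboundary_eq hc hi hj hyu
    have hz : ∀ a b, (a = y ∨ b = y) →
        alt (Pi.single (edge i j hij.ne) (1 : ℂ) : Simplex 1 → ℂ) a b = 0 := by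
      intro a b hab
      rcases lt_trichotomy a b with h | h | h
      · rw [alt_single hij h, if_neg]
        rintro ⟨rfl, rfl⟩
        rcases hab with h | h
        · exact hy.1 h.symm
        · exact hy.2 h.symm
      · rw [h, alt_self]
      · rw [alt_swap, alt_single hij h, if_neg, neg_zero]
        rintro ⟨rfl, rfl⟩
        rcases hab with h | h
        · exact hy.2 h.symm
        · exact hy.1 h.symm
    rw [hc0, cyc, hz j y (Or.inr rfl), hz y i (Or.inl rfl), alt_single hij hij] at e2
    simp at e2
  · intro a ha
    apply le_antisymm
    · rintro _ ⟨⟨μ, rfl⟩, h⟩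
      exact H.mem_span_of_apply_eq_zero hN hκ ha h
    · rw [Submodule.span_singleton_le_iff_mem]
      exact ⟨hmem a ha, fun t ht => H.support a ha t fun h => ht h.1⟩
  · intro f
    exact H.cochainOp_eq_zero _ 0 fun s _ => by rw [coboundary_coboundary, zero_mul]
  · exact (range_cochainHom u d).symm
  · exact H.cochainOp_eq_zero N 1 fun s _ => (one_mul _).symm
  · exact fun s _ => rfl
  · obtain ⟨s, hs, hsc⟩ := Finset.exists_subset_card_eq (s := u.1) (n := 2 + 1)
      (by rw [u.2]; omega)
    exact ⟨⟨s, hsc⟩, hs, hN _⟩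

end EdgeForm

/-! ### Existence of edge operators -/

/-- Over the complex numbers, a binary quadratic form is a product of two linear forms. -/
theorem exists_mul_eq_binaryForm (A B C : ℂ) : ∃ p q r s : ℂ, ∀ X Y : ℂ,
    (p * X + q * Y) * (r * X + s * Y) = A * X ^ 2 + 2 * B * X * Y + C * Y ^ 2 := by
  by_cases hA : A = 0
  · exact ⟨0, 1, 2 * B, C, fun X Y => by rw [hA]; ring⟩
  · obtain ⟨D, hD⟩ := IsAlgClosed.exists_pow_nat_eq (B ^ 2 - A * C) (n := 2) (by norm_num)
    refine ⟨A, B + D, 1, (B - D) / A, fun X Y => ?_⟩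
    field_simp
    linear_combination (-(Y ^ 2)) * hD

/-- The quadratic form of a tetrahedron is a product of two linear forms which vanish at the
cochains with coboundary proportional to `Ω`. -/
theorem exists_mul_eq_coboundary_energy {Ω : Simplex 2 → ℂ} (hΩ : ∀ s, Ω s ≠ 0) {t : Simplex 3}
    (ht : coboundary Ω t = 0) : ∃ F : (Simplex 1 → ℂ) →ₗ[ℂ] ℂ × ℂ,
      (∀ μ, (F μ).1 * (F μ).2 = coboundary (energy Ω μ) t) ∧
      ∀ (μ : Simplex 1 → ℂ) (c : ℂ),
        (∀ s : Simplex 2, s.1 ⊆ t.1 → coboundary μ s = c * Ω s) → F μ = 0 := by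
  obtain ⟨i, j, k, l, hij, hjk, hkl, hijkl⟩ := exists_sorted₄ t
  have hik := hij.trans hjk
  have hjl := hjk.trans hkl
  have hil := hik.trans hkl
  have h3 : ∀ {a b c : Fin 6}, a < b → b < c → ({a, b, c} : Finset (Fin 6)).card = 2 + 1 :=
    fun hab hbc => Finset.card_eq_three.2 ⟨_, _, _, hab.ne, (hab.trans hbc).ne, hbc.ne, rfl⟩
  set s₀ : Simplex 2 := ⟨{j, k, l}, h3 hjk hkl⟩ with hs₀
  set s₁ : Simplex 2 := ⟨{i, k, l}, h3 hik hkl⟩ with hs₁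
  set s₂ : Simplex 2 := ⟨{i, j, l}, h3 hij hjl⟩ with hs₂
  set s₃ : Simplex 2 := ⟨{i, j, k}, h3 hij hjk⟩ with hs₃
  have E : ∀ M : Simplex 2 → ℂ, coboundary M t = M s₀ - M s₁ + M s₂ - M s₃ := by
    intro M
    rw [coboundary_tetrahedron _ hij hjk hkl hijkl, extendZero_eq _ (h3 hjk hkl),
      extendZero_eq _ (h3 hik hkl), extendZero_eq _ (h3 hij hjl), extendZero_eq _ (h3 hij hjk)]
  -- subtracting a multiple of `Ω`, the value at `ijk` becomes zero
  let ρ : Simplex 2 → (Simplex 1 → ℂ) →ₗ[ℂ] ℂ := fun s =>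
    { toFun := fun μ => coboundary μ s - Ω s / Ω s₃ * coboundary μ s₃
      map_add' := fun μ ν => by rw [coboundary_add, coboundary_add]; ring
      map_smul' := fun c μ => by
        rw [coboundary_smul, coboundary_smul, RingHom.id_apply, smul_eq_mul]; ring }
  have hρ : ∀ s μ, ρ s μ = coboundary μ s - Ω s / Ω s₃ * coboundary μ s₃ := fun _ _ => rfl
  obtain ⟨p, q, r, z, hpq⟩ := exists_mul_eq_binaryForm (1 / Ω s₀ - 1 / Ω s₁) (-1 / Ω s₁)
    (1 / Ω s₂ - 1 / Ω s₁)
  refine ⟨(p • ρ s₀ + q • ρ s₂).prod (r • ρ s₀ + z • ρ s₂), fun μ => ?_, fun μ c hμ => ?_⟩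
  · refine (hpq (ρ s₀ μ) (ρ s₂ μ)).trans ?_
    have h1 := coboundary_coboundary μ t
    rw [E] at h1 ht
    rw [E, hρ, hρ]
    simp only [energy]
    have e1 : coboundary μ s₁ = coboundary μ s₀ + coboundary μ s₂ - coboundary μ s₃ := by
      linear_combination -h1
    have e2 : Ω s₁ = Ω s₀ + Ω s₂ - Ω s₃ := by linear_combination -ht
    have hm : ∀ m₀ m₂ m₃ w₀ w₁ w₂ w₃ : ℂ, w₀ ≠ 0 → w₁ ≠ 0 → w₂ ≠ 0 → w₃ ≠ 0 →
        w₁ = w₀ + w₂ - w₃ →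
        (1 / w₀ - 1 / w₁) * (m₀ - w₀ / w₃ * m₃) ^ 2 +
          2 * (-1 / w₁) * (m₀ - w₀ / w₃ * m₃) * (m₂ - w₂ / w₃ * m₃) +
          (1 / w₂ - 1 / w₁) * (m₂ - w₂ / w₃ * m₃) ^ 2 =
        m₀ ^ 2 / w₀ - (m₀ + m₂ - m₃) ^ 2 / w₁ + m₂ ^ 2 / w₂ - m₃ ^ 2 / w₃ := by
      intro m₀ m₂ m₃ w₀ w₁ w₂ w₃ h₀ h₁ h₂ h₃ h
      have h' : w₀ = w₁ - w₂ + w₃ := by linear_combination -h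
      field_simp
      subst h
      ring
    rw [hm _ _ _ _ _ _ _ (hΩ s₀) (hΩ s₁) (hΩ s₂) (hΩ s₃) e2, e1]
  · have hz : ∀ s : Simplex 2, s.1 ⊆ t.1 → ρ s μ = 0 := by
      intro s hs
      rw [hρ, hμ s hs, hμ s₃ (by rw [hijkl]; simp [hs₃, Finset.insert_subset_iff])]
      field_simp [hΩ s₃]
      ring
    have z₀ := hz s₀ (by rw [hijkl]; exact Finset.subset_insert _ _)
    have z₂ := hz s₂ (by rw [hijkl]; simp [hs₂, Finset.insert_subset_iff])
    simp [z₀, z₂]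

/-- The quadratic forms of the tetrahedra, factored into linear forms `F t`, determine a system of
edge operators for each 4-simplex `u` and each number `κ`. -/
noncomputable def edgeOperators (F : Simplex 3 → (Simplex 1 → ℂ) →ₗ[ℂ] ℂ × ℂ) (u : Simplex 4)
    (κ : ℂ) (a : Simplex 1) : Op := fun t =>
  if t.1 ⊆ u.1 then
    ((F t (Pi.single a 1)).1, κ * incidence u t * (F t (Pi.single a 1)).2)
  else 0

/-- A factorization of the quadratic forms of all tetrahedra. -/
structure IsFactorization (Ω : Simplex 2 → ℂ) (F : Simplex 3 → (Simplex 1 → ℂ) →ₗ[ℂ] ℂ × ℂ) :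
    Prop where
  mul_eq : ∀ t μ, (F t μ).1 * (F t μ).2 = coboundary (energy Ω μ) t
  eq_zero : ∀ t (μ : Simplex 1 → ℂ) (c : ℂ),
    (∀ s : Simplex 2, s.1 ⊆ t.1 → coboundary μ s = c * Ω s) → F t μ = 0

theorem exists_isFactorization {Ω : Simplex 2 → ℂ} (hΩ : ∀ s, Ω s ≠ 0) (h : IsCocycle Ω) :
    ∃ F, IsFactorization Ω F := by
  choose F h₁ h₂ using fun t => exists_mul_eq_coboundary_energy hΩ (h t)
  exact ⟨F, h₁, h₂⟩

theorem coboundary_single_eq_zero {a : Simplex 1} {s : Simplex 2} (h : ¬ a.1 ⊆ s.1) :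
    coboundary (Pi.single a (1 : ℂ) : Simplex 1 → ℂ) s = 0 := by
  refine Finset.sum_eq_zero fun v _ => ?_
  rw [Pi.single_eq_of_ne, mul_zero]
  rintro rfl
  exact h (facet_subset s v.1 v.2)

namespace IsFactorization

variable {Ω : Simplex 2 → ℂ} {F : Simplex 3 → (Simplex 1 → ℂ) →ₗ[ℂ] ℂ × ℂ}

theorem apply_single_eq_zero (hF : IsFactorization Ω F) {a : Simplex 1} {t : Simplex 3} (h : ¬ a.1 ⊆ t.1) :
    F t (Pi.single a 1) = 0 :=
  hF.eq_zero t _ 0 fun s hs => by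
    rw [coboundary_single_eq_zero fun has => h (has.trans hs), zero_mul]

theorem cochainOp_apply (hF : IsFactorization Ω F) {u : Simplex 4} (κ : ℂ) (μ : Simplex 1 → ℂ) {t : Simplex 3}
    (ht : t.1 ⊆ u.1) : cochainOp u (edgeOperators F u κ) μ t =
      ((F t μ).1, κ * incidence u t * (F t μ).2) := by
  have hμ : F t μ = ∑ a : Simplex 1 with a.1 ⊆ u.1, μ a • F t (Pi.single a 1) := by
    conv_lhs => rw [pi_eq_sum_univ' μ, map_sum]
    simp only [map_smul]
    refine (Finset.sum_filter_of_ne fun a _ ha => ?_).symm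
    by_contra hau
    exact ha (by rw [hF.apply_single_eq_zero fun h => hau (h.trans ht), smul_zero])
  rw [Pachner.cochainOp_apply, hμ]
  ext
  · simp [edgeOperators, ht, Prod.fst_sum]
  · simp only [edgeOperators, ht, if_true, Prod.snd_sum, Finset.mul_sum, Prod.smul_snd, smul_eq_mul]
    exact Finset.sum_congr rfl fun a _ => by ring

theorem edgeForm (hF : IsFactorization Ω F) (u : Simplex 4) (κ : ℂ) : EdgeForm Ω u (edgeOperators F u κ) κ where
  support a _ t ht := by
    by_cases htu : t.1 ⊆ u.1
    · simp [edgeOperators, hF.apply_single_eq_zero fun h => ht ⟨h, htu⟩]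
    · simp [edgeOperators, htu]
  cochainOp_eq_zero μ c hμ := by
    funext t
    by_cases htu : t.1 ⊆ u.1
    · rw [hF.cochainOp_apply κ μ htu, hF.eq_zero t μ c fun s hs => hμ s (hs.trans htu)]
      simp
    · rw [Pachner.cochainOp_apply]
      exact Finset.sum_eq_zero fun a _ => by simp [edgeOperators, htu]
  mul_eq t ht μ := by
    rw [hF.cochainOp_apply κ μ ht]
    linear_combination κ * incidence u t * hF.mul_eq t μ

end IsFactorization

/-! ### Generic cocycles -/

/-- Every 2-cocycle is a coboundary. -/
theorem exists_coboundary_eq_of_isCocycle {Ω : Simplex 2 → ℂ} (h : IsCocycle Ω) :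
    ∃ N : Simplex 1 → ℂ, Ω = coboundary N := by
  let N : Simplex 1 → ℂ := fun a => extendZero Ω (insert 0 a.1)
  refine ⟨N, funext fun s => ?_⟩
  obtain ⟨i, j, k, hij, hjk, hs⟩ := exists_sorted₃ s
  have hik := hij.trans hjk
  have hN : ∀ {a b : Fin 6} (hab : a < b), alt N a b = extendZero Ω {0, a, b} := fun hab => by
    rw [alt_of_lt _ hab]; rfl
  have hΩ : Ω s = extendZero Ω {i, j, k} := by
    rw [extendZero_eq Ω (by rw [← hs, s.2])]
    exact congrArg Ω (Subtype.ext hs)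
  rw [coboundary_triangle N hij hjk hs, cyc, alt_swap N i k, hN hij, hN hjk, hN hik, hΩ]
  rcases Nat.eq_zero_or_pos i.1 with hi | hi
  · obtain rfl : i = 0 := Fin.ext hi
    have hz : ∀ b : Fin 6, extendZero Ω {0, 0, b} = 0 := fun b => by
      rw [extendZero, dif_neg]
      have := Finset.card_le_two (a := (0 : Fin 6)) (b := b)
      rw [Finset.insert_eq_of_mem (Finset.mem_insert_self 0 {b})]
      omega
    rw [hz, hz]; ring
  · have h0 : (0 : Fin 6) < i := hi
    have hc : ({0, i, j, k} : Finset (Fin 6)).card = 3 + 1 := by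
      rw [Finset.card_insert_of_notMem, ← hs, s.2]
      simp [h0.ne, (h0.trans hij).ne, (h0.trans hik).ne]
    have := h ⟨{0, i, j, k}, hc⟩
    rw [coboundary_tetrahedron Ω h0 hij hjk rfl] at this
    linear_combination this

theorem isCocycle_one : IsCocycle fun _ => 1 := by
  intro t
  obtain ⟨i, j, k, l, hij, hjk, hkl, ht⟩ := exists_sorted₄ t
  have h3 : ∀ {a b c : Fin 6}, a < b → b < c → ({a, b, c} : Finset (Fin 6)).card = 2 + 1 :=
    fun hab hbc => Finset.card_eq_three.2 ⟨_, _, _, hab.ne, (hab.trans hbc).ne, hbc.ne, rfl⟩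
  rw [coboundary_tetrahedron _ hij hjk hkl ht, extendZero_eq _ (h3 hjk hkl),
    extendZero_eq _ (h3 (hij.trans hjk) hkl), extendZero_eq _ (h3 hij (hjk.trans hkl)),
    extendZero_eq _ (h3 hij hjk)]
  ring

/-- The generic 2-cocycles used here are those without zero values. -/
theorem forGenericCocycle_of_forall_ne_zero {P : (Simplex 2 → ℂ) → Prop}
    (h : ∀ N : Simplex 1 → ℂ, (∀ s, coboundary N s ≠ 0) → P (coboundary N)) :
    ForGenericCocycle P := by
  refine ⟨∏ s, MvPolynomial.X s, ⟨fun _ => 1, isCocycle_one, by simp⟩, fun Ω hΩ h0 => ?_⟩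
  obtain ⟨N, rfl⟩ := exists_coboundary_eq_of_isCocycle hΩ
  refine h N fun s => ?_
  simp only [map_prod, MvPolynomial.eval_X] at h0
  exact Finset.prod_ne_zero_iff.1 h0 s (Finset.mem_univ s)

/-! ### Gauge transformations -/

/-- Two factorizations of a quadratic form of rank two differ by rescaling and interchanging the
factors. -/
theorem exists_unit_eq_of_mul_eq {E : Type*} [AddCommGroup E] [Module ℂ E] (F G : E →ₗ[ℂ] ℂ × ℂ)
    (hF : Function.Surjective F) (hG : Function.Surjective G)
    (h : ∀ μ, (F μ).1 * (F μ).2 = (G μ).1 * (G μ).2) :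
    ∃ r : ℂˣ, (∀ μ, G μ = ((r⁻¹ : ℂˣ) * (F μ).1, r * (F μ).2)) ∨
      ∀ μ, G μ = (r * (F μ).2, (r⁻¹ : ℂˣ) * (F μ).1) := by
  have polar : ∀ μ ν, (F μ).1 * (F ν).2 + (F ν).1 * (F μ).2 =
      (G μ).1 * (G ν).2 + (G ν).1 * (G μ).2 := by
    intro μ ν
    have h1 := h (μ + ν)
    simp only [map_add, Prod.fst_add, Prod.snd_add] at h1
    linear_combination h1 - h μ - h ν
  have hker : ∀ ν, F ν = 0 → G ν = 0 := by
    intro ν hν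
    obtain ⟨μ₁, h₁⟩ := hG (1, 0)
    obtain ⟨μ₂, h₂⟩ := hG (0, 1)
    have p₁ := polar ν μ₁
    have p₂ := polar ν μ₂
    rw [hν, h₁] at p₁
    rw [hν, h₂] at p₂
    ext
    · simpa using p₂.symm
    · simpa using p₁.symm
  obtain ⟨e₁, h₁⟩ := hF (1, 0)
  obtain ⟨e₂, h₂⟩ := hF (0, 1)
  have hG' : ∀ μ, G μ = (F μ).1 • G e₁ + (F μ).2 • G e₂ := by
    intro μ
    rw [← sub_eq_zero, ← map_smul, ← map_smul, ← map_add, ← map_sub]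
    apply hker
    rw [map_sub, map_add, map_smul, map_smul, h₁, h₂]
    ext <;> simp
  have q₁ := h e₁
  have q₂ := h e₂
  have q₃ := polar e₁ e₂
  rw [h₁] at q₁ q₃
  rw [h₂] at q₂ q₃
  simp only [mul_zero, mul_one, add_zero] at q₁ q₂ q₃
  by_cases hp : (G e₁).1 = 0
  · rw [hp, zero_mul, zero_add] at q₃
    have hr : (G e₂).1 ≠ 0 := fun h0 => by simp [h0] at q₃
    have hs : (G e₂).2 = 0 := (mul_eq_zero.1 q₂.symm).resolve_left hr
    refine ⟨Units.mk0 _ hr, Or.inr fun μ => ?_⟩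
    rw [hG' μ]
    have : (G e₁).2 = ((G e₂).1)⁻¹ := eq_inv_of_mul_eq_one_right q₃.symm
    ext
    · simp [hp, mul_comm]
    · simp [hs, this, mul_comm]
  · have hq : (G e₁).2 = 0 := (mul_eq_zero.1 q₁.symm).resolve_left hp
    rw [hq, mul_zero, add_zero] at q₃
    have hs : (G e₂).2 ≠ 0 := fun h0 => by simp [h0] at q₃
    have hr : (G e₂).1 = 0 := (mul_eq_zero.1 q₂.symm).resolve_right hs
    refine ⟨Units.mk0 _ hs, Or.inl fun μ => ?_⟩
    rw [hG' μ]
    have : (G e₁).1 = ((G e₂).2)⁻¹ := eq_inv_of_mul_eq_one_left q₃.symm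
    ext
    · simp [hr, this, mul_comm]
    · simp [hq, mul_comm]

theorem EdgeForm.congr {Ω : Simplex 2 → ℂ} {u : Simplex 4} {d e : Simplex 1 → Op} {κ : ℂ}
    (H : EdgeForm Ω u d κ) (h : ∀ a : Simplex 1, a.1 ⊆ u.1 → e a = d a) : EdgeForm Ω u e κ := by
  have hc : ∀ μ, cochainOp u e μ = cochainOp u d μ := fun μ => cochainOp_congr (fun _ _ => rfl) h
  refine ⟨fun a ha t ht => ?_, fun μ c hμ => ?_, fun t ht μ => ?_⟩
  · rw [h a ha]; exact H.support a ha t ht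
  · rw [hc]; exact H.cochainOp_eq_zero μ c hμ
  · rw [hc]; exact H.mul_eq t ht μ

/-- Any edge operators built from `δN` can be brought to any given standard form. -/
theorem BuiltFrom.exists_gauge_eq {N : Simplex 1 → ℂ} (hN : ∀ s, coboundary N s ≠ 0)
    {u : Simplex 4} {V : Submodule ℂ Op} {d : Simplex 1 → Op} (h : BuiltFrom (coboundary N) u V d)
    {F : Simplex 3 → (Simplex 1 → ℂ) →ₗ[ℂ] ℂ × ℂ} (hF : IsFactorization (coboundary N) F) {σ : ℂ}
    (hσ : σ ≠ 0) : ∃ (c : ℂˣ) (lam : Simplex 3 → ℂˣ) (S : Finset (Simplex 3)),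
      BuiltFrom (coboundary N) u (V.map (gaugeMap lam S))
        (fun a => (c : ℂ) • gaugeMap lam S (d a)) ∧
      ∀ a : Simplex 1, a.1 ⊆ u.1 → (c : ℂ) • gaugeMap lam S (d a) = edgeOperators F u σ a := by
  classical
  obtain ⟨κ, hκ, H⟩ := h.exists_edgeForm hN
  obtain ⟨c, hc⟩ := IsAlgClosed.exists_pow_nat_eq (σ / κ) (n := 2) (by norm_num)
  have hc' : c ^ 2 * κ = σ := by rw [hc, div_mul_cancel₀ _ hκ]
  have hc0 : c ≠ 0 := by
    rintro rfl
    exact hσ (by rw [← hc']; ring)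
  have K := hF.edgeForm u σ
  have key : ∀ t : Simplex 3, t.1 ⊆ u.1 → ∃ r : ℂˣ,
      (∀ μ, cochainOp u (edgeOperators F u σ) μ t =
        ((r⁻¹ : ℂˣ) * (c * (cochainOp u d μ t).1), r * (c * (cochainOp u d μ t).2))) ∨
      ∀ μ, cochainOp u (edgeOperators F u σ) μ t =
        (r * (c * (cochainOp u d μ t).2), (r⁻¹ : ℂˣ) * (c * (cochainOp u d μ t).1)) := by
    intro t ht
    have hi : σ * incidence u t ≠ 0 := mul_ne_zero hσ (incidence_ne_zero ht)
    have h1 : ∀ μ, ((c • EdgeForm.component u d t) μ).1 * ((c • EdgeForm.component u d t) μ).2 =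
        σ * incidence u t * coboundary (energy (coboundary N) μ) t := by
      intro μ
      have := H.mul_eq t ht μ
      simp only [LinearMap.smul_apply, EdgeForm.component_apply, Prod.smul_fst, Prod.smul_snd,
        smul_eq_mul]
      rw [← hc']
      linear_combination c ^ 2 * this
    have h2 := K.mul_eq t ht
    exact exists_unit_eq_of_mul_eq (c • EdgeForm.component u d t)
      (EdgeForm.component u (edgeOperators F u σ) t) (surjective_of_mul_eq hN _ hi h1)
      (surjective_of_mul_eq hN _ hi h2) fun μ => (h1 μ).trans (h2 μ).symm
  choose r hr using key
  let S : Finset (Simplex 3) := Finset.univ.filter fun t => ∃ ht : t.1 ⊆ u.1,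
    ∀ μ, cochainOp u (edgeOperators F u σ) μ t =
      (r t ht * (c * (cochainOp u d μ t).2), ((r t ht)⁻¹ : ℂˣ) * (c * (cochainOp u d μ t).1))
  let lam : Simplex 3 → ℂˣ := fun t => if ht : t.1 ⊆ u.1 then r t ht else 1
  have heq : ∀ a : Simplex 1, a.1 ⊆ u.1 →
      (Units.mk0 c hc0 : ℂ) • gaugeMap lam S (d a) = edgeOperators F u σ a := by
    intro a ha
    funext t
    rw [Units.val_mk0, Pi.smul_apply, ← cochainOp_single (edgeOperators F u σ) ha,
      ← cochainOp_single d ha]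
    have hg : gaugeMap lam S (cochainOp u d (Pi.single a 1)) t = if t ∈ S then
        ((lam t : ℂ) * (cochainOp u d (Pi.single a 1) t).2,
          ((lam t)⁻¹ : ℂˣ) * (cochainOp u d (Pi.single a 1) t).1)
      else (((lam t)⁻¹ : ℂˣ) * (cochainOp u d (Pi.single a 1) t).1,
        (lam t : ℂ) * (cochainOp u d (Pi.single a 1) t).2) := rfl
    rw [hg]
    by_cases ht : t.1 ⊆ u.1
    · have hlam : lam t = r t ht := dif_pos ht
      rw [hlam]
      split_ifs with hS
      · obtain ⟨_, hS⟩ := (Finset.mem_filter.1 hS).2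
        rw [hS]
        ext <;> simp only [Prod.smul_fst, Prod.smul_snd, smul_eq_mul] <;> ring
      · rw [(hr t ht).resolve_right fun hS' =>
          hS (Finset.mem_filter.2 ⟨Finset.mem_univ _, ht, hS'⟩)]
        ext <;> simp only [Prod.smul_fst, Prod.smul_snd, smul_eq_mul] <;> ring
    · rw [K.cochainOp_mem_opSpace _ t ht, H.cochainOp_mem_opSpace _ t ht]
      simp
  refine ⟨Units.mk0 c hc0, lam, S, ?_, heq⟩
  have hcomp : cochainHom u (fun a => (Units.mk0 c hc0 : ℂ) • gaugeMap lam S (d a)) =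
      c • (gaugeMap lam S ∘ₗ cochainHom u d) := by
    refine LinearMap.ext fun μ => ?_
    simp [cochainHom_apply, cochainOp, Finset.smul_sum, smul_smul, mul_comm]
  have hV : V.map (gaugeMap lam S) = LinearMap.range
      (cochainHom u (fun a => (Units.mk0 c hc0 : ℂ) • gaugeMap lam S (d a))) := by
    rw [hcomp, LinearMap.range_smul _ _ hc0, LinearMap.range_comp, range_cochainHom,
      h.edgeSystem.span_eq]
  rw [hV]
  exact (K.congr heq).builtFrom hN hσ

/-! ### Signs of the 4-simplices -/

/-- The 4-simplex opposite to the vertex `m`. -/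
def oppositeSimplex (m : Fin 6) : Simplex 4 := ⟨Finset.univ.erase m, by simp⟩

theorem exists_eq_oppositeSimplex (u : Simplex 4) : ∃ m, u = oppositeSimplex m := by
  obtain ⟨m, hm⟩ := Finset.card_eq_one.1 (show u.1ᶜ.card = 1 by
    rw [Finset.card_compl, u.2, Fintype.card_fin])
  refine ⟨m, Subtype.ext ?_⟩
  rw [← compl_compl u.1, hm]
  ext; simp [oppositeSimplex]

theorem oppositeSimplex_mem_lhsSimplices (m : Fin 6) :
    oppositeSimplex m ∈ lhsSimplices ↔ 3 ≤ m := by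
  revert m; decide

theorem oppositeSimplex_mem_rhsSimplices (m : Fin 6) :
    oppositeSimplex m ∈ rhsSimplices ↔ m < 3 := by
  revert m; decide

/-- The sign of a 4-simplex: its orientation in the boundary of the 5-simplex, reversed on the
right-hand side of the move. -/
noncomputable def moveSign (u : Simplex 4) : ℂ :=
  (if u ∈ lhsSimplices then 1 else -1) * ∏ m ∈ u.1ᶜ, (-1) ^ (m : ℕ)

theorem moveSign_oppositeSimplex (m : Fin 6) :
    moveSign (oppositeSimplex m) = (if 3 ≤ m then 1 else -1) * (-1) ^ (m : ℕ) := by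
  have : (oppositeSimplex m).1ᶜ = {m} := by ext; simp [oppositeSimplex]
  rw [moveSign, this, Finset.prod_singleton]
  simp only [oppositeSimplex_mem_lhsSimplices]

theorem moveSign_ne_zero (u : Simplex 4) : moveSign u ≠ 0 := by
  obtain ⟨m, rfl⟩ := exists_eq_oppositeSimplex u
  rw [moveSign_oppositeSimplex]
  refine mul_ne_zero ?_ (pow_ne_zero _ (by norm_num))
  split_ifs <;> norm_num

/-- Two adjacent 4-simplices induce opposite orientations on their common tetrahedron. -/
theorem incidence_oppositeSimplex {m n : Fin 6} (hmn : m ≠ n) {t : Simplex 3}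
    (h₁ : t.1 ⊆ (oppositeSimplex m).1) (h₂ : t.1 ⊆ (oppositeSimplex n).1) :
    (-1) ^ (m : ℕ) * incidence (oppositeSimplex m) t =
      -((-1) ^ (n : ℕ) * incidence (oppositeSimplex n) t) := by
  have hm : m ∈ (oppositeSimplex n).1 := by simp [oppositeSimplex, hmn]
  have hn : n ∈ (oppositeSimplex m).1 := by simp [oppositeSimplex, hmn.symm]
  have e : ∀ {m n : Fin 6} (hn : n ∈ (oppositeSimplex m).1), m ≠ n →
      t.1 ⊆ (oppositeSimplex m).1 → t.1 ⊆ (oppositeSimplex n).1 →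
      t = facet (oppositeSimplex m) n hn := by
    intro m n hn hmn h₁ h₂
    refine Subtype.ext (Finset.eq_of_subset_of_card_le ?_ ?_)
    · exact Finset.subset_erase.2 ⟨h₁, fun h => by simpa [oppositeSimplex] using h₂ h⟩
    · rw [(facet (oppositeSimplex m) n hn).2, t.2]
  have e₁ : incidence (oppositeSimplex m) t = facetSign (oppositeSimplex m).1 n := by
    rw [e hn hmn h₁ h₂, incidence_facet]
  have e₂ : incidence (oppositeSimplex n) t = facetSign (oppositeSimplex n).1 m := by
    rw [e hm hmn.symm h₂ h₁, incidence_facet]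
  have key : ∀ m n : Fin 6, m ≠ n → (-1 : ℤ) ^ (m : ℕ) *
        (-1) ^ ((Finset.univ.erase m).filter (fun w => w < n)).card =
      -((-1) ^ (n : ℕ) * (-1) ^ ((Finset.univ.erase n).filter (fun w => w < m)).card) := by
    decide
  rw [e₁, e₂, facetSign, facetSign]
  exact_mod_cast key m n hmn

theorem agreeInner_edgeOperators (F : Simplex 3 → (Simplex 1 → ℂ) →ₗ[ℂ] ℂ × ℂ) :
    AgreeInner fun u => edgeOperators F u (moveSign u) := by
  intro u₁ u₂ hne hside t h₁ h₂ a _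
  obtain ⟨m, rfl⟩ := exists_eq_oppositeSimplex u₁
  obtain ⟨n, rfl⟩ := exists_eq_oppositeSimplex u₂
  have hinc := incidence_oppositeSimplex (fun h => hne (congrArg oppositeSimplex h)) h₁ h₂
  have hs : moveSign (oppositeSimplex n) * incidence (oppositeSimplex n) t =
      -(moveSign (oppositeSimplex m) * incidence (oppositeSimplex m) t) := by
    simp only [oppositeSimplex_mem_lhsSimplices, oppositeSimplex_mem_rhsSimplices] at hside
    rw [moveSign_oppositeSimplex, moveSign_oppositeSimplex]
    rcases hside with ⟨hm, hn⟩ | ⟨hm, hn⟩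
    · rw [if_pos hm, if_pos hn]; linear_combination hinc
    · rw [if_neg hm.not_ge, if_neg hn.not_ge]; linear_combination -hinc
  simp only [edgeOperators, h₁, h₂, if_true, hs]
  ext
  · rfl
  · simp

theorem agreeBoundary_edgeOperators (F : Simplex 3 → (Simplex 1 → ℂ) →ₗ[ℂ] ℂ × ℂ) :
    AgreeBoundary fun u => edgeOperators F u (moveSign u) := by
  intro u₁ hl u₂ hr t h₁ h₂ a _
  obtain ⟨m, rfl⟩ := exists_eq_oppositeSimplex u₁
  obtain ⟨n, rfl⟩ := exists_eq_oppositeSimplex u₂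
  rw [oppositeSimplex_mem_lhsSimplices] at hl
  rw [oppositeSimplex_mem_rhsSimplices] at hr
  have hinc := incidence_oppositeSimplex (hr.trans_le hl).ne' h₁ h₂
  have hs : moveSign (oppositeSimplex n) * incidence (oppositeSimplex n) t =
      moveSign (oppositeSimplex m) * incidence (oppositeSimplex m) t := by
    rw [moveSign_oppositeSimplex, moveSign_oppositeSimplex, if_pos hl, if_neg hr.not_ge]
    linear_combination -hinc
  simp only [edgeOperators, h₁, h₂, if_true, hs]

/-- Edge operators built from `δN` can be made consistent. -/
theorem exists_consistent {N : Simplex 1 → ℂ} (hN : ∀ s, coboundary N s ≠ 0)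
    {V : Simplex 4 → Submodule ℂ Op} {d : Simplex 4 → Simplex 1 → Op}
    (h : ∀ u, BuiltFrom (coboundary N) u (V u) (d u)) :
    ∃ (c : Simplex 4 → ℂˣ) (lam : Simplex 4 → Simplex 3 → ℂˣ)
      (S : Simplex 4 → Finset (Simplex 3)),
      (∀ u, BuiltFrom (coboundary N) u ((V u).map (gaugeMap (lam u) (S u)))
        fun a => (c u : ℂ) • gaugeMap (lam u) (S u) (d u a)) ∧
      AgreeInner (fun u a => (c u : ℂ) • gaugeMap (lam u) (S u) (d u a)) ∧
      AgreeBoundary (fun u a => (c u : ℂ) • gaugeMap (lam u) (S u) (d u a)) := by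
  obtain ⟨F, hF⟩ := exists_isFactorization hN (coboundary_coboundary N)
  choose c lam S hb heq using fun u => (h u).exists_gauge_eq hN hF (moveSign_ne_zero u)
  refine ⟨c, lam, S, hb, fun u₁ u₂ hne hside t h₁ h₂ a ha => ?_, fun u₁ hl u₂ hr t h₁ h₂ a ha => ?_⟩
  · simp only [heq u₁ a (ha.trans h₁), heq u₂ a (ha.trans h₂)]
    exact agreeInner_edgeOperators F u₁ u₂ hne hside t h₁ h₂ a ha
  · simp only [heq u₁ a (ha.trans h₁), heq u₂ a (ha.trans h₂)]
    exact agreeBoundary_edgeOperators F u₁ hl u₂ hr t h₁ h₂ a ha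

/-! ### Three 4-simplices around a triangle -/

/-- The 4-simplices `u₁`, `u₂`, `u₃` are those around a triangle `s`, and the tetrahedra `t₁`, `t₂`,
`t₃` separate them. -/
structure IsStar (s : Simplex 2) (u₁ u₂ u₃ : Simplex 4) (t₁ t₂ t₃ : Simplex 3) : Prop where
  inter₁₂ : u₁.1 ∩ u₂.1 = t₁.1
  inter₁₃ : u₁.1 ∩ u₃.1 = t₂.1
  inter₂₃ : u₂.1 ∩ u₃.1 = t₃.1
  ne₁₂ : t₁ ≠ t₂
  ne₁₃ : t₁ ≠ t₃
  ne₂₃ : t₂ ≠ t₃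
  subset₁ : s.1 ⊆ t₁.1
  subset₂ : s.1 ⊆ t₂.1
  subset₃ : s.1 ⊆ t₃.1

theorem eq_of_subset_inter {k l : ℕ} {u₁ u₂ : Simplex k} {t t' : Simplex l} (h : u₁.1 ∩ u₂.1 = t'.1)
    (h₁ : t.1 ⊆ u₁.1) (h₂ : t.1 ⊆ u₂.1) : t = t' :=
  Subtype.ext (Finset.eq_of_subset_of_card_le (h ▸ Finset.subset_inter h₁ h₂) (by rw [t.2, t'.2]))

/-- Derivatives killing `F` may be altered in an operator applied to `F`. -/
theorem act_congr {I : Set (Simplex 3)} {e e' : Op} {F : Grassmann}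
    (hF : ∀ t ∈ I, leftDeriv t F = 0) (h : ∀ t ∉ I, e t = e' t) (h₁ : ∀ t ∈ I, (e t).2 = 0)
    (h₂ : ∀ t ∈ I, (e' t).2 = 0) : act e F = act e' F := by
  rw [act_apply, act_apply]
  refine Finset.sum_congr rfl fun t _ => ?_
  by_cases ht : t ∈ I
  · rw [hF t ht, h₁ t ht, h₂ t ht]; simp
  · rw [h t ht]

theorem leftDeriv_leftDeriv (t : Simplex 3) (F : Grassmann) :
    leftDeriv t (leftDeriv t F) = 0 := by
  have h := act_act (derivOp t) (derivOp t) F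
  rw [scalarProd_derivOp, act_derivOp, act_derivOp] at h
  have h0 : ((derivOp t) t).2 = 0 := by simp [derivOp]
  rw [h0, zero_smul, ← two_smul ℂ] at h
  exact (smul_eq_zero.1 h).resolve_left two_ne_zero

theorem leftDeriv_berezin_self (t : Simplex 3) (F : Grassmann) :
    leftDeriv t (berezin t F) = 0 := by
  rw [berezin_eq_parity_leftDeriv, ← neg_eq_zero, ← parity_leftDeriv, leftDeriv_leftDeriv, map_zero]

theorem leftDeriv_berezin_of_eq_zero (s t : Simplex 3) {F : Grassmann} (h : leftDeriv t F = 0) :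
    leftDeriv t (berezin s F) = 0 := by
  have hd : ((derivOp t) s).2 = 0 := by
    by_cases hst : s = t
    · subst hst; simp [derivOp]
    · simp [derivOp, hst]
  rw [← act_derivOp, ← berezin_act s _ hd, act_derivOp, h, map_zero]

namespace IsStar

variable {s : Simplex 2} {u₁ u₂ u₃ : Simplex 4} {t₁ t₂ t₃ : Simplex 3}

theorem subsets (h : IsStar s u₁ u₂ u₃ t₁ t₂ t₃) :
    (t₁.1 ⊆ u₁.1 ∧ t₁.1 ⊆ u₂.1 ∧ ¬ t₁.1 ⊆ u₃.1) ∧ (t₂.1 ⊆ u₁.1 ∧ ¬ t₂.1 ⊆ u₂.1 ∧ t₂.1 ⊆ u₃.1) ∧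
      (¬ t₃.1 ⊆ u₁.1 ∧ t₃.1 ⊆ u₂.1 ∧ t₃.1 ⊆ u₃.1) := by
  have a₁ : t₁.1 ⊆ u₁.1 := h.inter₁₂ ▸ Finset.inter_subset_left
  have a₂ : t₁.1 ⊆ u₂.1 := h.inter₁₂ ▸ Finset.inter_subset_right
  have b₁ : t₂.1 ⊆ u₁.1 := h.inter₁₃ ▸ Finset.inter_subset_left
  have b₃ : t₂.1 ⊆ u₃.1 := h.inter₁₃ ▸ Finset.inter_subset_right
  have c₂ : t₃.1 ⊆ u₂.1 := h.inter₂₃ ▸ Finset.inter_subset_left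
  have c₃ : t₃.1 ⊆ u₃.1 := h.inter₂₃ ▸ Finset.inter_subset_right
  exact ⟨⟨a₁, a₂, fun h' => h.ne₁₂ (eq_of_subset_inter h.inter₁₃ a₁ h')⟩,
    ⟨b₁, fun h' => h.ne₁₂ (eq_of_subset_inter h.inter₁₂ b₁ h').symm, b₃⟩,
    ⟨fun h' => h.ne₁₃ (eq_of_subset_inter h.inter₁₂ h' c₂).symm, c₂, c₃⟩⟩

/-- Operators from the three spaces whose components at the inner tetrahedra match combine to an
operator annihilating the integral: after the integration, the `x`-parts at the inner tetrahedra
cancel. -/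
theorem act_berezin_eq_zero (h : IsStar s u₁ u₂ u₃ t₁ t₂ t₃) {V₁ V₂ V₃ : Submodule ℂ Op}
    (hV₁ : V₁ ≤ opSpace u₁) (hV₂ : V₂ ≤ opSpace u₂) (hV₃ : V₃ ≤ opSpace u₃)
    {W₁ W₂ W₃ : Grassmann} (hW₁ : IsWeight u₁ V₁ W₁) (hW₂ : IsWeight u₂ V₂ W₂)
    (hW₃ : IsWeight u₃ V₃ W₃) {D₁ D₂ D₃ : Op} (hD₁ : D₁ ∈ V₁) (hD₂ : D₂ ∈ V₂) (hD₃ : D₃ ∈ V₃)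
    (h₁₂ : D₂ t₁ = ((D₁ t₁).1, -(D₁ t₁).2)) (h₁₃ : D₃ t₂ = ((D₁ t₂).1, -(D₁ t₂).2))
    (h₂₃ : D₃ t₃ = ((D₂ t₃).1, -(D₂ t₃).2)) {e : Op}
    (he : ∀ t ∉ ({t₁, t₂, t₃} : Set (Simplex 3)), (t.1 ⊆ u₁.1 → e t = D₁ t) ∧
      (t.1 ⊆ u₂.1 → e t = D₂ t) ∧ (t.1 ⊆ u₃.1 → e t = D₃ t))
    (heI : ∀ t ∈ ({t₁, t₂, t₃} : Set (Simplex 3)), (e t).2 = 0)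
    (he0 : ∀ t : Simplex 3, ¬ t.1 ⊆ u₁.1 → ¬ t.1 ⊆ u₂.1 → ¬ t.1 ⊆ u₃.1 → (e t).2 = 0) :
    act e (berezin t₃ (berezin t₂ (berezin t₁ (W₁ * W₂ * W₃)))) = 0 := by
  obtain ⟨⟨a₁, a₂, a₃⟩, ⟨b₁, b₂, b₃⟩, c₁, c₂, c₃⟩ := h.subsets
  -- the common derivative part of the three operators
  let b : Simplex 3 → ℂ := fun t => if t.1 ⊆ u₁.1 then (D₁ t).1 else if t.1 ⊆ u₂.1 then (D₂ t).1
    else if t.1 ⊆ u₃.1 then (D₃ t).1 else (e t).1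
  let ext : Simplex 4 → Op → Op := fun u D t => if t.1 ⊆ u.1 then D t else (b t, 0)
  have ext_pos : ∀ (u : Simplex 4) (D : Op) {t : Simplex 3}, t.1 ⊆ u.1 → ext u D t = D t :=
    fun _ _ _ ht => if_pos ht
  have ext_neg : ∀ (u : Simplex 4) (D : Op) {t : Simplex 3}, ¬ t.1 ⊆ u.1 → ext u D t = (b t, 0) :=
    fun _ _ _ ht => if_neg ht
  have ext_fst : ∀ (u : Simplex 4) (D : Op), (∀ t : Simplex 3, t.1 ⊆ u.1 → b t = (D t).1) →
      ∀ t, (ext u D t).1 = b t := by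
    intro u D hb t
    by_cases ht : t.1 ⊆ u.1
    · rw [ext_pos u D ht, hb t ht]
    · rw [ext_neg u D ht]
  have hb₁ : ∀ t : Simplex 3, t.1 ⊆ u₁.1 → b t = (D₁ t).1 := fun t ht => if_pos ht
  have hb₂ : ∀ t : Simplex 3, t.1 ⊆ u₂.1 → b t = (D₂ t).1 := by
    intro t ht
    by_cases ht₁ : t.1 ⊆ u₁.1
    · rw [hb₁ t ht₁, eq_of_subset_inter h.inter₁₂ ht₁ ht, h₁₂]
    · simp only [b, ht₁, ht, if_true, if_false]
  have hb₃ : ∀ t : Simplex 3, t.1 ⊆ u₃.1 → b t = (D₃ t).1 := by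
    intro t ht
    by_cases ht₁ : t.1 ⊆ u₁.1
    · rw [hb₁ t ht₁, eq_of_subset_inter h.inter₁₃ ht₁ ht, h₁₃]
    · by_cases ht₂ : t.1 ⊆ u₂.1
      · rw [hb₂ t ht₂, eq_of_subset_inter h.inter₂₃ ht₂ ht, h₂₃]
      · simp only [b, ht₁, ht₂, ht, if_true, if_false]
  have hext : ∀ {u : Simplex 4} {V : Submodule ℂ Op} {D : Op}, V ≤ opSpace u → D ∈ V →
      ext u D ∈ extendedSpace u V := fun {u V D} hV hD =>
    ⟨⟨D, hD, hV hD, fun t ht => ext_pos u D ht⟩, fun t ht => by rw [ext_neg u D ht]⟩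
  have hsum : ∀ t ∈ ({t₁, t₂, t₃} : Set (Simplex 3)),
      (ext u₁ D₁ t).2 + (ext u₂ D₂ t).2 + (ext u₃ D₃ t).2 = 0 := by
    rintro t (rfl | rfl | rfl)
    · rw [ext_pos _ _ a₁, ext_pos _ _ a₂, ext_neg _ _ a₃, h₁₂]; simp
    · rw [ext_pos _ _ b₁, ext_neg _ _ b₂, ext_pos _ _ b₃, h₁₃]; simp
    · rw [ext_neg _ _ c₁, ext_pos _ _ c₂, ext_pos _ _ c₃, h₂₃]; simp
  have hy : (ext u₁ D₁, ext u₂ D₂, ext u₃ D₃) ∈ descentSpace {t₁, t₂, t₃} :=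
    ⟨fun t => (ext_fst u₁ D₁ hb₁ t).trans (ext_fst u₃ D₃ hb₃ t).symm,
      fun t => (ext_fst u₂ D₂ hb₂ t).trans (ext_fst u₃ D₃ hb₃ t).symm, hsum⟩
  have z₁ := hW₁.act_eq_zero_of_mem (hext hV₁ hD₁)
  have z₂ := hW₂.act_eq_zero_of_mem (hext hV₂ hD₂)
  have z₃ := hW₃.act_eq_zero_of_mem (hext hV₃ hD₃)
  have key := tripleIntegral_tripleRep_of_mem hy
    (TensorProduct.tmul ℂ W₁ (TensorProduct.tmul ℂ W₂ W₃))
  rw [tripleRep_tmul] at key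
  simp only [z₁, z₂, z₃, TensorProduct.zero_tmul, TensorProduct.tmul_zero, add_zero, map_zero,
    tripleIntegral_tmul] at key
  refine (act_congr (I := {t₁, t₂, t₃}) ?_ ?_ heI hsum).trans key.symm
  · rintro t (rfl | rfl | rfl)
    · exact leftDeriv_berezin_of_eq_zero _ _ (leftDeriv_berezin_of_eq_zero _ _
        (leftDeriv_berezin_self _ _))
    · exact leftDeriv_berezin_of_eq_zero _ _ (leftDeriv_berezin_self _ _)
    · exact leftDeriv_berezin_self _ _
  · intro t ht
    have n₁₂ : t.1 ⊆ u₁.1 → ¬ t.1 ⊆ u₂.1 := fun h₁ h₂ =>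
      ht (by simp [eq_of_subset_inter h.inter₁₂ h₁ h₂])
    have n₁₃ : t.1 ⊆ u₁.1 → ¬ t.1 ⊆ u₃.1 := fun h₁ h₂ =>
      ht (by simp [eq_of_subset_inter h.inter₁₃ h₁ h₂])
    have n₂₃ : t.1 ⊆ u₂.1 → ¬ t.1 ⊆ u₃.1 := fun h₁ h₂ =>
      ht (by simp [eq_of_subset_inter h.inter₂₃ h₁ h₂])
    obtain ⟨e₁, e₂, e₃⟩ := he t ht
    by_cases k₁ : t.1 ⊆ u₁.1
    · simp only [ext_pos u₁ D₁ k₁, ext_neg u₂ D₂ (n₁₂ k₁), ext_neg u₃ D₃ (n₁₃ k₁), e₁ k₁, hb₁ t k₁]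
      simp
    · by_cases k₂ : t.1 ⊆ u₂.1
      · simp only [ext_neg u₁ D₁ k₁, ext_pos u₂ D₂ k₂, ext_neg u₃ D₃ (n₂₃ k₂), e₂ k₂, hb₂ t k₂]
        simp
      · by_cases k₃ : t.1 ⊆ u₃.1
        · simp only [ext_neg u₁ D₁ k₁, ext_neg u₂ D₂ k₂, ext_pos u₃ D₃ k₃, e₃ k₃]
          simp
        · simp only [ext_neg u₁ D₁ k₁, ext_neg u₂ D₂ k₂, ext_neg u₃ D₃ k₃]
          have : b t = (e t).1 := by simp only [b, k₁, k₂, k₃, if_false]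
          ext
          · exact this.symm
          · simpa using he0 t k₁ k₂ k₃

variable {N : Simplex 1 → ℂ} {d₁ d₂ d₃ : Simplex 1 → Op} {κ₁ κ₂ κ₃ : ℂ}

/-- It suffices that the operator of `μ` vanishes at the outer tetrahedra of `u`: the three facets of
`u` opposite to the vertices of the central triangle are outer. -/
theorem exists_coboundary_eq (h : IsStar s u₁ u₂ u₃ t₁ t₂ t₃) (hN : ∀ s, coboundary N s ≠ 0)
    {u : Simplex 4} {d : Simplex 1 → Op} {κ : ℂ} (hκ : κ ≠ 0) (H : EdgeForm (coboundary N) u d κ)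
    (hu : s.1 ⊆ u.1) {μ : Simplex 1 → ℂ}
    (hμ : ∀ t ∉ ({t₁, t₂, t₃} : Set (Simplex 3)), t.1 ⊆ u.1 → cochainOp u d μ t = 0) :
    ∃ c : ℂ, ∀ r : Simplex 2, r.1 ⊆ u.1 → coboundary μ r = c * coboundary N r := by
  obtain ⟨p, q, r, hpq, hqr, hs⟩ := exists_sorted₃ s
  have hp : p ∈ s.1 := by simp [hs]
  have hq : q ∈ s.1 := by simp [hs]
  have hr : r ∈ s.1 := by simp [hs]
  have key : ∀ v (hv : v ∈ s.1), cochainOp u d μ (facet u v (hu hv)) = 0 := by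
    intro v hv
    refine hμ _ ?_ (facet_subset _ _ _)
    have hv' : v ∉ (facet u v (hu hv)).1 := Finset.notMem_erase _ _
    rintro (h' | h' | h')
    · exact hv' (h' ▸ h.subset₁ hv)
    · exact hv' (h' ▸ h.subset₂ hv)
    · exact hv' ((show facet u v (hu hv) = t₃ from h') ▸ h.subset₃ hv)
  exact H.exists_coboundary_eq_of_three hN hκ (hu hp) (hu hq) (hu hr) hpq.ne (hpq.trans hqr).ne
    hqr.ne (key p hp) (key q hq) (key r hr)

theorem subset (h : IsStar s u₁ u₂ u₃ t₁ t₂ t₃) : s.1 ⊆ u₁.1 ∧ s.1 ⊆ u₂.1 ∧ s.1 ⊆ u₃.1 :=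
  ⟨h.subset₁.trans h.subsets.1.1, h.subset₁.trans h.subsets.1.2.1,
    h.subset₂.trans h.subsets.2.1.2.2⟩

/-- The integral of the product of the three weights is nonzero. -/
theorem berezin_ne_zero (h : IsStar s u₁ u₂ u₃ t₁ t₂ t₃) (hN : ∀ s, coboundary N s ≠ 0)
    (hκ₁ : κ₁ ≠ 0) (hκ₂ : κ₂ ≠ 0) (hκ₃ : κ₃ ≠ 0) (H₁ : EdgeForm (coboundary N) u₁ d₁ κ₁)
    (H₂ : EdgeForm (coboundary N) u₂ d₂ κ₂) (H₃ : EdgeForm (coboundary N) u₃ d₃ κ₃)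
    {W₁ W₂ W₃ : Grassmann} (hW₁ : IsWeight u₁ (LinearMap.range (cochainHom u₁ d₁)) W₁)
    (hW₂ : IsWeight u₂ (LinearMap.range (cochainHom u₂ d₂)) W₂)
    (hW₃ : IsWeight u₃ (LinearMap.range (cochainHom u₃ d₃)) W₃) :
    berezin t₃ (berezin t₂ (berezin t₁ (W₁ * W₂ * W₃))) ≠ 0 := by
  have hle : ∀ {u : Simplex 4} {d : Simplex 1 → Op} {κ : ℂ}, EdgeForm (coboundary N) u d κ →
      LinearMap.range (cochainHom u d) ≤ opSpace u := by
    rintro u d κ H _ ⟨μ, rfl⟩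
    exact H.cochainOp_mem_opSpace μ
  have hz : ∀ {u : Simplex 4} {d : Simplex 1 → Op} {κ : ℂ}, κ ≠ 0 →
      EdgeForm (coboundary N) u d κ → s.1 ⊆ u.1 → ∀ e ∈ LinearMap.range (cochainHom u d),
      (∀ t ∉ ({t₁, t₂, t₃} : Set (Simplex 3)), e t = 0) → e = 0 := by
    rintro u d κ hκ H hu _ ⟨μ, rfl⟩ hμ
    obtain ⟨c, hc⟩ := h.exists_coboundary_eq hN hκ H hu fun t ht _ => hμ t ht
    exact H.cochainOp_eq_zero μ c hc
  obtain ⟨s₁, s₂, s₃⟩ := h.subset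
  refine berezin_mul_mul_ne_zero h.ne₁₂ h.ne₁₃ h.ne₂₃ ?_ hW₁ hW₂ hW₃
  refine extendedSpace_prod_sup_descentSpace (hle H₁) (hle H₂) (hle H₃)
    (fun e he => H₁.mem_of_orthogonal hN hκ₁ he) (fun e he => H₂.mem_of_orthogonal hN hκ₂ he)
    (fun e he => H₃.mem_of_orthogonal hN hκ₃ he) (hz hκ₁ H₁ s₁) (hz hκ₂ H₂ s₂) (hz hκ₃ H₃ s₃)
    (fun t k₁ k₂ => ?_) (fun t k₁ k₂ => ?_) (fun t k₁ k₂ => ?_) ?_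
  · simp [eq_of_subset_inter h.inter₁₂ k₁ k₂]
  · simp [eq_of_subset_inter h.inter₁₃ k₁ k₂]
  · simp [eq_of_subset_inter h.inter₂₃ k₁ k₂]
  · rintro t (rfl | rfl | rfl)
    · exact Or.inl h.subsets.1.1
    · exact Or.inl h.subsets.2.1.1
    · exact Or.inr (Or.inl h.subsets.2.2.2.1)

/-- A cochain whose operators vanish at all outer tetrahedra has coboundary proportional to `δN`. -/
theorem exists_coboundary_eq_of_outer (h : IsStar s u₁ u₂ u₃ t₁ t₂ t₃)
    (hN : ∀ s, coboundary N s ≠ 0)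
    (hκ₁ : κ₁ ≠ 0) (hκ₂ : κ₂ ≠ 0) (hκ₃ : κ₃ ≠ 0) (H₁ : EdgeForm (coboundary N) u₁ d₁ κ₁)
    (H₂ : EdgeForm (coboundary N) u₂ d₂ κ₂) (H₃ : EdgeForm (coboundary N) u₃ d₃ κ₃)
    {μ : Simplex 1 → ℂ}
    (hμ : ∀ t ∉ ({t₁, t₂, t₃} : Set (Simplex 3)), (t.1 ⊆ u₁.1 → cochainOp u₁ d₁ μ t = 0) ∧
      (t.1 ⊆ u₂.1 → cochainOp u₂ d₂ μ t = 0) ∧ (t.1 ⊆ u₃.1 → cochainOp u₃ d₃ μ t = 0)) :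
    ∃ c : ℂ, (∀ r : Simplex 2, r.1 ⊆ u₁.1 → coboundary μ r = c * coboundary N r) ∧
      (∀ r : Simplex 2, r.1 ⊆ u₂.1 → coboundary μ r = c * coboundary N r) ∧
      ∀ r : Simplex 2, r.1 ⊆ u₃.1 → coboundary μ r = c * coboundary N r := by
  obtain ⟨s₁, s₂, s₃⟩ := h.subset
  obtain ⟨c₁, e₁⟩ := h.exists_coboundary_eq hN hκ₁ H₁ s₁ fun t ht => (hμ t ht).1
  obtain ⟨c₂, e₂⟩ := h.exists_coboundary_eq hN hκ₂ H₂ s₂ fun t ht => (hμ t ht).2.1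
  obtain ⟨c₃, e₃⟩ := h.exists_coboundary_eq hN hκ₃ H₃ s₃ fun t ht => (hμ t ht).2.2
  obtain rfl := mul_right_cancel₀ (hN s) ((e₁ s s₁).symm.trans (e₂ s s₂))
  obtain rfl := mul_right_cancel₀ (hN s) ((e₁ s s₁).symm.trans (e₃ s s₃))
  exact ⟨c₁, e₁, e₂, e₃⟩

end IsStar

theorem isStar_lhs : IsStar ⟨{0, 1, 2}, rfl⟩ s01234 s01235 s01245 t0123 t0124 t0125 := by
  constructor <;> decide

theorem isStar_rhs : IsStar ⟨{3, 4, 5}, rfl⟩ s01345 s02345 s12345 t0345 t1345 t2345 := by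
  constructor <;> decide

/-! ### The 3–3 relation -/

/-- The six tetrahedra over which one of the sides of the move is integrated. The other nine
tetrahedra form the common boundary of both sides. -/
def innerTetrahedra : Finset (Simplex 3) := {t0123, t0124, t0125, t0345, t1345, t2345}

theorem exists_subset_of_notMem_innerTetrahedra : ∀ t ∉ innerTetrahedra,
    (∃ u ∈ lhsSimplices, t.1 ⊆ u.1) ∧ ∃ u ∈ rhsSimplices, t.1 ⊆ u.1 := by
  decide

theorem mem_innerTetrahedra_of_subset : ∀ u ∈ lhsSimplices, ∀ u' ∈ lhsSimplices, u' ≠ u →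
    ∀ t : Simplex 3, t.1 ⊆ u.1 → t.1 ⊆ u'.1 → t ∈ innerTetrahedra := by
  decide

theorem mem_innerTetrahedra_of_subset_lhs : ∀ u ∈ lhsSimplices, ∀ t ∈ innerTetrahedra,
    t.1 ⊆ u.1 → t = t0123 ∨ t = t0124 ∨ t = t0125 := by
  decide

theorem mem_innerTetrahedra_of_subset_rhs : ∀ u ∈ rhsSimplices, ∀ t ∈ innerTetrahedra,
    t.1 ⊆ u.1 → t = t0345 ∨ t = t1345 ∨ t = t2345 := by
  decide

theorem exists_lhsSimplices_insert_zero_subset (a : Simplex 1) :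
    ∃ u ∈ lhsSimplices, insert 0 a.1 ⊆ u.1 := by
  revert a; decide

section

variable {N : Simplex 1 → ℂ} {d : Simplex 4 → Simplex 1 → Op} {κ : Simplex 4 → ℂ}

theorem AgreeInner.cochainOp_eq (hd : AgreeInner d)
    (H : ∀ u, EdgeForm (coboundary N) u (d u) (κ u)) {u₁ u₂ : Simplex 4} (hne : u₁ ≠ u₂)
    (hside : u₁ ∈ lhsSimplices ∧ u₂ ∈ lhsSimplices ∨ u₁ ∈ rhsSimplices ∧ u₂ ∈ rhsSimplices)
    {t : Simplex 3} (h₁ : t.1 ⊆ u₁.1) (h₂ : t.1 ⊆ u₂.1) (μ : Simplex 1 → ℂ) :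
    cochainOp u₂ (d u₂) μ t =
      ((cochainOp u₁ (d u₁) μ t).1, -(cochainOp u₁ (d u₁) μ t).2) := by
  have e : ∀ a ∈ Finset.univ.filter (fun a : Simplex 1 => a.1 ⊆ t.1), μ a • d u₂ a t =
      ((μ a • d u₁ a t).1, -(μ a • d u₁ a t).2) := fun a ha => by
    rw [hd u₁ u₂ hne hside t h₁ h₂ a (Finset.mem_filter.1 ha).2]
    ext <;> simp
  rw [cochainOp_apply_eq_sum (H u₁).support h₁, cochainOp_apply_eq_sum (H u₂).support h₂, Finset.sum_congr rfl e]
  ext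
  · rw [Prod.fst_sum, Prod.fst_sum]
  · rw [Prod.snd_sum, Prod.snd_sum, Finset.sum_neg_distrib]

theorem AgreeBoundary.cochainOp_eq (hd : AgreeBoundary d)
    (H : ∀ u, EdgeForm (coboundary N) u (d u) (κ u)) {u₁ u₂ : Simplex 4} (hl : u₁ ∈ lhsSimplices)
    (hr : u₂ ∈ rhsSimplices) {t : Simplex 3} (h₁ : t.1 ⊆ u₁.1) (h₂ : t.1 ⊆ u₂.1)
    (μ : Simplex 1 → ℂ) : cochainOp u₁ (d u₁) μ t = cochainOp u₂ (d u₂) μ t := by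
  rw [cochainOp_apply_eq_sum (H u₁).support h₁, cochainOp_apply_eq_sum (H u₂).support h₂]
  refine Finset.sum_congr rfl fun a ha => ?_
  rw [hd u₁ hl u₂ hr t h₁ h₂ a (Finset.mem_filter.1 ha).2]

/-- The operators of a 1-cochain for the three 4-simplices on the left-hand side, glued. -/
noncomputable def gluedHom (d : Simplex 4 → Simplex 1 → Op) : (Simplex 1 → ℂ) →ₗ[ℂ] Op :=
  ∑ u ∈ lhsSimplices, cochainHom u (d u)

theorem gluedHom_apply_lhs (H : ∀ u, EdgeForm (coboundary N) u (d u) (κ u)) {u : Simplex 4}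
    (hu : u ∈ lhsSimplices) {t : Simplex 3} (ht : t ∉ innerTetrahedra) (htu : t.1 ⊆ u.1)
    (μ : Simplex 1 → ℂ) : gluedHom d μ t = cochainOp u (d u) μ t := by
  rw [gluedHom, LinearMap.sum_apply, Finset.sum_apply, Finset.sum_eq_single_of_mem u hu]
  · rfl
  · intro u' hu' hne
    exact (H u').cochainOp_mem_opSpace μ t fun h =>
      ht (mem_innerTetrahedra_of_subset u hu u' hu' hne t htu h)

theorem gluedHom_apply_rhs (H : ∀ u, EdgeForm (coboundary N) u (d u) (κ u)) (hd : AgreeBoundary d)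
    {u : Simplex 4} (hu : u ∈ rhsSimplices) {t : Simplex 3} (ht : t ∉ innerTetrahedra)
    (htu : t.1 ⊆ u.1) (μ : Simplex 1 → ℂ) : gluedHom d μ t = cochainOp u (d u) μ t := by
  obtain ⟨⟨u', hu', htu'⟩, -⟩ := exists_subset_of_notMem_innerTetrahedra t ht
  rw [gluedHom_apply_lhs H hu' ht htu', hd.cochainOp_eq H hu' hu htu' htu]

/-- The operators annihilating `F`. -/
noncomputable def annihilator (F : Grassmann) : Submodule ℂ Op :=
  LinearMap.ker (LinearMap.applyₗ F ∘ₗ actHom)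

theorem mem_annihilator {F : Grassmann} {e : Op} : e ∈ annihilator F ↔ act e F = 0 := Iff.rfl

/-- Consistent quasi-Gaussian weights satisfy the 3–3 relation: both sides are nonzero and are
annihilated by the same isotropic space of dimension fifteen. -/
theorem exists_lhs33_eq_smul_rhs33 (hN : ∀ s, coboundary N s ≠ 0) (hκ : ∀ u, κ u ≠ 0)
    (H : ∀ u, EdgeForm (coboundary N) u (d u) (κ u)) (hi : AgreeInner d) (hb : AgreeBoundary d)
    {W : Simplex 4 → Grassmann}
    (hW : ∀ u, IsWeight u (LinearMap.range (cochainHom u (d u))) (W u)) :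
    ∃ const : ℂ, const ≠ 0 ∧ lhs33 W = const • rhs33 W := by
  have hV : ∀ u, LinearMap.range (cochainHom u (d u)) ≤ opSpace u := by
    rintro u _ ⟨μ, rfl⟩
    exact (H u).cochainOp_mem_opSpace μ
  have l₁ : s01234 ∈ lhsSimplices := by decide
  have l₂ : s01235 ∈ lhsSimplices := by decide
  have l₃ : s01245 ∈ lhsSimplices := by decide
  have r₁ : s01345 ∈ rhsSimplices := by decide
  have r₂ : s02345 ∈ rhsSimplices := by decide
  have r₃ : s12345 ∈ rhsSimplices := by decide
  have hF : lhs33 W ≠ 0 := isStar_lhs.berezin_ne_zero hN (hκ _) (hκ _) (hκ _) (H _) (H _) (H _)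
    (hW _) (hW _) (hW _)
  have hG : rhs33 W ≠ 0 := isStar_rhs.berezin_ne_zero hN (hκ _) (hκ _) (hκ _) (H _) (H _) (H _)
    (hW _) (hW _) (hW _)
  have hactl : ∀ (μ : Simplex 1 → ℂ) (e : Op), (∀ t ∈ {t : Simplex 3 | t ∉ innerTetrahedra},
      e t = gluedHom d μ t) → (∀ t ∉ {t : Simplex 3 | t ∉ innerTetrahedra}, (e t).2 = 0) →
      act e (lhs33 W) = 0 := by
    intro μ e he he'
    rw [lhs33]
    refine isStar_lhs.act_berezin_eq_zero (hV s01234) (hV s01235) (hV s01245) (hW s01234) (hW s01235)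
      (hW s01245) (D₁ := cochainOp s01234 (d s01234) μ) (D₂ := cochainOp s01235 (d s01235) μ)
      (D₃ := cochainOp s01245 (d s01245) μ)
      ⟨μ, rfl⟩ ⟨μ, rfl⟩ ⟨μ, rfl⟩
      (hi.cochainOp_eq H (by decide) (Or.inl ⟨l₁, l₂⟩) (by decide) (by decide) μ)
      (hi.cochainOp_eq H (by decide) (Or.inl ⟨l₁, l₃⟩) (by decide) (by decide) μ)
      (hi.cochainOp_eq H (by decide) (Or.inl ⟨l₂, l₃⟩) (by decide) (by decide) μ)
      (fun t ht => ?_) (fun t ht => he' t ?_) fun t n₁ n₂ n₃ => he' t ?_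
    · have key : ∀ u ∈ lhsSimplices, t.1 ⊆ u.1 → e t = cochainOp u (d u) μ t := by
        intro u hu htu
        have ht' : t ∉ innerTetrahedra := fun h =>
          ht (mem_innerTetrahedra_of_subset_lhs u hu t h htu)
        rw [he t ht', gluedHom_apply_lhs H hu ht' htu]
      exact ⟨key _ l₁, key _ l₂, key _ l₃⟩
    · simp only [Set.mem_insert_iff, Set.mem_singleton_iff] at ht
      rw [Set.mem_ofPred_eq, not_not]
      rcases ht with h | h | h <;> rw [h] <;> decide
    · intro ht
      obtain ⟨⟨u, hu, htu⟩, -⟩ := exists_subset_of_notMem_innerTetrahedra t ht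
      simp only [lhsSimplices, Finset.mem_insert, Finset.mem_singleton] at hu
      rcases hu with rfl | rfl | rfl
      exacts [n₁ htu, n₂ htu, n₃ htu]
  have hactr : ∀ (μ : Simplex 1 → ℂ) (e : Op), (∀ t ∈ {t : Simplex 3 | t ∉ innerTetrahedra},
      e t = gluedHom d μ t) → (∀ t ∉ {t : Simplex 3 | t ∉ innerTetrahedra}, (e t).2 = 0) →
      act e (rhs33 W) = 0 := by
    intro μ e he he'
    rw [rhs33]
    refine isStar_rhs.act_berezin_eq_zero (hV s01345) (hV s02345) (hV s12345) (hW s01345) (hW s02345)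
      (hW s12345) (D₁ := cochainOp s01345 (d s01345) μ) (D₂ := cochainOp s02345 (d s02345) μ)
      (D₃ := cochainOp s12345 (d s12345) μ)
      ⟨μ, rfl⟩ ⟨μ, rfl⟩ ⟨μ, rfl⟩
      (hi.cochainOp_eq H (by decide) (Or.inr ⟨r₁, r₂⟩) (by decide) (by decide) μ)
      (hi.cochainOp_eq H (by decide) (Or.inr ⟨r₁, r₃⟩) (by decide) (by decide) μ)
      (hi.cochainOp_eq H (by decide) (Or.inr ⟨r₂, r₃⟩) (by decide) (by decide) μ)
      (fun t ht => ?_) (fun t ht => he' t ?_) fun t n₁ n₂ n₃ => he' t ?_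
    · have key : ∀ u ∈ rhsSimplices, t.1 ⊆ u.1 → e t = cochainOp u (d u) μ t := by
        intro u hu htu
        have ht' : t ∉ innerTetrahedra := fun h =>
          ht (mem_innerTetrahedra_of_subset_rhs u hu t h htu)
        rw [he t ht', gluedHom_apply_rhs H hb hu ht' htu]
      exact ⟨key _ r₁, key _ r₂, key _ r₃⟩
    · simp only [Set.mem_insert_iff, Set.mem_singleton_iff] at ht
      rw [Set.mem_ofPred_eq, not_not]
      rcases ht with h | h | h <;> rw [h] <;> decide
    · intro ht
      obtain ⟨-, u, hu, htu⟩ := exists_subset_of_notMem_innerTetrahedra t ht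
      simp only [rhsSimplices, Finset.mem_insert, Finset.mem_singleton] at hu
      rcases hu with rfl | rfl | rfl
      exacts [n₁ htu, n₂ htu, n₃ htu]
  have hdim := card_add_card_le_finrank {a : Simplex 1 | a.1 ⊆ Finset.univ.erase 0}
    {t : Simplex 3 | t ∉ innerTetrahedra} (gluedHom d) (N - coboundary (cone N 0)) (by
      intro μ hμ h0
      have hzero : ∀ u ∈ lhsSimplices, ∀ t ∉ ({t0123, t0124, t0125} : Set (Simplex 3)),
          t.1 ⊆ u.1 → cochainOp u (d u) μ t = 0 := by
        intro u hu t ht htu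
        have ht' : t ∉ innerTetrahedra := fun h =>
          ht (mem_innerTetrahedra_of_subset_lhs u hu t h htu)
        rw [← gluedHom_apply_lhs H hu ht' htu]
        exact h0 t ht'
      obtain ⟨c, e₁, e₂, e₃⟩ := isStar_lhs.exists_coboundary_eq_of_outer hN (hκ _) (hκ _) (hκ _)
        (H _) (H _) (H _) fun t ht => ⟨hzero _ l₁ t ht, hzero _ l₂ t ht, hzero _ l₃ t ht⟩
      have hc : ∀ u ∈ lhsSimplices, ∀ r : Simplex 2, r.1 ⊆ u.1 →
          coboundary μ r = c * coboundary N r := by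
        intro u hu
        simp only [lhsSimplices, Finset.mem_insert, Finset.mem_singleton] at hu
        rcases hu with rfl | rfl | rfl
        exacts [e₁, e₂, e₃]
      refine ⟨c, fun a _ => eq_mul_of_cyc_eq (fun b hb0 => hμ b fun h => ?_) fun i j hi hj => ?_⟩
      · simpa using h hb0
      · obtain ⟨u, hu, hau⟩ := exists_lhsSimplices_insert_zero_subset a
        exact cyc_eq_of_coboundary_eq (hc u hu) (hau (Finset.mem_insert_self _ _))
          (hau (Finset.mem_insert_of_mem hi)) (hau (Finset.mem_insert_of_mem hj)))
    (annihilator (lhs33 W) ⊓ annihilator (rhs33 W)) fun μ e he he' =>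
      ⟨mem_annihilator.2 (hactl μ e he he'), mem_annihilator.2 (hactr μ e he he')⟩
  have hA : Nat.card {a : Simplex 1 | a.1 ⊆ Finset.univ.erase 0} = 10 :=
    card_simplex_subset 1 (Finset.univ.erase 0)
  have hB : Nat.card ({t : Simplex 3 | t ∉ innerTetrahedra}ᶜ : Set (Simplex 3)) = 6 := by
    have : ({t : Simplex 3 | t ∉ innerTetrahedra}ᶜ : Set (Simplex 3)) = innerTetrahedra := by
      ext; simp
    rw [this, Nat.card_eq_card_toFinset, Finset.toFinset_coe]
    decide
  rw [hA, hB] at hdim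
  refine exists_eq_smul_of_act_eq_zero hF hG (annihilator (lhs33 W) ⊓ annihilator (rhs33 W)) ?_
    (fun e he => mem_annihilator.1 he.1) fun e he => mem_annihilator.1 he.2
  rw [card_simplex]
  change 15 ≤ _
  omega

end

end Pachner

open Pachner
theorem mainTheorem1 :
    ForGenericCocycle fun Ω =>
      -- edge operators of the six 4-simplices can be built from `Ω`
      (∃ (V : Simplex 4 → Submodule ℂ Op) (d : Simplex 4 → Simplex 1 → Op),
        ∀ u, BuiltFrom Ω u (V u) (d u)) ∧
      -- by common factors and gauge transformations, any such edge operators can be made consistent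
      (∀ (V : Simplex 4 → Submodule ℂ Op) (d : Simplex 4 → Simplex 1 → Op),
        (∀ u, BuiltFrom Ω u (V u) (d u)) →
        ∃ (c : Simplex 4 → ℂˣ) (lam : Simplex 4 → Simplex 3 → ℂˣ)
          (S : Simplex 4 → Finset (Simplex 3)) (V' : Simplex 4 → Submodule ℂ Op)
          (d' : Simplex 4 → Simplex 1 → Op),
          (∀ u, V' u = (V u).map (gaugeMap (lam u) (S u))) ∧
          (∀ u a, d' u a = (c u : ℂ) • gaugeMap (lam u) (S u) (d u a)) ∧
          (∀ u, BuiltFrom Ω u (V' u) (d' u)) ∧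
          AgreeInner d' ∧ AgreeBoundary d') ∧
      -- whenever they are consistent, the weights exist and satisfy the 3–3 relation
      (∀ (V : Simplex 4 → Submodule ℂ Op) (d : Simplex 4 → Simplex 1 → Op),
        (∀ u, BuiltFrom Ω u (V u) (d u)) → AgreeInner d → AgreeBoundary d →
        (∃ W : Simplex 4 → Grassmann, ∀ u, IsWeight u (V u) (W u)) ∧
        ∀ W : Simplex 4 → Grassmann, (∀ u, IsWeight u (V u) (W u)) →
          ∃ const : ℂ, const ≠ 0 ∧ lhs33 W = const • rhs33 W) := by
  refine forGenericCocycle_of_forall_ne_zero fun N hN => ⟨?_, fun V d h => ?_, fun V d h hi hb => ?_⟩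
  · obtain ⟨F, hF⟩ := exists_isFactorization hN (coboundary_coboundary N)
    exact ⟨_, fun u => edgeOperators F u 1, fun u => (hF.edgeForm u 1).builtFrom hN one_ne_zero⟩
  · obtain ⟨c, lam, S, h₁, h₂, h₃⟩ := exists_consistent hN h
    exact ⟨c, lam, S, _, _, fun _ => rfl, fun _ _ => rfl, h₁, h₂, h₃⟩
  · refine ⟨⟨_, fun u => (exists_isWeight (h u).maximalIsotropic.prop.1
      (h u).maximalIsotropic.prop.2).choose_spec⟩, fun W hW => ?_⟩
    choose κ hκ H using fun u => (h u).exists_edgeForm hN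
    refine exists_lhs33_eq_smul_rhs33 hN hκ H hi hb fun u => ?_
    rw [range_cochainHom, (h u).edgeSystem.span_eq]
    exact hW u
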